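/- \textbf{Corollary (bicliques).} There are an absolute constant $c$ and a single deterministic algorithm (a unit-cost random access machine program over the natural numbers, with addition, truncated subtraction, comparison and indirect memory access as its operations) with the following property. Let $s \ge t \ge 1$ and $d \ge 0$ be integers and let $G$ be a $d$-degenerate graph on $n$ vertices, that is, the vertices of $G$ can be linearly ordered such that every vertex has at most $d$ neighbours preceding it. Given $s$, $t$ and an adjacency-list representation of $G$ (but not $d$), the algorithm computes the number of biclique patterns $K_{s,t}$ in $G$, i.e. the number of (not necessarily induced) subgraphs of $G$ that are isomorphic to the complete bipartite graph $K_{s,t}$, in time at most \[ c\cdot\bigl(s\cdot(2s)! + d\,2^{d}\,n + n\,(4d)^{s}\,d\,s^{3}\bigr). \] (For fixed $d$ and $s$ this bound is linear in $n$.) -/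

import Mathlib

/-! ## The machine model

A random access machine with finitely many index registers (those named by the program) and an
infinite memory, all of whose cells hold natural numbers. Each instruction and each evaluation of a
branching or loop test costs one time unit. The only arithmetic is addition and truncated
subtraction (there is no multiplication, division or shift), as is usual for unit-cost machines.
Control flow is structured; the program is a finite object that does not depend on the input. -/

namespace RAM

/-- Machine instructions; the arguments are names of registers, except that the second argument of
`const` is a number. -/
inductive Instr : Type where
  /-- `r i := c` -/
  | const (i c : ℕ)
  /-- `r i := r j` -/
  | move (i j : ℕ)
  /-- `r i := r j + r k` -/
  | add (i j k : ℕ)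
  /-- `r i := max (r j - r k) 0` -/
  | sub (i j k : ℕ)
  /-- `r i := mem[r j]` -/
  | load (i j : ℕ)
  /-- `mem[r i] := r j` -/
  | store (i j : ℕ)

/-- Tests: compare two registers. -/
inductive Test : Type where
  /-- `r i < r j` -/
  | lt (i j : ℕ)
  /-- `r i = r j` -/
  | eq (i j : ℕ)

/-- Programs. -/
inductive Prog : Type where
  | skip
  | instr (a : Instr)
  | seq (p q : Prog)
  | ite (b : Test) (p q : Prog)
  /-- Repeat `p` as long as the test `b` succeeds. -/
  | loop (b : Test) (p : Prog)

/-- A machine state: contents of the registers and of the memory. -/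
structure State : Type where
  reg : ℕ → ℕ
  mem : ℕ → ℕ

/-- Write `v` into register `i`. -/
def State.setReg (σ : State) (i v : ℕ) : State :=
  { σ with reg := Function.update σ.reg i v }

/-- Write `v` into the memory cell with address `a`. -/
def State.setMem (σ : State) (a v : ℕ) : State :=
  { σ with mem := Function.update σ.mem a v }

/-- The effect of one instruction. -/
def Instr.exec : Instr → State → State
  | .const i c, σ => σ.setReg i c
  | .move i j, σ => σ.setReg i (σ.reg j)
  | .add i j k, σ => σ.setReg i (σ.reg j + σ.reg k)
  | .sub i j k, σ => σ.setReg i (σ.reg j - σ.reg k)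
  | .load i j, σ => σ.setReg i (σ.mem (σ.reg j))
  | .store i j, σ => σ.setMem (σ.reg i) (σ.reg j)

/-- The test `b` succeeds in the state `σ`. -/
def Test.Holds : Test → State → Prop
  | .lt i j, σ => σ.reg i < σ.reg j
  | .eq i j, σ => σ.reg i = σ.reg j

/-- `Runs p σ T τ`: the program `p`, started in the state `σ`, halts in the state `τ` after exactly
`T` time units. -/
inductive Runs : Prog → State → ℕ → State → Prop where
  | skip (σ : State) : Runs .skip σ 0 σ
  | instr (a : Instr) (σ : State) : Runs (.instr a) σ 1 (a.exec σ)
  | seq {p q : Prog} {σ τ ρ : State} {T U : ℕ} :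
      Runs p σ T τ → Runs q τ U ρ → Runs (.seq p q) σ (T + U) ρ
  | ite_true {b : Test} {p q : Prog} {σ τ : State} {T : ℕ} :
      b.Holds σ → Runs p σ T τ → Runs (.ite b p q) σ (T + 1) τ
  | ite_false {b : Test} {p q : Prog} {σ τ : State} {T : ℕ} :
      ¬ b.Holds σ → Runs q σ T τ → Runs (.ite b p q) σ (T + 1) τ
  | loop_false {b : Test} {p : Prog} {σ : State} :
      ¬ b.Holds σ → Runs (.loop b p) σ 1 σ
  | loop_true {b : Test} {p : Prog} {σ τ ρ : State} {T U : ℕ} :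
      b.Holds σ → Runs p σ T τ → Runs (.loop b p) τ U ρ → Runs (.loop b p) σ (T + U + 1) ρ

end RAM

/-! ## Graphs and their representation -/

/-- `G` is `d`-degenerate: the vertices can be linearly ordered such that every vertex has at most
`d` neighbours that precede it. -/
def SimpleGraph.IsDegenerate {V : Type*} [Fintype V] (G : SimpleGraph V) (d : ℕ) : Prop :=
  ∃ r : LinearOrder V, ∀ v : V, {u : V | G.Adj v u ∧ r.lt u v}.ncard ≤ d

/-- `adj` is an adjacency-list representation of `G`: the list `adj v` contains every neighbour of
`v` exactly once, in an arbitrary order, and nothing else. -/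
def SimpleGraph.IsAdjList {n : ℕ} (G : SimpleGraph (Fin n)) (adj : Fin n → List (Fin n)) : Prop :=
  ∀ v : Fin n, (adj v).Nodup ∧ ∀ u : Fin n, u ∈ adj v ↔ G.Adj v u

/-- The address at which the adjacency list of vertex number `k` starts; for `k = n` the first
address behind all the lists. The addresses `0, …, n` are taken by the table of these starting
addresses. -/
def adjStart {n : ℕ} (adj : Fin n → List (Fin n)) (k : ℕ) : ℕ :=
  (n + 1) + ∑ v : Fin n, if (v : ℕ) < k then (adj v).length else 0

/-- The adjacency lists as a sequence of numbers: the table of the `n + 1` starting addresses,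
followed by the lists of the vertices `0, …, n - 1`. -/
def encodeAdj {n : ℕ} (adj : Fin n → List (Fin n)) : List ℕ :=
  (List.range (n + 1)).map (adjStart adj) ++
    (List.finRange n).flatMap fun v => (adj v).map fun u => (u : ℕ)

/-- The initial state: the registers `0, 1, 2` hold `n`, `s`, `t`, the memory starts with the
adjacency lists, and everything else is zero. -/
def inputState {n : ℕ} (adj : Fin n → List (Fin n)) (s t : ℕ) : RAM.State where
  reg i := if i = 0 then n else if i = 1 then s else if i = 2 then t else 0
  mem i := (encodeAdj adj).getD i 0

/-! Repeatedly removing vertices of small remaining degree and reading the removal order backwards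
gives an order `R` in which every vertex has at most `d` left neighbours, i.e. neighbours preceding
it; `d` need not be known (`wp_eliminate`, `leftOf_reverse_length_le`). A copy of K_{s,t} has a
unique last vertex v in `R`. The side Y opposite to v consists of t or s left neighbours of v, and
the rest Z of the side of v is an arbitrary set, of the complementary size, of common neighbours of
Y that precede v. These triples (v, Y, Z) correspond bijectively to the copies, also for s = t,
because v singles out its own side (`card_triples`). So the answer is a sum, over v and over the
sets Y of s or t left neighbours of v, of binomial coefficients in the number of common neighbours
of Y before v (`sum_pairs_eq`).

To find that number quickly, let w be the last member of Y. A common neighbour before w is one of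
the at most `d` left neighbours of w, which are tested directly against an adjacency matrix. A
common neighbour after w has all of Y among its left neighbours, so Y was enumerated when that
vertex was processed, and a dictionary counts these events (`common_eq`). The dictionary is a trie
whose nodes are multiples of n, so that a child is addressed by an addition. The subsets of the left
neighbours are generated by doubling; each extends an earlier one by one vertex, hence by one step
in the trie.

A vertex costs O(2^d) for the enumeration and O(ds) for each of at most 2d^s relevant sets; the
ordering costs O(dn) and the binomial tables O(sn) (`total_le`). Edgeless graphs are recognised in
constant time; otherwise d ≥ 1. The factorial term only serves to absorb a constant.

The program is written in a small language with a clock and verified by weakest preconditions that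
include time bounds; `cmd_compiles` transfers this to the machine with a constant factor. Memory
behind the input is initially zero, so neither the matrix nor the trie has to be cleared. -/

set_option linter.constructorNameAsVariable false

/-! ## A small imperative language

Programs are written in a language with expressions and sixteen arrays; every command of the
language is simulated by the machine with constant overhead. -/

namespace Biclique

/-- The variables of the language. -/
inductive Var : Type where
  | n | s | t | top | i | j | upto | k | v | u | w | m | free | q | acc | x | head | tail
  | cnt | a | z | good | res | len | y
  deriving DecidableEq

/-- The arrays of the language. -/
inductive Arr : Type where
  | input | deg | ord | mul | trie | left | mat | llen | done | bin | bin2 | dict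
  | code | par | last | dep
  deriving DecidableEq

/-- The number of a variable. -/
def Var.idx : Var → ℕ
  | n => 0 | s => 1 | t => 2 | top => 3 | i => 4 | j => 5 | upto => 6 | k => 7 | v => 8 | u => 9
  | w => 10 | m => 11 | free => 12 | q => 13 | acc => 14 | x => 15 | head => 16 | tail => 17
  | cnt => 18 | a => 19 | z => 20 | good => 21 | res => 22 | len => 23 | y => 24

/-- The number of an array. -/
def Arr.idx : Arr → ℕ
  | input => 0 | deg => 1 | ord => 2 | mul => 3 | trie => 4 | left => 5 | mat => 6 | llen => 7
  | done => 8 | bin => 9 | bin2 => 10 | dict => 11 | code => 12 | par => 13 | last => 14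
  | dep => 15

/-- The variable with a given number. -/
def Var.ofIdx : ℕ → Var
  | 0 => n | 1 => s | 2 => t | 3 => top | 4 => i | 5 => j | 6 => upto | 7 => k | 8 => v | 9 => u
  | 10 => w | 11 => m | 12 => free | 13 => q | 14 => acc | 15 => x | 16 => head | 17 => tail
  | 18 => cnt | 19 => a | 20 => z | 21 => good | 22 => res | 23 => len | _ => y

/-- The array with a given number. -/
def Arr.ofIdx : ℕ → Arr
  | 0 => input | 1 => deg | 2 => ord | 3 => mul | 4 => trie | 5 => left | 6 => mat | 7 => llen
  | 8 => done | 9 => bin | 10 => bin2 | 11 => dict | 12 => code | 13 => par | 14 => last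
  | _ => dep

theorem Var.ofIdx_idx (x : Var) : Var.ofIdx x.idx = x := by cases x <;> rfl

theorem Arr.ofIdx_idx (a : Arr) : Arr.ofIdx a.idx = a := by cases a <;> rfl

theorem Var.idx_inj {x y : Var} (h : x.idx = y.idx) : x = y := by
  rw [← Var.ofIdx_idx x, h, Var.ofIdx_idx]

theorem Arr.idx_inj {a b : Arr} (h : a.idx = b.idx) : a = b := by
  rw [← Arr.ofIdx_idx a, h, Arr.ofIdx_idx]

theorem Arr.idx_lt (a : Arr) : a.idx < 16 := by cases a <;> decide

/-- Expressions. -/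
inductive Exp : Type where
  | var (x : Var)
  | lit (c : ℕ)
  | add (e f : Exp)
  | sub (e f : Exp)
  | get (a : Arr) (e : Exp)

/-- Conditions. -/
inductive Cond : Type where
  | lt (e f : Exp)
  | eq (e f : Exp)

/-- Commands; `read x e` reads the cell `e` of the machine's input. -/
inductive Cmd : Type where
  | skip
  | set (x : Var) (e : Exp)
  | put (a : Arr) (e f : Exp)
  | read (x : Var) (e : Exp)
  | seq (p q : Cmd)
  | ite (b : Cond) (p q : Cmd)
  | loop (b : Cond) (p : Cmd)

/-- Sequential composition. -/
infixr:60 " ;; " => Cmd.seq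

/-- The values of the variables and arrays, together with a clock. -/
structure Store : Type where
  v : Var → ℕ
  a : Arr → ℕ → ℕ
  time : ℕ

namespace Store

/-- Assign to a variable. -/
def set (h : Store) (x : Var) (c : ℕ) : Store :=
  ⟨fun y => if y = x then c else h.v y, h.a, h.time + 1⟩

/-- Assign to an array cell. -/
def put (h : Store) (a : Arr) (i c : ℕ) : Store :=
  ⟨h.v, fun b => if b = a then Function.update (h.a a) i c else h.a b, h.time + 1⟩

/-- Advance the clock. -/
def tick (h : Store) : Store := ⟨h.v, h.a, h.time + 1⟩

@[simp] theorem set_v (h : Store) (x : Var) (c : ℕ) (y : Var) :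
    (h.set x c).v y = if y = x then c else h.v y := rfl
@[simp] theorem set_a (h : Store) (x : Var) (c : ℕ) : (h.set x c).a = h.a := rfl
@[simp] theorem set_time (h : Store) (x : Var) (c : ℕ) : (h.set x c).time = h.time + 1 := rfl
@[simp] theorem put_v (h : Store) (a : Arr) (i c : ℕ) : (h.put a i c).v = h.v := rfl
@[simp] theorem put_a (h : Store) (a : Arr) (i c : ℕ) (b : Arr) :
    (h.put a i c).a b = if b = a then Function.update (h.a a) i c else h.a b := rfl
@[simp] theorem put_time (h : Store) (a : Arr) (i c : ℕ) : (h.put a i c).time = h.time + 1 := rfl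
@[simp] theorem tick_v (h : Store) : h.tick.v = h.v := rfl
@[simp] theorem tick_a (h : Store) : h.tick.a = h.a := rfl
@[simp] theorem tick_time (h : Store) : h.tick.time = h.time + 1 := rfl

end Store

/-- The value of an expression. -/
@[simp] def Exp.eval (h : Store) : Exp → ℕ
  | var x => h.v x
  | lit c => c
  | add e f => e.eval h + f.eval h
  | sub e f => e.eval h - f.eval h
  | get a e => h.a a (e.eval h)

/-- The truth of a condition. -/
@[simp] def Cond.eval (h : Store) : Cond → Prop
  | lt e f => e.eval h < f.eval h
  | eq e f => e.eval h = f.eval h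

/-- Weakest precondition for total correctness, where the input consists of the first `N` values of
`inp`. The invariant of a loop is indexed by a variant that has to decrease. -/
def wp (inp : ℕ → ℕ) (N : ℕ) : Cmd → Store → (Store → Prop) → Prop
  | .skip, h, Q => Q h
  | .set x e, h, Q => Q (h.set x (e.eval h))
  | .put a e f, h, Q => Q (h.put a (e.eval h) (f.eval h))
  | .read x e, h, Q => e.eval h < N ∧ Q (h.set x (inp (e.eval h)))
  | .seq p q, h, Q => wp inp N p h fun h' => wp inp N q h' Q
  | .ite b p q, h, Q => (b.eval h → wp inp N p h.tick Q) ∧ (¬ b.eval h → wp inp N q h.tick Q)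
  | .loop b p, h, Q => ∃ J : ℕ → Store → Prop, (∃ k, J k h) ∧ ∀ k h, J k h →
      (b.eval h → wp inp N p h.tick fun h' => ∃ k' < k, J k' h') ∧ (¬ b.eval h → Q h.tick)

/-- The variables that a command may change. -/
@[simp] def Cmd.vars : Cmd → List Var
  | .skip => []
  | .set x _ => [x]
  | .put _ _ _ => []
  | .read x _ => [x]
  | .seq p q => p.vars ++ q.vars
  | .ite _ p q => p.vars ++ q.vars
  | .loop _ p => p.vars

/-- The arrays that a command may change. -/
@[simp] def Cmd.arrs : Cmd → List Arr
  | .skip => []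
  | .set _ _ => []
  | .put a _ _ => [a]
  | .read _ _ => []
  | .seq p q => p.arrs ++ q.arrs
  | .ite _ p q => p.arrs ++ q.arrs
  | .loop _ p => p.arrs

/-- The two stores agree except on the given variables and arrays. -/
structure Agree (X : List Var) (Y : List Arr) (h h' : Store) : Prop where
  v : ∀ x, x ∉ X → h'.v x = h.v x
  a : ∀ a, a ∉ Y → h'.a a = h.a a

theorem Agree.refl (X : List Var) (Y : List Arr) (h : Store) : Agree X Y h h :=
  ⟨fun _ _ => rfl, fun _ _ => rfl⟩

theorem Agree.trans {X₁ X₂ X : List Var} {Y₁ Y₂ Y : List Arr} {h₁ h₂ h₃ : Store}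
    (A : Agree X₁ Y₁ h₁ h₂) (A' : Agree X₂ Y₂ h₂ h₃) (hX₁ : X₁ ⊆ X) (hX₂ : X₂ ⊆ X)
    (hY₁ : Y₁ ⊆ Y) (hY₂ : Y₂ ⊆ Y) : Agree X Y h₁ h₃ :=
  ⟨fun x hx => (A'.v x fun h => hx (hX₂ h)).trans (A.v x fun h => hx (hX₁ h)),
    fun a ha => (A'.a a fun h => ha (hY₂ h)).trans (A.a a fun h => ha (hY₁ h))⟩

/-! ### Monotonicity and the frame rule for weakest preconditions. -/

section wp

variable {inp : ℕ → ℕ} {N : ℕ}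

theorem wp_mono {p : Cmd} {h : Store} {Q R : Store → Prop} (hp : wp inp N p h Q)
    (hQ : ∀ h', Q h' → R h') : wp inp N p h R := by
  induction p generalizing h Q R with
  | skip => exact hQ _ hp
  | set x e => exact hQ _ hp
  | put a e f => exact hQ _ hp
  | read x e => exact ⟨hp.1, hQ _ hp.2⟩
  | seq p q ihp ihq => exact ihp hp fun h' hh => ihq hh hQ
  | ite b p q ihp ihq => exact ⟨fun hb => ihp (hp.1 hb) hQ, fun hb => ihq (hp.2 hb) hQ⟩
  | loop b p ihp =>
    obtain ⟨J, hJ, hJ'⟩ := hp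
    exact ⟨J, hJ, fun k h hk => ⟨(hJ' k h hk).1, fun hb => hQ _ ((hJ' k h hk).2 hb)⟩⟩

/-- A command changes only the variables and arrays that it assigns to, and the clock does not run
backwards. -/
theorem wp_agree {p : Cmd} {h : Store} {Q : Store → Prop} (hp : wp inp N p h Q) :
    wp inp N p h fun h' => Q h' ∧ Agree p.vars p.arrs h h' := by
  induction p generalizing h Q with
  | skip => exact ⟨hp, Agree.refl ..⟩
  | set x e => exact ⟨hp, ⟨fun y hy => by simp_all, fun _ _ => rfl⟩⟩
  | put a e f => exact ⟨hp, ⟨fun _ _ => rfl, fun b hb => by simp_all⟩⟩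
  | read x e => exact ⟨hp.1, hp.2, ⟨fun y hy => by simp_all, fun _ _ => rfl⟩⟩
  | seq p q ihp ihq =>
    change wp inp N p h fun h' => wp inp N q h' _
    refine wp_mono (ihp hp) fun h' hh => wp_mono (ihq hh.1) fun h'' hh' => ⟨hh'.1, ?_⟩
    exact hh.2.trans hh'.2 (by simp) (by simp) (by simp) (by simp)
  | ite b p q ihp ihq =>
    have htick : Agree [] [] h h.tick := ⟨fun _ _ => rfl, fun _ _ => rfl⟩
    exact ⟨fun hb => wp_mono (ihp (hp.1 hb)) fun h' hh => ⟨hh.1,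
        htick.trans hh.2 (List.nil_subset _) (by simp) (List.nil_subset _) (by simp)⟩,
      fun hb => wp_mono (ihq (hp.2 hb)) fun h' hh => ⟨hh.1,
        htick.trans hh.2 (List.nil_subset _) (by simp) (List.nil_subset _) (by simp)⟩⟩
  | loop b p ihp =>
    obtain ⟨J, ⟨k, hJ⟩, hJ'⟩ := hp
    refine ⟨fun k h' => J k h' ∧ Agree p.vars p.arrs h h', ⟨k, hJ, Agree.refl ..⟩,
      fun k h' hk => ⟨fun hb => ?_, fun hb => ⟨(hJ' k h' hk.1).2 hb, ?_⟩⟩⟩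
    · refine wp_mono (ihp ((hJ' k h' hk.1).1 hb)) fun h'' hh => ?_
      obtain ⟨⟨k', hk', hJk'⟩, hA⟩ := hh
      exact ⟨k', hk', hJk', hk.2.trans (X₂ := p.vars) (Y₂ := p.arrs) ⟨hA.v, hA.a⟩
        (by simp) (by simp) (by simp) (by simp)⟩
    · exact ⟨hk.2.v, hk.2.a⟩

end wp

/-! ### Simulation by the machine -/

open RAM

/-- The state of the machine represents the store: the variables are in the even registers, the
arrays are interleaved behind the input, whose end is in register 1. -/
structure Rep (inp : ℕ → ℕ) (N : ℕ) (σ : State) (h : Store) : Prop where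
  reg : ∀ x : Var, σ.reg (2 * x.idx) = h.v x
  one : σ.reg 1 = N
  inp : ∀ j < N, σ.mem j = inp j
  arr : ∀ (a : Arr) (i : ℕ), σ.mem (N + 16 * i + a.idx) = h.a a i

/-- The state of the machine has changed at most in the odd registers from number `2 * k + 3`
on. -/
structure Temp (k : ℕ) (σ τ : State) : Prop where
  mem : τ.mem = σ.mem
  reg : ∀ r, r % 2 = 0 ∨ r < 2 * k + 3 → τ.reg r = σ.reg r

theorem Temp.rep {inp : ℕ → ℕ} {N k : ℕ} {σ τ : State} {h : Store} (hT : Temp k σ τ)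
    (hR : Rep inp N σ h) : Rep inp N τ h :=
  ⟨fun x => by rw [hT.reg _ (by omega), hR.reg], by rw [hT.reg _ (by omega), hR.one],
    fun j hj => by rw [hT.mem, hR.inp j hj], fun a i => by rw [hT.mem, hR.arr]⟩

theorem Temp.trans {k l m : ℕ} {σ τ ρ : State} (h₁ : Temp l σ τ) (h₂ : Temp m τ ρ) (hl : k ≤ l)
    (hm : k ≤ m) : Temp k σ ρ :=
  ⟨h₂.mem.trans h₁.mem, fun r hr => (h₂.reg r (by omega)).trans (h₁.reg r (by omega))⟩

theorem Temp.setReg (k : ℕ) (σ : State) (c : ℕ) : Temp k σ (σ.setReg (2 * k + 3) c) :=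
  ⟨rfl, fun r hr => by simp only [State.setReg]; rw [Function.update_of_ne (by omega)]⟩

/-- A machine program that computes `f h` in a temporary register in `K` steps. -/
def Computes (f : ℕ → Store → ℕ) (k : ℕ) : Prop :=
  ∃ (P : Prog) (K : ℕ), ∀ inp N σ h, Rep inp N σ h →
    ∃ τ, Runs P σ K τ ∧ τ.reg (2 * k + 3) = f N h ∧ Temp k σ τ

/-- The second operand is evaluated with temporaries of level `k + 1` and above, so the first one
survives in register `2 * k + 3`. -/
theorem Computes.binary {f g : ℕ → Store → ℕ} {k : ℕ} (o : ℕ → ℕ → ℕ) (a : Instr)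
    (ha : ∀ σ : State, a.exec σ =
      σ.setReg (2 * k + 3) (o (σ.reg (2 * k + 3)) (σ.reg (2 * (k + 1) + 3))))
    (hf : Computes f k) (hg : Computes g (k + 1)) :
    Computes (fun N h => o (f N h) (g N h)) k := by
  obtain ⟨P, K, hP⟩ := hf
  obtain ⟨P', K', hP'⟩ := hg
  refine ⟨.seq P (.seq P' (.instr a)), K + (K' + 1), fun inp N σ h hR => ?_⟩
  obtain ⟨τ, h1, h2, h3⟩ := hP inp N σ h hR
  obtain ⟨ρ, h1', h2', h3'⟩ := hP' inp N τ h (h3.rep hR)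
  refine ⟨_, .seq h1 (.seq h1' (.instr _ _)), ?_, ?_⟩
  · rw [ha]
    simp only [State.setReg, Function.update_self]
    rw [h3'.reg _ (by omega), h2, h2']
  · rw [ha]
    exact (h3.trans h3' le_rfl (by omega)).trans (.setReg k ρ _) le_rfl le_rfl

/-- The operation may also use register 1, the length of the input; address computations need this
offset. -/
theorem Computes.unary {f : ℕ → Store → ℕ} {k : ℕ} (o : ℕ → ℕ → ℕ) (a : Instr)
    (ha : ∀ σ : State, a.exec σ = σ.setReg (2 * k + 3) (o (σ.reg 1) (σ.reg (2 * k + 3))))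
    (hf : Computes f k) : Computes (fun N h => o N (f N h)) k := by
  obtain ⟨P, K, hP⟩ := hf
  refine ⟨.seq P (.instr a), K + 1, fun inp N σ h hR => ?_⟩
  obtain ⟨τ, h1, h2, h3⟩ := hP inp N σ h hR
  refine ⟨_, .seq h1 (.instr _ _), ?_, ?_⟩
  · rw [ha]
    simp only [State.setReg, Function.update_self]
    rw [h2, (h3.rep hR).one]
  · rw [ha]
    exact h3.trans (.setReg k τ _) le_rfl le_rfl

theorem computes_lit (c k : ℕ) : Computes (fun _ _ => c) k :=
  ⟨.instr (.const (2 * k + 3) c), 1, fun _ _ σ _ _ =>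
    ⟨_, .instr _ _, by simp [Instr.exec, State.setReg], .setReg k σ _⟩⟩

/-- The address of an array cell. -/
theorem Computes.address {f : ℕ → Store → ℕ} {k : ℕ} (a : Arr) (hf : Computes f k) :
    Computes (fun N h => N + 16 * f N h + a.idx) k := by
  have double : ∀ {f : ℕ → Store → ℕ}, Computes f k → Computes (fun N h => f N h + f N h) k :=
    fun hf => hf.unary (fun _ y => y + y) (.add (2 * k + 3) (2 * k + 3) (2 * k + 3)) fun _ => rfl
  -- Four doublings replace the missing multiplication by 16.
  have h16 := ((double (double (double (double hf)))).unary (fun x y => x + y)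
    (.add (2 * k + 3) 1 (2 * k + 3)) fun _ => rfl).binary (fun x y => x + y)
    (.add (2 * k + 3) (2 * k + 3) (2 * (k + 1) + 3)) (fun _ => rfl) (computes_lit a.idx (k + 1))
  convert h16 using 3
  ring

theorem exp_computes (e : Exp) (k : ℕ) : Computes (fun _ h => e.eval h) k := by
  induction e generalizing k with
  | var x =>
    refine ⟨.instr (.move (2 * k + 3) (2 * x.idx)), 1, fun _ _ σ _ hR =>
      ⟨_, .instr _ _, ?_, .setReg k σ _⟩⟩
    simp [Instr.exec, State.setReg, hR.reg]
  | lit c => exact computes_lit c k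
  | add e f ihe ihf =>
    exact (ihe k).binary (fun x y => x + y) (.add (2 * k + 3) (2 * k + 3) (2 * (k + 1) + 3))
      (fun _ => rfl) (ihf (k + 1))
  | sub e f ihe ihf =>
    exact (ihe k).binary (fun x y => x - y) (.sub (2 * k + 3) (2 * k + 3) (2 * (k + 1) + 3))
      (fun _ => rfl) (ihf (k + 1))
  | get a e ih =>
    obtain ⟨P, K, hP⟩ := (ih k).address a
    refine ⟨.seq P (.instr (.load (2 * k + 3) (2 * k + 3))), K + 1, fun inp N σ h hR => ?_⟩
    obtain ⟨τ, h1, h2, h3⟩ := hP inp N σ h hR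
    refine ⟨_, .seq h1 (.instr _ _), ?_, h3.trans (.setReg k τ _) le_rfl le_rfl⟩
    simp [Instr.exec, State.setReg, h2, (h3.rep hR).arr]

/-- A condition is evaluated by a program followed by a test. -/
theorem cond_computes (b : Cond) : ∃ (P : Prog) (K : ℕ) (c : Test), ∀ inp N σ h, Rep inp N σ h →
    ∃ τ, Runs P σ K τ ∧ (c.Holds τ ↔ b.eval h) ∧ Temp 0 σ τ := by
  have key : ∀ e f : Exp, ∃ (P : Prog) (K : ℕ), ∀ inp N σ h, Rep inp N σ h →
      ∃ τ, Runs P σ K τ ∧ τ.reg 3 = e.eval h ∧ τ.reg 5 = f.eval h ∧ Temp 0 σ τ := by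
    intro e f
    obtain ⟨P, K, hP⟩ := exp_computes e 0
    obtain ⟨P', K', hP'⟩ := exp_computes f 1
    refine ⟨.seq P P', K + K', fun inp N σ h hR => ?_⟩
    obtain ⟨τ, h1, h2, h3⟩ := hP inp N σ h hR
    obtain ⟨ρ, h1', h2', h3'⟩ := hP' inp N τ h (h3.rep hR)
    exact ⟨ρ, .seq h1 h1', by rw [h3'.reg _ (by omega)]; exact h2, h2',
      h3.trans h3' le_rfl (by omega)⟩
  cases b with
  | lt e f =>
    obtain ⟨P, K, hP⟩ := key e f
    refine ⟨P, K, .lt 3 5, fun inp N σ h hR => ?_⟩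
    obtain ⟨τ, h1, h2, h3, h4⟩ := hP inp N σ h hR
    exact ⟨τ, h1, by simp [Test.Holds, h2, h3], h4⟩
  | eq e f =>
    obtain ⟨P, K, hP⟩ := key e f
    refine ⟨P, K, .eq 3 5, fun inp N σ h hR => ?_⟩
    obtain ⟨τ, h1, h2, h3, h4⟩ := hP inp N σ h hR
    exact ⟨τ, h1, by simp [Test.Holds, h2, h3], h4⟩

theorem Rep.setVar {inp : ℕ → ℕ} {N : ℕ} {σ : State} {h : Store} (hR : Rep inp N σ h) (x : Var)
    (c : ℕ) : Rep inp N (σ.setReg (2 * x.idx) c) (h.set x c) := by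
  refine ⟨fun y => ?_, ?_, hR.inp, hR.arr⟩
  · simp only [State.setReg, Store.set_v, Function.update_apply]
    by_cases hxy : y = x
    · simp [hxy]
    · have : y.idx ≠ x.idx := fun h => hxy (Var.idx_inj h)
      rw [if_neg (by omega), if_neg hxy, hR.reg]
  · simp only [State.setReg]
    rw [Function.update_of_ne (by omega), hR.one]

/-- Array numbers are below 16, so different arrays occupy different residue classes behind `N`, and
the input is never overwritten. -/
theorem Rep.setArr {inp : ℕ → ℕ} {N : ℕ} {σ : State} {h : Store} (hR : Rep inp N σ h) (a : Arr)
    (i c : ℕ) : Rep inp N (σ.setMem (N + 16 * i + a.idx) c) (h.put a i c) := by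
  refine ⟨hR.reg, hR.one, fun j hj => ?_, fun b j => ?_⟩
  · simp only [State.setMem]
    rw [Function.update_of_ne (by omega), hR.inp j hj]
  · simp only [State.setMem, Store.put_a, Function.update_apply]
    have ha := a.idx_lt
    have hb := b.idx_lt
    by_cases hab : b = a
    · subst hab
      by_cases hij : j = i
      · simp [hij]
      · rw [if_neg (by omega), if_pos rfl, hR.arr, Function.update_of_ne hij]
    · have : b.idx ≠ a.idx := fun h => hab (Arr.idx_inj h)
      rw [if_neg (by omega), if_neg hab, hR.arr]

/-- Every command is simulated by a machine program with constant overhead. -/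
theorem cmd_compiles (p : Cmd) : ∃ (P : Prog) (K : ℕ), ∀ inp N σ h Q, Rep inp N σ h →
    wp inp N p h Q → ∃ T τ h', Runs P σ T τ ∧ Rep inp N τ h' ∧ Q h' ∧
      T + K * h.time ≤ K * h'.time ∧ h.time ≤ h'.time := by
  induction p with
  | skip => exact ⟨.skip, 0, fun inp N σ h Q hR hQ => ⟨0, σ, h, .skip σ, hR, hQ, by simp⟩⟩
  | set x e =>
    obtain ⟨P, K, hP⟩ := exp_computes e 0
    refine ⟨.seq P (.instr (.move (2 * x.idx) 3)), K + 1, fun inp N σ h Q hR hQ => ?_⟩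
    obtain ⟨τ, h1, h2, h3⟩ := hP inp N σ h hR
    refine ⟨_, _, _, .seq h1 (.instr _ _), ?_, hQ, ?_⟩
    · have e3 : τ.reg 3 = e.eval h := h2
      simpa [Instr.exec, e3] using (h3.rep hR).setVar x (e.eval h)
    · simp [mul_add]; omega
  | put a e f =>
    obtain ⟨P, K, hP⟩ := (exp_computes e 0).address a
    obtain ⟨P', K', hP'⟩ := exp_computes f 1
    refine ⟨.seq P (.seq P' (.instr (.store 3 5))), K + (K' + 1), fun inp N σ h Q hR hQ => ?_⟩
    obtain ⟨τ, h1, h2, h3⟩ := hP inp N σ h hR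
    obtain ⟨ρ, h1', h2', h3'⟩ := hP' inp N τ h (h3.rep hR)
    refine ⟨_, _, _, .seq h1 (.seq h1' (.instr _ _)), ?_, hQ, ?_⟩
    · have := (h3'.rep (h3.rep hR)).setArr a (e.eval h) (f.eval h)
      have e3 : ρ.reg 3 = N + 16 * e.eval h + a.idx := by rw [h3'.reg _ (by omega)]; exact h2
      have e5 : ρ.reg 5 = f.eval h := h2'
      simpa [Instr.exec, e3, e5] using this
    · simp [mul_add]; omega
  | read x e =>
    obtain ⟨P, K, hP⟩ := exp_computes e 0
    refine ⟨.seq P (.instr (.load (2 * x.idx) 3)), K + 1, fun inp N σ h Q hR hQ => ?_⟩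
    obtain ⟨τ, h1, h2, h3⟩ := hP inp N σ h hR
    refine ⟨_, _, _, .seq h1 (.instr _ _), ?_, hQ.2, ?_⟩
    · have := (h3.rep hR).setVar x (inp (e.eval h))
      have e3 : τ.reg 3 = e.eval h := h2
      simpa [Instr.exec, e3, (h3.rep hR).inp _ hQ.1] using this
    · simp [mul_add]; omega
  | seq p q ihp ihq =>
    obtain ⟨P, K, hP⟩ := ihp
    obtain ⟨P', K', hP'⟩ := ihq
    refine ⟨.seq P P', K + K', fun inp N σ h Q hR hQ => ?_⟩
    obtain ⟨T, τ, h', h1, h2, h3, h4, h5⟩ := hP inp N σ h _ hR hQ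
    obtain ⟨T', ρ, h'', h1', h2', h3', h4', h5'⟩ := hP' inp N τ h' Q h2 h3
    refine ⟨_, _, _, .seq h1 h1', h2', h3', ?_, h5.trans h5'⟩
    have := Nat.mul_le_mul_left K h5'
    have := Nat.mul_le_mul_left K' h5
    rw [add_mul, add_mul]
    omega
  | ite b p q ihp ihq =>
    obtain ⟨P₀, K₀, c, hP₀⟩ := cond_computes b
    obtain ⟨P, K, hP⟩ := ihp
    obtain ⟨P', K', hP'⟩ := ihq
    refine ⟨.seq P₀ (.ite c P P'), K₀ + 1 + K + K', fun inp N σ h Q hR hQ => ?_⟩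
    obtain ⟨τ, h1, h2, h3⟩ := hP₀ inp N σ h hR
    have hR' : Rep inp N τ h.tick := ⟨(h3.rep hR).reg, (h3.rep hR).one, (h3.rep hR).inp,
      (h3.rep hR).arr⟩
    by_cases hb : b.eval h
    · obtain ⟨T, ρ, h', h1', h2', h3', h4', h5'⟩ := hP inp N τ h.tick _ hR' (hQ.1 hb)
      refine ⟨_, _, _, .seq h1 (.ite_true (h2.2 hb) h1'), h2', h3', ?_, ?_⟩
      · simp only [Store.tick_time] at h4' h5'
        have := Nat.mul_le_mul_left (K₀ + 1 + K') h5'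
        simp only [add_mul, mul_add] at *
        omega
      · simp only [Store.tick_time] at h5'
        omega
    · obtain ⟨T, ρ, h', h1', h2', h3', h4', h5'⟩ := hP' inp N τ h.tick _ hR' (hQ.2 hb)
      refine ⟨_, _, _, .seq h1 (.ite_false (h2.not.2 hb) h1'), h2', h3', ?_, ?_⟩
      · simp only [Store.tick_time] at h4' h5'
        have := Nat.mul_le_mul_left (K₀ + 1 + K) h5'
        simp only [add_mul, mul_add] at *
        omega
      · simp only [Store.tick_time] at h5'
        omega
  | loop b p ihp =>
    obtain ⟨P₀, K₀, c, hP₀⟩ := cond_computes b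
    obtain ⟨P, K, hP⟩ := ihp
    -- A machine loop only compares registers, so the operands of the test are computed before the
    -- loop and again at the end of each round.
    refine ⟨.seq P₀ (.loop c (.seq P P₀)), K₀ + 1 + K, fun inp N σ h Q hR hQ => ?_⟩
    obtain ⟨J, ⟨k, hJ⟩, hJ'⟩ := hQ
    obtain ⟨τ, h1, h2, h3⟩ := hP₀ inp N σ h hR
    -- The summand `K₀` pays for the evaluation of the test that has already happened on entry to
    -- `τ`.
    suffices H : ∀ k τ h, J k h → Rep inp N τ h → (c.Holds τ ↔ b.eval h) →
        ∃ T ρ h', Runs (.loop c (.seq P P₀)) τ T ρ ∧ Rep inp N ρ h' ∧ Q h' ∧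
          K₀ + T + (K₀ + 1 + K) * h.time ≤ (K₀ + 1 + K) * h'.time ∧ h.time ≤ h'.time by
      obtain ⟨T, ρ, h', h1', h2', h3', h4'⟩ := H k τ h hJ (h3.rep hR) h2
      exact ⟨_, _, _, .seq h1 h1', h2', h3', h4'⟩
    clear h1 h2 h3 hJ hR σ τ k h
    intro k
    induction k using Nat.strong_induction_on with
    | _ k ih =>
      intro τ h hJ hR hc
      have hR' : Rep inp N τ h.tick := ⟨hR.reg, hR.one, hR.inp, hR.arr⟩
      by_cases hb : b.eval h
      · obtain ⟨T, ρ, h', h1, h2, ⟨k', hk', hJk⟩, h4, h5⟩ := hP inp N τ h.tick _ hR'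
          ((hJ' k h hJ).1 hb)
        obtain ⟨ρ', h1', h2', h3'⟩ := hP₀ inp N ρ h' h2
        obtain ⟨T', ρ'', h'', g1, g2, g3, g4, g5⟩ := ih k' hk' ρ' h' hJk (h3'.rep h2) h2'
        refine ⟨_, _, _, .loop_true (hc.2 hb) (.seq h1 h1') g1, g2, g3, ?_, ?_⟩
        · simp only [Store.tick_time] at h4 h5
          have := Nat.mul_le_mul_left (K₀ + 1) h5
          simp only [add_mul, mul_add] at *
          omega
        · simp only [Store.tick_time] at h5
          omega
      · refine ⟨_, _, _, .loop_false (hc.not.2 hb), hR', (hJ' k h hJ).2 hb, ?_, ?_⟩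
        · simp only [Store.tick_time, mul_add]
          omega
        · simp

end Biclique

namespace Biclique

/-! ### Loops -/

/-- Run `p` for `x = 0, 1, …` as long as `x` is less than `e`. -/
def Cmd.forTo (x : Var) (e : Exp) (p : Cmd) : Cmd :=
  .set x (.lit 0) ;; .loop (.lt (.var x) e) (p ;; .set x (.add (.var x) (.lit 1)))

/-- Run `p` for all neighbours `y` of the vertex `x`. -/
def Cmd.forNbr (x : Var) (p : Cmd) : Cmd :=
  .set .j (.get .input (.var x)) ;;
  .set .upto (.get .input (.add (.var x) (.lit 1))) ;;
  .loop (.lt (.var .j) (.var .upto))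
    (.set .y (.get .input (.var .j)) ;; p ;; .set .j (.add (.var .j) (.lit 1)))

@[simp] theorem vars_forTo (x : Var) (e : Exp) (p : Cmd) :
    (Cmd.forTo x e p).vars = x :: (p.vars ++ [x]) := rfl

@[simp] theorem arrs_forTo (x : Var) (e : Exp) (p : Cmd) :
    (Cmd.forTo x e p).arrs = p.arrs ++ [] := rfl

@[simp] theorem vars_forNbr (x : Var) (p : Cmd) :
    (Cmd.forNbr x p).vars = .j :: .upto :: .y :: (p.vars ++ [.j]) := rfl

@[simp] theorem arrs_forNbr (x : Var) (p : Cmd) : (Cmd.forNbr x p).arrs = p.arrs ++ [] := rfl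

/-- The assertion does not depend on the given variables and the clock. -/
def Indep (X : List Var) (J : Store → Prop) : Prop :=
  ∀ h h', J h → (∀ x, x ∉ X → h'.v x = h.v x) → h'.a = h.a → J h'

variable {inp : ℕ → ℕ} {N : ℕ}

/-- The variant is `M - k`. Each round pays 2 for test and increment, and the final 2 covers the
initialisation and the failing test. -/
theorem wp_forTo {x : Var} {e : Exp} {p : Cmd} {h : Store} {Q : Store → Prop} (M : ℕ) (K : ℕ → ℕ)
    (J : ℕ → Store → Prop) (hx : x ∉ p.vars) (hJ : ∀ k, Indep [x] (J k)) (h0 : J 0 h)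
    (he : ∀ k h', J k h' → Agree (x :: p.vars) p.arrs h h' → e.eval h' = M)
    (hs : ∀ k < M, ∀ h', J k h' → h'.v x = k → Agree (x :: p.vars) p.arrs h h' →
      wp inp N p h' fun h'' => J (k + 1) h'' ∧ h''.time ≤ h'.time + K k)
    (hQ : ∀ h', J M h' → Agree (x :: p.vars) p.arrs h h' →
      h'.time ≤ h.time + (∑ k ∈ Finset.range M, (K k + 2) + 2) → Q h') :
    wp inp N (Cmd.forTo x e p) h Q := by
  refine ⟨fun m h' => ∃ k ≤ M, m = M - k ∧ J k h' ∧ h'.v x = k ∧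
    Agree (x :: p.vars) p.arrs h h' ∧
    h'.time ≤ h.time + (∑ k ∈ Finset.range k, (K k + 2) + 1), ⟨M, 0, by simp, by simp, ?_, ?_, ?_,
    by simp⟩, ?_⟩
  · exact hJ 0 h _ h0 (fun y hy => by simp_all) rfl
  · simp
  · exact ⟨fun y hy => by simp_all, fun _ _ => rfl⟩
  · rintro m h' ⟨k, hk, rfl, hJk, hxk, hA, ht⟩
    have hA' : Agree (x :: p.vars) p.arrs h h'.tick := ⟨hA.v, hA.a⟩
    have hev := he k h' hJk hA
    refine ⟨fun hb => ?_, fun hb => ?_⟩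
    · have hlt : k < M := by simpa [hxk, hev] using hb
      simp only [wp]
      refine wp_mono (wp_agree (hs k hlt h'.tick (hJ k h' _ hJk (fun _ _ => rfl) rfl) hxk hA'))
        fun h'' hh => ?_
      obtain ⟨⟨hJ'', ht''⟩, hA''⟩ := hh
      have hxk' : h''.v x = k := by rw [hA''.v x hx]; exact hxk
      have hA3 := hA'.trans hA'' (X := x :: p.vars) (Y := p.arrs) (by simp) (by simp) (by simp)
        (by simp)
      refine ⟨M - (k + 1), by omega, k + 1, hlt, rfl,
        hJ _ h'' _ hJ'' (fun y hy => by simp_all) rfl, by simp [hxk'],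
        ⟨fun y hy => ?_, fun a ha => hA3.a a ha⟩, ?_⟩
      · rw [← hA3.v y hy]
        simp only [List.mem_cons, not_or] at hy
        simp [hy.1]
      · simp only [Exp.eval, Store.set_time, Finset.sum_range_succ, Store.tick_time] at ht'' ⊢
        omega
    · have hle : k = M := by
        have : ¬ k < M := by simpa [hxk, hev] using hb
        omega
      subst hle
      refine hQ _ (hJ k h' _ hJk (fun _ _ => rfl) rfl) hA' ?_
      simp only [Store.tick_time]
      omega

/-- Each round pays 3 for the test, fetching the neighbour and the increment; the final 3 covers two
initialisations and the failing test. -/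
theorem wp_forNbr {x : Var} {p : Cmd} {h : Store} {Q : Store → Prop} (l : List ℕ) (K : ℕ)
    (J : ℕ → Store → Prop) (hj : .j ∉ p.vars) (hupto : .upto ∉ p.vars) (hp : .input ∉ p.arrs)
    (hx : x ≠ .j)
    (hJ : ∀ k, Indep [.j, .upto, .y] (J k)) (h0 : J 0 h)
    (hl : h.a .input (h.v x + 1) = h.a .input (h.v x) + l.length)
    (hl' : ∀ k (hk : k < l.length), h.a .input (h.a .input (h.v x) + k) = l[k])
    (hs : ∀ k (hk : k < l.length) h', J k h' → h'.v .y = l[k] →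
      Agree (.j :: .upto :: .y :: p.vars) p.arrs h h' →
      wp inp N p h' fun h'' => J (k + 1) h'' ∧ h''.time ≤ h'.time + K)
    (hQ : ∀ h', J l.length h' → Agree (.j :: .upto :: .y :: p.vars) p.arrs h h' →
      h'.time ≤ h.time + (l.length * (K + 3) + 3) → Q h') :
    wp inp N (Cmd.forNbr x p) h Q := by
  set st := h.a .input (h.v x) with hst
  refine ⟨fun m h' => ∃ k ≤ l.length, m = l.length - k ∧ J k h' ∧ h'.v .j = st + k ∧
    h'.v .upto = st + l.length ∧
    Agree (.j :: .upto :: .y :: p.vars) p.arrs h h' ∧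
    h'.time ≤ h.time + (k * (K + 3) + 2), ⟨l.length, 0, by simp, by simp, ?_, ?_, ?_, ?_,
    by simp⟩, ?_⟩
  · exact hJ 0 h _ h0 (fun y hy => by simp_all) rfl
  · simp [hst]
  · simp [hl, hx]
  · exact ⟨fun y hy => by simp_all, fun _ _ => rfl⟩
  · rintro m h' ⟨k, hk, rfl, hJk, hjk, hsk, hA, ht⟩
    refine ⟨fun hb => ?_, fun hb => ?_⟩
    · have hlt : k < l.length := by simpa [hjk, hsk] using hb
      have hval : h'.a .input (h'.v .j) = l[k] := by rw [hjk, hA.a _ hp, hl' k hlt]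
      have hA' : Agree (.j :: .upto :: .y :: p.vars) p.arrs h
          (h'.tick.set .y (h'.a .input (h'.v .j))) := by
        refine ⟨fun y hy => ?_, fun a ha => hA.a a ha⟩
        rw [← hA.v y hy]
        simp only [List.mem_cons, not_or] at hy
        simp [hy.2.2.1]
      simp only [wp]
      refine wp_mono (wp_agree (hs k hlt (h'.tick.set .y (h'.a .input (h'.v .j)))
        (hJ k h' _ hJk (fun y hy => by simp_all) rfl) (by simp [hval]) hA')) fun h'' hh => ?_
      obtain ⟨⟨hJ'', ht''⟩, hA''⟩ := hh
      have hjk' : h''.v .j = st + k := by rw [hA''.v _ hj]; simpa using hjk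
      have hsk' : h''.v .upto = st + l.length := by rw [hA''.v _ hupto]; simpa using hsk
      have hA3 := hA'.trans hA'' (X := .j :: .upto :: .y :: p.vars) (Y := p.arrs) (by simp)
        (fun z hz => by simp [hz]) (by simp) (by simp)
      refine ⟨l.length - (k + 1), by omega, k + 1, hlt, rfl,
        hJ _ h'' _ hJ'' (fun y hy => by simp_all) rfl, by simp [hjk', add_assoc], by simp [hsk'],
        ⟨fun y hy => ?_, fun a ha => hA3.a a ha⟩, ?_⟩
      · rw [← hA3.v y hy]
        simp only [List.mem_cons, not_or] at hy
        simp [hy.1]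
      · simp only [Exp.eval, Store.set_time, Store.tick_time, add_mul, one_mul] at ht'' ⊢
        omega
    · have hle : k = l.length := by
        have : ¬ k < l.length := by simpa [hjk, hsk] using hb
        omega
      refine hQ _ (hJ _ h' _ (hle ▸ hJk) (fun _ _ => rfl) rfl) ⟨hA.v, hA.a⟩ ?_
      simp only [Store.tick_time]
      rw [hle] at ht
      omega

end Biclique

namespace Biclique

variable {inp : ℕ → ℕ} {N : ℕ}

/-! ### Preparation -/

/-- Copy the input into an array. -/
def copyInput : Cmd :=
  .forTo .j (.var .top) (.read .x (.var .j) ;; .put .input (.var .j) (.var .x))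

/-- Expressions can access arrays but not the input itself; all later phases work on this copy. -/
theorem wp_copyInput (h : Store) (hN : h.v .top = N) :
    wp inp N copyInput h fun h' => (∀ i < N, h'.a .input i = inp i) ∧
      h'.time ≤ h.time + (4 * N + 2) := by
  refine wp_forTo N (fun _ => 2) (fun k h' => ∀ i < k, h'.a .input i = inp i) (by decide)
    (fun k h h' hJ hv ha => by simpa [ha] using hJ) (by simp)
    (fun k h' _ hA => by simp [← hN, hA.v .top (by decide)]) ?_ ?_
  · intro k hk h' hJ hj hA
    simp only [wp, Exp.eval, hj]
    refine ⟨hk, fun i hi => ?_, by simp⟩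
    rcases Nat.lt_succ_iff_lt_or_eq.1 hi with hi | rfl
    · simp [hj, Function.update_of_ne hi.ne, hJ i hi]
    · simp [hj]
  · intro h' hJ hA ht
    refine ⟨hJ, ht.trans_eq ?_⟩
    simp
    ring

/-- Compute the degrees and the multiples of the number of vertices. -/
def initTables : Cmd :=
  .set .m (.lit 0) ;;
  .forTo .v (.var .n) (
    .put .deg (.var .v)
      (.sub (.get .input (.add (.var .v) (.lit 1))) (.get .input (.var .v))) ;;
    .put .mul (.var .v) (.var .m) ;; .set .m (.add (.var .m) (.var .n)))

/-- The multiples of `n` are accumulated by addition; they are the row offsets of the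
two-dimensional tables used later. -/
theorem wp_initTables (h : Store) : wp inp N initTables h fun h' =>
    (∀ v < h.v .n, h'.a .deg v = h.a .input (v + 1) - h.a .input v ∧
      h'.a .mul v = v * h.v .n) ∧
    h'.time ≤ h.time + (5 * h.v .n + 3) := by
  simp only [initTables, wp]
  refine wp_forTo (h.v .n) (fun _ => 3) (fun k h' => h'.v .m = k * h.v .n ∧
    ∀ v < k, h'.a .deg v = h.a .input (v + 1) - h.a .input v ∧
      h'.a .mul v = v * h.v .n) (by decide)
    (fun k h h' hJ hv ha => by simpa [ha, hv] using hJ) (by simp)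
    (fun k h' _ hA => by simp [hA.v .n (by decide)]) ?_ ?_
  · intro k hk h' hJ hj hA
    have h1 := hA.v .n (by decide)
    have h2 := hA.a .input (by decide)
    simp at h1 h2
    obtain ⟨hm, hJ⟩ := hJ
    simp [wp, h1, h2, hj, hm]
    refine ⟨by ring, fun v hv => ?_⟩
    rcases Nat.lt_or_eq_of_le hv with hv | rfl
    · simpa [Function.update_of_ne hv.ne] using hJ v hv
    · simp
  · intro h' hJ hA ht
    refine ⟨hJ.2, ht.trans_eq ?_⟩
    simp
    ring

/-- Fill the array `A` with the binomial coefficients `v.choose (L - 1)`. -/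
def binomials (A : Arr) (L : Var) : Cmd :=
  .forTo .v (.var .n) (.put A (.var .v) (.lit 1)) ;;
  .forTo .j (.sub (.var L) (.lit 1)) (
    .set .acc (.lit 0) ;;
    .forTo .v (.var .n) (
      .set .x (.get A (.var .v)) ;; .put A (.var .v) (.var .acc) ;;
      .set .acc (.add (.var .acc) (.var .x))))

/-- The sum of C(i, k) over i < v is C(v, k + 1). Hence replacing a column by its prefix sums moves
from k to k + 1, and `L - 1` such passes are applied to a column of ones. -/
theorem wp_binomials (A : Arr) (L : Var) (hL : L = .s ∨ L = .t) (h : Store) (h0 : 1 ≤ h.v L) :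
    wp inp N (binomials A L) h fun h' =>
      (∀ v < h.v .n, h'.a A v = v.choose (h.v L - 1)) ∧
      h'.time ≤ h.time + 5 * ((h.v .n + 1) * h.v L) := by
  set n := h.v .n with hn
  obtain ⟨s, hs⟩ : ∃ s, h.v L = s + 1 := ⟨h.v L - 1, by omega⟩
  simp only [binomials, wp]
  refine wp_forTo n (fun _ => 1) (fun k h' => ∀ v < k, h'.a A v = 1) (by simp)
    (fun k h h' hJ hv ha => by simpa [ha] using hJ) (by simp)
    (fun k h' _ hA => by simp [hA.v .n (by simp), hn]) ?_ ?_
  · intro k hk h' hJ hj hA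
    simp only [wp]
    refine ⟨fun v hv => ?_, by simp⟩
    rcases Nat.lt_succ_iff_lt_or_eq.1 hv with hv | rfl
    · simp [hj, Function.update_of_ne hv.ne, hJ v hv]
    · simp [hj]
  · intro h₁ hJ₁ hA₁ ht₁
    have hLv : L ∉ ([.v, .j, .acc, .x] : List Var) := by rcases hL with rfl | rfl <;> decide
    simp only [List.mem_cons, not_or] at hLv
    refine wp_forTo s (fun _ => 5 * n + 3)
      (fun k h' => ∀ v < n, h'.a A v = v.choose k) (by simp)
      (fun k h h' hJ hv ha => by simpa [ha] using hJ) (by simpa using hJ₁)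
      (fun k h' _ hA => ?_) ?_ ?_
    · have e1 := hA.v L (by simp [hLv])
      have e2 := hA₁.v L (by simp [hLv])
      simp [e1, e2, hs]
    · intro k hk h₂ hJ₂ hj₂ hA₂
      simp only [wp]
      have hn2 : h₂.v .n = n := by
        rw [hA₂.v .n (by simp), hA₁.v .n (by simp)]
      -- The pass works in place: cells below `i` are already new, the others still old, and the
      -- accumulator holds the next new entry.
      refine wp_forTo n (fun _ => 3) (fun i h' => h'.v .acc = i.choose (k + 1) ∧
        (∀ v < i, h'.a A v = v.choose (k + 1)) ∧ ∀ v < n, i ≤ v → h'.a A v = v.choose k) (by simp)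
        (fun k h h' hJ hv ha => by simpa [ha, hv] using hJ) ?_
        (fun k h' _ hA => by simp [hA.v .n (by simp), hn2]) ?_ ?_
      · simpa using hJ₂
      · rintro i hi h₃ ⟨hJa, hJb, hJc⟩ hi₃ hA₃
        simp [wp, hi₃, hJa]
        refine ⟨?_, fun v hv => ?_, fun v hv hiv => ?_⟩
        · rw [hJc i hi le_rfl, Nat.choose_succ_succ, add_comm]
        · rcases Nat.lt_or_eq_of_le hv with hv | rfl
          · simp [Function.update_of_ne hv.ne, hJb v hv]
          · simp
        · rw [Function.update_of_ne (by omega), hJc v hv (by omega)]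
      · intro h₃ hJ₃ hA₃ ht₃
        refine ⟨hJ₃.2.1, ht₃.trans ?_⟩
        simp
        omega
    · intro h₂ hJ₂ hA₂ ht₂
      refine ⟨by simpa [hs] using hJ₂, ht₂.trans ((Nat.add_le_add_right ht₁ _).trans ?_)⟩
      simp [hs]
      nlinarith

end Biclique

namespace Biclique

variable {inp : ℕ → ℕ} {N : ℕ}

/-! ### Degeneracy orderings -/

theorem getElem_notMem_take {α : Type*} {L : List α} (hL : L.Nodup) {i : ℕ} (hi : i < L.length) :
    L[i] ∉ L.take i := by
  intro h
  obtain ⟨j, hj, hji⟩ := List.mem_take_iff_getElem.1 h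
  have := (hL.getElem_inj_iff).1 hji
  omega

/-- Adjacency lists of a graph whose vertices are the numbers below `n`. -/
structure AdjLists (n : ℕ) : Type where
  nb : ℕ → List ℕ
  nodup : ∀ v, (nb v).Nodup
  symm : ∀ {u v}, u ∈ nb v → v ∈ nb u
  irrefl : ∀ v, v ∉ nb v
  lt : ∀ {u v}, u ∈ nb v → u < n

namespace AdjLists

variable {n : ℕ} (A : AdjLists n)

/-- The array contains the adjacency lists. -/
structure Stored (I : ℕ → ℕ) : Prop where
  next : ∀ v < n, I (v + 1) = I v + (A.nb v).length
  get : ∀ v < n, ∀ k (hk : k < (A.nb v).length), I (I v + k) = (A.nb v)[k]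

/-- Every nonempty set of vertices contains a vertex with at most `d` neighbours in the set. -/
def Degenerate (d : ℕ) : Prop :=
  ∀ U : Finset ℕ, U.Nonempty → U ⊆ Finset.range n →
    ∃ v ∈ U, (U.filter (· ∈ A.nb v)).card ≤ d

/-- The number of neighbours of a vertex outside a list. -/
def rest (S : List ℕ) (u : ℕ) : ℕ := ((A.nb u).toFinset.filter (· ∉ S)).card

theorem rest_append (S : List ℕ) (v u : ℕ) (hv : v ∉ S) :
    A.rest (S ++ [v]) u = A.rest S u - if v ∈ A.nb u then 1 else 0 := by
  have : (A.nb u).toFinset.filter (· ∉ S ++ [v]) =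
      ((A.nb u).toFinset.filter (· ∉ S)).erase v := by
    ext w
    simp
    tauto
  rw [rest, rest, this]
  split_ifs with h
  · rw [Finset.card_erase_of_mem (by simp [h, hv])]
  · rw [Finset.erase_eq_of_notMem (by simp [h]), Nat.sub_zero]

theorem rest_pos {S : List ℕ} {v u : ℕ} (hv : v ∉ S) (h : v ∈ A.nb u) : 1 ≤ A.rest S u :=
  Finset.card_pos.2 ⟨v, by simp [h, hv]⟩

/-- The list `Q`, which is stored in the array `o`, consists of distinct vertices, and the first
`m` vertices have at most `d` neighbours that do not precede them. -/
structure Queue (d : ℕ) (Q : List ℕ) (m : ℕ) (o : ℕ → ℕ) : Prop where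
  get : ∀ i (hi : i < Q.length), o i = Q[i]
  nodup : Q.Nodup
  lt : ∀ u ∈ Q, u < n
  le : m ≤ Q.length
  good : ∀ i (hi : i < Q.length), i < m → A.rest (Q.take (i + 1)) Q[i] ≤ d

variable {A}

theorem Queue.push {d : ℕ} {Q : List ℕ} {m : ℕ} {o : ℕ → ℕ} (h : A.Queue d Q m o) {u : ℕ}
    (hu : u < n) (huQ : u ∉ Q) : A.Queue d (Q ++ [u]) m (Function.update o Q.length u) := by
  refine ⟨fun i hi => ?_, ?_, ?_, by have := h.le; simp; omega, fun i hi him => ?_⟩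
  · rcases Nat.lt_or_eq_of_le (Nat.le_of_lt_succ (by simpa using hi)) with hi' | rfl
    · rw [Function.update_of_ne hi'.ne, h.get i hi', List.getElem_append_left hi']
    · simp
  · exact h.nodup.append (List.nodup_singleton u) (by simpa using huQ)
  · intro w hw
    rcases List.mem_append.1 hw with hw | hw
    · exact h.lt w hw
    · rw [List.mem_singleton.1 hw]; exact hu
  · have hi' : i < Q.length := him.trans_le h.le
    rw [List.take_append_of_le_length (by omega), List.getElem_append_left hi']
    exact h.good i hi' him

theorem Queue.length_le {d : ℕ} {Q : List ℕ} {m : ℕ} {o : ℕ → ℕ} (h : A.Queue d Q m o) :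
    Q.length ≤ n := by
  have := Finset.card_le_card (s := Q.toFinset) (t := Finset.range n)
    (fun u hu => by simpa using h.lt u (by simpa using hu))
  rwa [List.toFinset_card_of_nodup h.nodup, Finset.card_range] at this

end AdjLists

/-- Append all vertices whose degree has the value `k`. -/
def scanDegrees : Cmd :=
  .forTo .v (.var .n) (.ite (.eq (.get .deg (.var .v)) (.var .k))
    (.put .ord (.var .tail) (.var .v) ;; .set .tail (.add (.var .tail) (.lit 1))) .skip)

/-- Remove the vertex `v` and append its neighbours whose degree falls to `k`. -/
def removeVertex : Cmd :=
  .forNbr .v (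
    .put .deg (.var .y) (.sub (.get .deg (.var .y)) (.lit 1)) ;;
    .ite (.eq (.get .deg (.var .y)) (.var .k))
      (.put .ord (.var .tail) (.var .y) ;; .set .tail (.add (.var .tail) (.lit 1))) .skip)

/-- Remove the vertices of the queue one by one. -/
def drainQueue : Cmd :=
  .loop (.lt (.var .head) (.var .tail)) (
    .set .v (.get .ord (.var .head)) ;; removeVertex ;;
    .set .head (.add (.var .head) (.lit 1)))

/-- Compute a degeneracy ordering. -/
def eliminate : Cmd :=
  .set .head (.lit 0) ;; .set .tail (.lit 0) ;; .set .k (.lit 0) ;;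
  .loop (.lt (.var .head) (.var .n)) (
    scanDegrees ;; drainQueue ;; .set .k (.add (.var .k) (.lit 1)))

variable {n : ℕ} {A : AdjLists n}

/-- Members of `Q` have values below `k`, so the scan for the value `k` never appends a vertex
twice. -/
theorem wp_scanDegrees {d m : ℕ} {Q : List ℕ} (h : Store) (hn : h.v .n = n)
    (hQ : A.Queue d Q m (h.a .ord)) (ht : h.v .tail = Q.length)
    (hD : ∀ u ∈ Q, h.a .deg u < h.v .k) :
    wp inp N scanDegrees h fun h' => (∃ R : List ℕ, A.Queue d (Q ++ R) m (h'.a .ord) ∧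
      h'.v .tail = (Q ++ R).length ∧ ∀ u, u ∈ R ↔ u < n ∧ h.a .deg u = h.v .k) ∧
      h'.time ≤ h.time + (5 * n + 2) := by
  refine wp_forTo n (fun _ => 3) (fun i h' =>
    A.Queue d (Q ++ (List.range i).filter (h.a .deg · = h.v .k)) m (h'.a .ord) ∧
    h'.v .tail = (Q ++ (List.range i).filter (h.a .deg · = h.v .k)).length) (by decide)
    (fun k h h' hJ hv ha => by
      dsimp only at hJ ⊢
      rwa [ha, hv .tail (by decide)]) (by simpa using ⟨hQ, ht⟩)
    (fun k h' _ hA => by simp [hA.v .n (by decide), hn]) ?_ ?_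
  · rintro i hi h' ⟨hq, ht'⟩ hv hA
    have e1 := hA.v .k (by decide)
    have e2 := hA.a .deg (by decide)
    simp only [wp, Cond.eval, Exp.eval, Store.tick_v, Store.tick_a, hv, e1, e2]
    rw [List.range_succ, List.filter_append]
    refine ⟨fun hk => ?_, fun hk => ?_⟩
    · have := hq.push hi (fun hmem => ?_)
      · simp only [List.append_assoc] at this
        simp [hk, ht'] at this ⊢
        exact ⟨this, by ring⟩
      · rcases List.mem_append.1 hmem with hmem | hmem
        · exact (hD i hmem).ne hk
        · simp at hmem
    · simpa [hk] using And.intro hq (by simpa using ht')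
  · rintro h' ⟨hq, ht'⟩ hA hle
    refine ⟨⟨_, hq, ht', fun u => by simp⟩, hle.trans_eq ?_⟩
    simp
    ring

/-- Values drop by one at a time, so a vertex outside the queue enters it exactly when its value
reaches `k`. Queued vertices keep losing degree, but from `k` or less they never land on `k` again.
-/
theorem wp_removeVertex {d m : ℕ} {Q : List ℕ} (h : Store) (hI : A.Stored (h.a .input))
    (hQ : A.Queue d Q m (h.a .ord)) (ht : h.v .tail = Q.length) (hm : m < Q.length)
    (hv : h.v .v = Q[m]) (hD : ∀ u < n, h.a .deg u = A.rest (Q.take m) u)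
    (hmem : ∀ u < n, u ∈ Q ↔ h.a .deg u ≤ h.v .k) :
    wp inp N removeVertex h fun h' => (∃ R : List ℕ, A.Queue d (Q ++ R) m (h'.a .ord) ∧
      h'.v .tail = (Q ++ R).length ∧ ∀ u < n, h'.a .deg u = A.rest (Q.take (m + 1)) u ∧
        (u ∈ Q ++ R ↔ h'.a .deg u ≤ h.v .k)) ∧
      h'.time ≤ h.time + (7 * (A.nb Q[m]).length + 3) := by
  set v := Q[m] with hvdef
  have hvn : v < n := hQ.lt _ (List.getElem_mem hm)
  have hvS : v ∉ Q.take m := getElem_notMem_take hQ.nodup hm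
  refine wp_forNbr (A.nb v) 4 (fun i h' => ∃ R : List ℕ, A.Queue d (Q ++ R) m (h'.a .ord) ∧
      h'.v .tail = (Q ++ R).length ∧ ∀ u < n,
        h'.a .deg u = A.rest (Q.take m) u - (if u ∈ (A.nb v).take i then 1 else 0) ∧
        (u ∈ Q ++ R ↔ h'.a .deg u ≤ h.v .k)) (by decide) (by decide) (by decide) (by decide)
    (fun k h h' hJ hv ha => by
      dsimp only at hJ ⊢
      rwa [ha, hv .tail (by decide)])
    ⟨[], by simpa using hQ, by simpa using ht, fun u hu => by simp [hD u hu, hmem u hu]⟩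
    (by rw [hv]; exact hI.next v hvn) (by rw [hv]; exact hI.get v hvn) ?_ ?_
  · rintro i hi h' ⟨R, hq, ht', hR⟩ hy hA
    set y := (A.nb v)[i] with hydef
    have hyv : y ∈ A.nb v := List.getElem_mem hi
    have hyn := A.lt hyv
    have e1 := hA.v .k (by decide)
    -- Since `v` is itself a neighbour not yet removed, the truncated subtraction really decreases
    -- the value; otherwise a value 0 with `k = 0` would queue `y` twice.
    have hpos : 1 ≤ A.rest (Q.take m) y := A.rest_pos hvS (A.symm hyv)
    have hyt : y ∉ (A.nb v).take i := getElem_notMem_take (A.nodup v) hi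
    have htk : ∀ u, u ∈ (A.nb v).take (i + 1) ↔ u ∈ (A.nb v).take i ∨ u = y := fun u => by
      rw [← List.take_append_getElem hi, List.mem_append, List.mem_singleton]
    have hDy : h'.a .deg y = A.rest (Q.take m) y := by simpa [hyt] using (hR y hyn).1
    have hdeg : ∀ u < n, Function.update (h'.a .deg) y (h'.a .deg y - 1) u =
        A.rest (Q.take m) u - (if u ∈ (A.nb v).take (i + 1) then 1 else 0) := by
      intro u hu
      by_cases huy : u = y
      · subst huy; simp [htk, hDy]
      · rw [Function.update_of_ne huy, (hR u hu).1]
        simp [htk, huy]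
    simp only [wp, Cond.eval, Exp.eval, hy, Store.tick_v, Store.tick_a, Store.put_a, Store.put_v,
      if_true, e1, Function.update_self]
    refine ⟨fun hk => ?_, fun hk => ⟨⟨R, by simpa using hq, by simpa using ht', fun u hu => ?_⟩,
      by simp⟩⟩
    · have hyQ : y ∉ Q ++ R := by
        rw [(hR y hyn).2, hDy]
        omega
      refine ⟨⟨R ++ [y], ?_, ?_, fun u hu => ?_⟩, by simp⟩
      · have := hq.push hyn hyQ
        simpa [ht', hy] using this
      · simp [ht']; ring
      · simp only [Store.set_a, Store.put_a, Store.tick_a]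
        refine ⟨by simpa using hdeg u hu, ?_⟩
        by_cases huy : u = y
        · subst huy; simp [hk]
        · have := (hR u hu).2
          simp [huy] at this ⊢
          exact this
    · refine ⟨hdeg u hu, ?_⟩
      by_cases huy : u = y
      · subst huy
        rw [(hR y hyn).2]
        simp
        omega
      · rw [Function.update_of_ne huy]
        exact (hR u hu).2
  · rintro h' ⟨R, hq, ht', hR⟩ hA hle
    refine ⟨⟨R, hq, ht', fun u hu => ⟨?_, (hR u hu).2⟩⟩, hle.trans_eq (by ring)⟩
    rw [(hR u hu).1, ← List.take_append_getElem hm, A.rest_append _ _ _ hvS, List.take_length]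
    have : u ∈ A.nb v ↔ v ∈ A.nb u := ⟨A.symm, A.symm⟩
    simp only [this]

/-- The time it takes to remove a vertex. -/
def AdjLists.cost (A : AdjLists n) (v : ℕ) : ℕ := 7 * (A.nb v).length + 6

/-- A vertex taken from the queue has at most `k ≤ d` neighbours left, which is the property
required of the ordering. Time is accounted as a base `T` plus the cost of every removed vertex, so
that over all rounds each vertex pays once. The variant `n - m` works because queued vertices are
distinct. -/
theorem wp_drainQueue {d m T : ℕ} {Q : List ℕ} (h : Store) (hI : A.Stored (h.a .input))
    (hQ : A.Queue d Q m (h.a .ord)) (ht : h.v .tail = Q.length) (hm : h.v .head = m)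
    (hk : h.v .k ≤ d) (hD : ∀ u < n, h.a .deg u = A.rest (Q.take m) u)
    (hmem : ∀ u < n, u ∈ Q ↔ h.a .deg u ≤ h.v .k)
    (hT : h.time ≤ T + ((Q.take m).map A.cost).sum) :
    wp inp N drainQueue h fun h' => ∃ Q' : List ℕ, A.Queue d Q' Q'.length (h'.a .ord) ∧
      h'.v .tail = Q'.length ∧ h'.v .head = Q'.length ∧
      (∀ u < n, h'.a .deg u = A.rest Q' u) ∧ (∀ u < n, u ∈ Q' ↔ h'.a .deg u ≤ h.v .k) ∧
      h'.time ≤ T + (Q'.map A.cost).sum + 1 := by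
  refine ⟨fun x h' => ∃ (Q : List ℕ) (m : ℕ), x = n - m ∧ A.Queue d Q m (h'.a .ord) ∧
    h'.v .tail = Q.length ∧ h'.v .head = m ∧
    (∀ u < n, h'.a .deg u = A.rest (Q.take m) u) ∧ (∀ u < n, u ∈ Q ↔ h'.a .deg u ≤ h.v .k) ∧
    h'.time ≤ T + ((Q.take m).map A.cost).sum ∧ h'.v .k = h.v .k ∧ A.Stored (h'.a .input),
    ⟨n - m, Q, m, rfl, hQ, ht, hm, hD, hmem, hT, rfl, hI⟩, ?_⟩
  rintro x h' ⟨Q, m, rfl, hQ, ht, hm, hD, hmem, hT, hk', hI⟩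
  simp only [Cond.eval, Exp.eval, hm, ht]
  refine ⟨fun hlt => ?_, fun hlt => ?_⟩
  · have hval : h'.a .ord m = Q[m] := hQ.get m hlt
    simp only [wp, Exp.eval, Store.tick_v, Store.tick_a, hm, hval]
    have hx : (h'.tick.set .v Q[m]).v .k = h.v .k := hk'
    refine wp_mono (wp_agree (wp_removeVertex (h'.tick.set .v Q[m]) hI hQ (by simpa using ht) hlt
      (by simp) hD (by rw [hx]; exact hmem))) ?_
    rintro h'' ⟨⟨⟨R, hq, ht', hR⟩, hle⟩, hA⟩
    have e1 := hA.v .k (by decide)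
    have e2 := hA.v .head (by decide)
    have e3 := hA.a .input (by decide)
    rw [hx] at hR e1
    simp only [Store.set_v, reduceCtorEq, if_false, Store.tick_v, hm] at e2
    have hlen := hq.length_le
    have htake : ∀ i ≤ Q.length, (Q ++ R).take i = Q.take i := fun i hi =>
      List.take_append_of_le_length hi
    refine ⟨n - (m + 1), by simp at hlen; omega, Q ++ R, m + 1, rfl,
      ⟨hq.get, hq.nodup, hq.lt, by simp; omega, fun i hi him => ?_⟩, by simpa using ht',
      by simp [e2], fun u hu => ?_, fun u hu => (hR u hu).2, ?_, e1, by
        simpa [e3] using hI⟩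
    · rcases Nat.lt_succ_iff_lt_or_eq.1 him with him | rfl
      · exact hq.good i hi him
      · rw [List.getElem_append_left hlt, htake _ hlt]
        have hQn := hQ.lt _ (List.getElem_mem hlt)
        have h1 := (hmem _ hQn).1 (List.getElem_mem hlt)
        rw [hD _ hQn] at h1
        -- A vertex is not its own neighbour, so including it in the prefix leaves its count
        -- unchanged.
        rw [← List.take_append_getElem hlt, A.rest_append, if_neg (A.irrefl _), Nat.sub_zero]
        · exact h1.trans hk
        · exact getElem_notMem_take hQ.nodup hlt
    · rw [htake _ hlt]
      exact (hR u hu).1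
    · rw [htake _ hlt, ← List.take_append_getElem hlt]
      simp only [Store.set_time, Store.tick_time] at hle ⊢
      simp only [List.map_append, List.map_cons, List.map_nil, List.sum_append, List.sum_cons,
        List.sum_nil, AdjLists.cost] at hT ⊢
      omega
  · have hle := hQ.le
    obtain rfl : m = Q.length := by omega
    rw [List.take_length] at hT hD
    exact ⟨Q, hQ, ht, hm, hD, hmem, by simpa using hT⟩

/-- The vertices left before round `k` all have at least `k` neighbours among themselves, whereas
degeneracy provides one with at most `d`. Thus there are at most `d + 1` rounds, although the
program does not know `d`. -/
theorem wp_eliminate {d : ℕ} (hdeg : A.Degenerate d) (h : Store) (hI : A.Stored (h.a .input))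
    (hn : h.v .n = n) (hD : ∀ v < n, h.a .deg v = (A.nb v).length) :
    wp inp N eliminate h fun h' => (∃ Q : List ℕ, A.Queue d Q n (h'.a .ord) ∧ Q.length = n) ∧
      h'.time ≤ h.time + ((d + 1) * (5 * n + 5) + ∑ v ∈ Finset.range n, A.cost v + 4) := by
  simp only [eliminate, wp]
  refine ⟨fun x h' => ∃ (Q : List ℕ) (k : ℕ), x = d + 1 - k ∧ k ≤ d + 1 ∧
    A.Queue d Q Q.length (h'.a .ord) ∧
    h'.v .tail = Q.length ∧ h'.v .head = Q.length ∧ h'.v .k = k ∧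
    (∀ u < n, h'.a .deg u = A.rest Q u) ∧ (∀ u < n, u ∈ Q ↔ h'.a .deg u < k) ∧
    h'.time ≤ h.time + 3 + k * (5 * n + 5) + (Q.map A.cost).sum ∧ h'.v .n = n ∧
    A.Stored (h'.a .input),
    ⟨d + 1, [], 0, by simp, by simp, ⟨by simp, by simp, by simp, by simp, by simp⟩, by simp,
      by simp, by simp, ?_, by simp, by simp, by simpa using hn, by simpa using hI⟩, ?_⟩
  · intro u hu
    simp [AdjLists.rest, hD u hu, List.toFinset_card_of_nodup (A.nodup u)]
  · rintro x h₁ ⟨Q, k, rfl, hk, hQ, ht, hhd, hk₁, hD, hmem, hT, hn₁, hI⟩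
    simp only [Cond.eval, Exp.eval, hhd, hn₁]
    refine ⟨fun hlt => ?_, fun hlt => ?_⟩
    · have hkd : k ≤ d := by
        have hU : (Finset.range n \ Q.toFinset).Nonempty := by
          rw [Finset.sdiff_nonempty]
          intro hsub
          have := Finset.card_le_card hsub
          rw [List.toFinset_card_of_nodup hQ.nodup, Finset.card_range] at this
          omega
        obtain ⟨v, hv, hvd⟩ := hdeg _ hU Finset.sdiff_subset
        simp only [Finset.mem_sdiff, Finset.mem_range, List.mem_toFinset] at hv
        have h1 : ¬ h₁.a .deg v < k := fun hlt => hv.2 ((hmem v hv.1).2 hlt)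
        rw [hD v hv.1] at h1
        have h2 : (A.nb v).toFinset.filter (· ∉ Q) ⊆
            (Finset.range n \ Q.toFinset).filter (· ∈ A.nb v) := by
          intro w hw
          simp only [Finset.mem_filter, List.mem_toFinset] at hw
          simp [hw.1, hw.2, A.lt hw.1]
        have := Finset.card_le_card h2
        rw [AdjLists.rest] at h1
        omega
      refine wp_mono (wp_agree (wp_scanDegrees h₁.tick hn₁ hQ ht fun u hu => ?_)) ?_
      · rw [Store.tick_a, Store.tick_v, hk₁]
        exact (hmem u (hQ.lt u hu)).1 hu
      rintro h₂ ⟨⟨⟨R, hq, ht₂, hR⟩, hle₂⟩, hA₂⟩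
      have e1 := hA₂.v .k (by decide)
      have e2 := hA₂.v .head (by decide)
      have e3 := hA₂.a .input (by decide)
      have e4 := hA₂.a .deg (by decide)
      have e5 := hA₂.v .n (by decide)
      simp only [Store.tick_v, Store.tick_a, hk₁, hhd, hn₁, Store.tick_time] at e1 e2 e3 e4 e5 hR hle₂
      refine wp_mono (wp_agree (wp_drainQueue (T := h.time + 3 + k * (5 * n + 5) + (5 * n + 3)) h₂
        (e3 ▸ hI) hq ht₂ e2 (e1 ▸ hkd) (fun u hu => ?_) (fun u hu => ?_) ?_)) ?_
      · simp [e4, hD u hu]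
      · rw [List.mem_append, hmem u hu, hR u, e4, e1]
        omega
      · simp
        omega
      · rintro h₃ ⟨⟨Q', hQ', ht₃, hhd₃, hD₃, hmem₃, hT₃⟩, hA₃⟩
        have f1 := hA₃.v .k (by decide)
        have f2 := hA₃.v .n (by decide)
        have f3 := hA₃.a .input (by decide)
        refine ⟨d + 1 - (k + 1), by omega, Q', k + 1, rfl, by omega, hQ', by simpa using ht₃,
          by simpa using hhd₃, by simp [f1, e1], hD₃, fun u hu => ?_, ?_, by simp [f2, e5],
          by simpa [f3, e3] using hI⟩
        · rw [hmem₃ u hu, e1]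
          exact Nat.lt_succ_iff.symm
        · simp only [Store.set_time]
          ring_nf at hT₃ ⊢
          omega
    · have hlen := hQ.length_le
      have hQn : Q.length = n := by omega
      refine ⟨⟨Q, hQn ▸ hQ, hQn⟩, ?_⟩
      have hperm : Q.toFinset = Finset.range n := by
        apply Finset.eq_of_subset_of_card_le
        · intro u hu
          simpa using hQ.lt u (by simpa using hu)
        · rw [List.toFinset_card_of_nodup hQ.nodup, Finset.card_range, hQn]
      rw [← hperm, List.sum_toFinset A.cost hQ.nodup]
      have := Nat.mul_le_mul_right (5 * n + 5) hk
      simp only [Store.tick_time]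
      omega

end Biclique

namespace Biclique

variable {inp : ℕ → ℕ} {N : ℕ}

/-! ### A dictionary for sequences of vertices -/

/-- The sequence `l`, read from its end to its beginning, leads from the root `0` of the trie to
the node `b`; the child of `a` that belongs to `w` is stored in the cell `a + w`. -/
def Path (T : ℕ → ℕ) : List ℕ → ℕ → Prop
  | [], b => b = 0
  | w :: l, b => b ≠ 0 ∧ ∃ a, Path T l a ∧ T (a + w) = b

/-- The nodes of the trie are multiples of `n`, its cells are the numbers below `f`, and different
cells contain different nodes. -/
structure Trie (n : ℕ) (T : ℕ → ℕ) (f : ℕ) : Prop where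
  dvd : ∀ i, n ∣ T i
  dvd' : n ∣ f
  lt : ∀ i, T i < f
  inj : ∀ i j, T i = T j → T i ≠ 0 → i = j
  zero : ∀ i, f ≤ i → T i = 0

theorem Path.unique {T : ℕ → ℕ} {l : List ℕ} {a b : ℕ} (ha : Path T l a) (hb : Path T l b) :
    a = b := by
  induction l generalizing a b with
  | nil => exact ha.trans hb.symm
  | cons w l ih =>
    obtain ⟨-, a', ha', rfl⟩ := ha
    obtain ⟨-, b', hb', rfl⟩ := hb
    rw [ih ha' hb']

section Trie

variable {n : ℕ} {T : ℕ → ℕ} {f : ℕ}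

theorem Trie.path_dvd (hT : Trie n T f) {l : List ℕ} {a : ℕ} (ha : Path T l a) : n ∣ a := by
  cases l with
  | nil => rw [show a = 0 from ha]; exact dvd_zero n
  | cons w l =>
    obtain ⟨-, a', -, rfl⟩ := ha
    exact hT.dvd _

theorem Trie.path_lt (hT : Trie n T f) {l : List ℕ} {a : ℕ} (ha : Path T l a) : a < f := by
  cases l with
  | nil => rw [show a = 0 from ha]; exact (Nat.zero_le _).trans_lt (hT.lt 0)
  | cons w l =>
    obtain ⟨-, a', -, rfl⟩ := ha
    exact hT.lt _

/-- Both `a` and `f` are multiples of `n`, so `a < f` forces `a + n ≤ f`: the whole block of a node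
is allocated. -/
theorem Trie.cell_lt (hT : Trie n T f) {l : List ℕ} {a w : ℕ} (ha : Path T l a) (hw : w < n) :
    a + w < f := by
  have h1 := hT.path_lt ha
  obtain ⟨x, rfl⟩ := hT.path_dvd ha
  obtain ⟨y, rfl⟩ := hT.dvd'
  have : x + 1 ≤ y := by
    by_contra hlt
    have := Nat.mul_le_mul_left n (show y ≤ x by omega)
    omega
  have := Nat.mul_le_mul_left n this
  rw [mul_add] at this
  omega

/-- A nonzero node occurs in only one cell, and the cell `a + w` determines `a` and `w` by division
by `n`; so the sequence can be read back from the node. -/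
theorem Trie.path_inj (hT : Trie n T f) {l l' : List ℕ} {a : ℕ} (ha : Path T l a)
    (ha' : Path T l' a) (hl : ∀ w ∈ l, w < n) (hl' : ∀ w ∈ l', w < n) : l = l' := by
  induction l generalizing l' a with
  | nil =>
    cases l' with
    | nil => rfl
    | cons w l' => exact absurd ha ha'.1
  | cons w l ih =>
    cases l' with
    | nil => exact absurd ha' ha.1
    | cons w' l' =>
      obtain ⟨h0, b, hb, rfl⟩ := ha
      obtain ⟨-, b', hb', hbb⟩ := ha'
      have heq := hT.inj _ _ hbb.symm h0
      have hw : w < n := hl w (by simp)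
      have hw' : w' < n := hl' w' (by simp)
      have hww : w = w' := by
        obtain ⟨x, rfl⟩ := hT.path_dvd hb
        obtain ⟨y, rfl⟩ := hT.path_dvd hb'
        have := congrArg (· % n) heq
        simpa [Nat.mod_eq_of_lt hw, Nat.mod_eq_of_lt hw'] using this
      subst hww
      obtain rfl : b = b' := by omega
      rw [ih hb hb' (fun w hw => hl w (by simp [hw])) (fun w hw => hl' w (by simp [hw]))]

theorem Path.alloc {l : List ℕ} {a i x : ℕ} (ha : Path T l a) (hi : T i = 0) :
    Path (Function.update T i x) l a := by
  induction l generalizing a with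
  | nil => exact ha
  | cons w l ih =>
    obtain ⟨h0, b, hb, rfl⟩ := ha
    refine ⟨h0, b, ih hb, Function.update_of_ne ?_ _ _⟩
    rintro rfl
    exact h0 hi

theorem Trie.alloc (hT : Trie n T f) (hn : 0 < n) {i : ℕ} (hi : i < f) :
    Trie n (Function.update T i f) (f + n) := by
  refine ⟨fun j => ?_, (Nat.dvd_add_right hT.dvd').2 dvd_rfl, fun j => ?_, fun j k => ?_,
    fun j hj => ?_⟩
  · rw [Function.update_apply]
    split_ifs
    exacts [hT.dvd', hT.dvd j]
  · rw [Function.update_apply]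
    have := hT.lt j
    split_ifs <;> omega
  · have h1 := hT.lt j
    have h2 := hT.lt k
    rw [Function.update_apply, Function.update_apply]
    split_ifs with hj hk hk
    · intros; omega
    · intros; omega
    · intros; omega
    · exact hT.inj j k
  · rw [Function.update_of_ne (by omega), hT.zero j (by omega)]

/-- The block of the new node `f` is still empty, so no path continues through it; the only new
paths end in `f`, and their sequences had no node before. -/
theorem Trie.path_alloc (hT : Trie n T f) {i : ℕ} (hi : i < f) (h0 : T i = 0) {l : List ℕ} {a : ℕ}
    (ha : Path (Function.update T i f) l a) : Path T l a ∨ a = f ∧ ¬ ∃ b, Path T l b := by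
  induction l generalizing a with
  | nil => exact .inl ha
  | cons w l ih =>
    obtain ⟨hne, b, hb, rfl⟩ := ha
    rcases ih hb with hbT | ⟨rfl, -⟩
    · by_cases hbi : b + w = i
      · subst hbi
        refine .inr ⟨by simp, ?_⟩
        rintro ⟨c, hc, b', hb', rfl⟩
        rw [hb'.unique hbT] at hc
        exact hc h0
      · rw [Function.update_of_ne hbi] at hne ⊢
        exact .inl ⟨hne, b, hbT, rfl⟩
    · rw [Function.update_of_ne (by omega), hT.zero _ (by omega)] at hne
      exact absurd rfl hne

/-- The dictionary `D` contains the values of `c` at the nodes of the trie. -/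
structure Dict (n : ℕ) (T D : ℕ → ℕ) (f : ℕ) (c : List ℕ → ℕ) : Prop where
  trie : Trie n T f
  val : ∀ l a, (∀ w ∈ l, w < n) → Path T l a → D a = c l
  zero : ∀ a, f ≤ a → D a = 0
  miss : ∀ l, c l ≠ 0 → ∃ a, Path T l a

theorem Dict.init (hn : 0 < n) {c : List ℕ → ℕ} (hc : ∀ l, c l = 0) :
    Dict n (fun _ => 0) (fun _ => 0) n c :=
  ⟨⟨fun _ => dvd_zero n, dvd_rfl, fun _ => hn, fun _ _ _ h => absurd rfl h, fun _ _ => rfl⟩,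
    fun l _ _ _ => (hc l).symm, fun _ _ => rfl, fun l h => absurd (hc l) h⟩

/-- A sequence without a node has value 0 by `miss`, which agrees with the untouched dictionary cell
at `f`. -/
theorem Dict.alloc {D : ℕ → ℕ} {c : List ℕ → ℕ} (hD : Dict n T D f c) (hn : 0 < n) {i : ℕ}
    (hi : i < f) (h0 : T i = 0) : Dict n (Function.update T i f) D (f + n) c := by
  refine ⟨hD.trie.alloc hn hi, fun l a hl ha => ?_, fun a ha => hD.zero a (by omega),
    fun l hl => ?_⟩
  · rcases hD.trie.path_alloc hi h0 ha with ha | ⟨rfl, hno⟩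
    · exact hD.val l a hl ha
    · rw [hD.zero a le_rfl]
      by_contra hne
      exact hno (hD.miss l (Ne.symm hne))
  · obtain ⟨a, ha⟩ := hD.miss l hl
    exact ⟨a, ha.alloc h0⟩

/-- By `Trie.path_inj` no other sequence shares the node, so a single cell changes a single value.
-/
theorem Dict.incr {D : ℕ → ℕ} {c c' : List ℕ → ℕ} (hD : Dict n T D f c) {l : List ℕ} {a : ℕ}
    (ha : Path T l a) (hl : ∀ w ∈ l, w < n) (hc : c' l = c l + 1)
    (hc' : ∀ l', l' ≠ l → c' l' = c l') : Dict n T (Function.update D a (D a + 1)) f c' := by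
  refine ⟨hD.trie, fun l' a' hl' ha' => ?_, fun b hb => ?_, fun l' hl' => ?_⟩
  · by_cases h : l' = l
    · subst h
      rw [ha'.unique ha, Function.update_self, hc, hD.val _ a hl ha]
    · rw [hc' l' h, Function.update_of_ne, hD.val l' a' hl' ha']
      rintro rfl
      exact h (hD.trie.path_inj ha' ha hl' hl)
  · have := hD.trie.path_lt ha
    rw [Function.update_of_ne (by omega), hD.zero b hb]
  · by_cases h : l' = l
    · exact ⟨a, h ▸ ha⟩
    · exact hD.miss l' (hc' l' h ▸ hl')

end Trie

/-! ### Enumerating the subsets of a set of vertices -/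

/-- The arrays `code`, `par`, `last` and `dep` describe the members of the list `L`. -/
def Entries (L : List (List ℕ)) (h : Store) : Prop :=
  ∀ q l, L[q]? = some l → Path (h.a .trie) l.reverse (h.a .code q) ∧ h.a .dep q = l.length ∧
    (l ≠ [] → ∃ l', L[h.a .par q]? = some l' ∧ l = l' ++ [h.a .last q])

/-- Append a description of the member `q`, extended by `w`. -/
def extendEntry : Cmd :=
  .set .z (.add (.get .code (.var .q)) (.var .w)) ;;
  .ite (.eq (.get .trie (.var .z)) (.lit 0))
    (.put .trie (.var .z) (.var .free) ;; .set .free (.add (.var .free) (.var .n))) .skip ;;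
  .put .code (.var .len) (.get .trie (.var .z)) ;;
  .put .par (.var .len) (.var .q) ;;
  .put .last (.var .len) (.var .w) ;;
  .put .dep (.var .len) (.add (.get .dep (.var .q)) (.lit 1)) ;;
  .set .len (.add (.var .len) (.lit 1))

/-- Describe all subsets of the set of left neighbours of `v`. -/
def buildSubsets : Cmd :=
  .put .code (.lit 0) (.lit 0) ;; .put .dep (.lit 0) (.lit 0) ;; .set .len (.lit 1) ;;
  .forTo .j (.get .llen (.var .v)) (
    .set .w (.get .left (.add (.get .mul (.var .v)) (.var .j))) ;;
    .set .m (.var .len) ;;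
    .forTo .q (.var .m) extendEntry)

theorem wp_extendEntry {n w q : ℕ} {c : List ℕ → ℕ} {L : List (List ℕ)} {l : List ℕ} (hn : 0 < n)
    (h : Store) (hvn : h.v .n = n) (hD : Dict n (h.a .trie) (h.a .dict) (h.v .free) c)
    (hE : Entries L h) (hlen : h.v .len = L.length) (hq : h.v .q = q) (hl : L[q]? = some l)
    (hw : h.v .w = w) (hwn : w < n) :
    wp inp N extendEntry h fun h' => (Dict n (h'.a .trie) (h'.a .dict) (h'.v .free) c ∧
      Entries (L ++ [l ++ [w]]) h' ∧ h'.v .len = (L ++ [l ++ [w]]).length) ∧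
      h'.time ≤ h.time + 9 := by
  obtain ⟨hp, hdep, -⟩ := hE q l hl
  have hlt := hD.trie.cell_lt hp hwn
  -- The remaining commands are treated once for both branches, whether or not a trie node had to be
  -- allocated.
  have key : ∀ h₁ : Store, Dict n (h₁.a .trie) (h₁.a .dict) (h₁.v .free) c →
      h₁.a .trie (h₁.v .z) ≠ 0 → h₁.v .z = h.a .code q + w →
      (∀ k a, Path (h.a .trie) k a → Path (h₁.a .trie) k a) → h₁.a .code = h.a .code →
      h₁.a .par = h.a .par → h₁.a .last = h.a .last → h₁.a .dep = h.a .dep →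
      h₁.v .len = L.length → h₁.v .q = q → h₁.v .w = w → h₁.time ≤ h.time + 4 →
      wp inp N (.put .code (.var .len) (.get .trie (.var .z)) ;;
        .put .par (.var .len) (.var .q) ;;
        .put .last (.var .len) (.var .w) ;;
        .put .dep (.var .len) (.add (.get .dep (.var .q)) (.lit 1)) ;;
        .set .len (.add (.var .len) (.lit 1))) h₁ fun h' =>
        (Dict n (h'.a .trie) (h'.a .dict) (h'.v .free) c ∧
        Entries (L ++ [l ++ [w]]) h' ∧ h'.v .len = (L ++ [l ++ [w]]).length) ∧
        h'.time ≤ h.time + 9 := by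
    intro h₁ g1 g2 g3 g4 g5 g6 g7 g8 g9 g10 g11 g12
    simp [wp, g9, g10, g11]
    refine ⟨⟨g1, fun q' l' hl' => ?_⟩, by omega⟩
    rw [List.getElem?_append] at hl'
    split_ifs at hl' with hlt'
    · obtain ⟨e1, e2, e3⟩ := hE q' l' hl'
      simp only [Store.set_a, Store.put_a, reduceCtorEq, if_false, if_true,
        Function.update_of_ne hlt'.ne, g5, g6, g7, g8]
      refine ⟨g4 _ _ e1, e2, fun hne => ?_⟩
      obtain ⟨l'', hl'', e4⟩ := e3 hne
      exact ⟨l'', by rw [List.getElem?_append_left, hl'']; exact (List.getElem?_eq_some_iff.1 hl'').1,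
        e4⟩
    · obtain ⟨hq', rfl⟩ : q' = L.length ∧ l' = l ++ [w] := by
        have := (List.getElem?_eq_some_iff.1 hl').1
        simp at this
        obtain rfl : q' = L.length := by omega
        simp at hl'
        exact ⟨rfl, hl'.symm⟩
      subst hq'
      simp only [Store.set_a, Store.put_a, reduceCtorEq, if_false, if_true, Function.update_self,
        g5, g6, g7, g8]
      refine ⟨?_, by simp [hdep], fun _ => ⟨l, by
        rw [List.getElem?_append_left, hl]; exact (List.getElem?_eq_some_iff.1 hl).1, rfl⟩⟩
      rw [List.reverse_append, List.reverse_singleton, List.singleton_append]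
      exact ⟨g2, _, g4 _ _ hp, by rw [g3]⟩
  rw [extendEntry]
  change wp inp N (.ite _ _ _) _ _
  refine ⟨fun h0 => ?_, fun h0 => ?_⟩
  · simp [hq, hw] at h0
    have hf : h.v .free ≠ 0 := by have := hD.trie.lt 0; omega
    have := hD.alloc hn hlt h0
    refine key _ ?_ ?_ ?_ ?_ ?_ ?_ ?_ ?_ ?_ ?_ ?_ ?_ <;> simp [hq, hw, hvn, hlen, hf]
    · exact this
    · exact fun k a hk => hk.alloc h0
  · simp [hq, hw] at h0
    refine key _ ?_ ?_ ?_ ?_ ?_ ?_ ?_ ?_ ?_ ?_ ?_ ?_ <;> simp [hq, hw, hlen]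
    · exact hD
    · exact h0

/-- Doubling: the sublists of `W ++ [w]` are those of `W` followed by the same lists with `w`
appended. This is the order of `List.sublists`. -/
theorem wp_buildSubsets {n v : ℕ} {c : List ℕ → ℕ} {W : List ℕ} (hn : 0 < n)
    (h : Store) (hvn : h.v .n = n) (hD : Dict n (h.a .trie) (h.a .dict) (h.v .free) c)
    (hv : h.v .v = v) (hlen : h.a .llen v = W.length)
    (hW : ∀ k (hk : k < W.length), h.a .left (h.a .mul v + k) = W[k]) (hWn : ∀ w ∈ W, w < n) :
    wp inp N buildSubsets h fun h' => Dict n (h'.a .trie) (h'.a .dict) (h'.v .free) c ∧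
      Entries W.sublists h' ∧ h'.v .len = W.sublists.length ∧
      h'.time ≤ h.time + 17 * 2 ^ W.length := by
  simp only [buildSubsets, wp]
  refine wp_forTo W.length (fun j => 11 * 2 ^ j + 4) (fun j h' =>
    Dict n (h'.a .trie) (h'.a .dict) (h'.v .free) c ∧
    Entries (W.take j).sublists h' ∧ h'.v .len = (W.take j).sublists.length)
    (by decide) (fun k h h' hJ hv ha => ?_) ⟨by simpa using hD, ?_, by simp⟩
    (fun k h' _ hA => ?_) ?_ ?_
  · dsimp only [Entries] at hJ ⊢
    rwa [ha, hv .free (by decide), hv .len (by decide)]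
  · intro q l hql
    obtain ⟨hq, hl⟩ := List.getElem?_eq_some_iff.1 hql
    simp at hq hl
    subst hq hl
    simp [Path]
  · have e1 := hA.a .llen (by decide)
    have e2 := hA.v .v (by decide)
    simp [e1, e2, hv, hlen]
  · rintro j hj h₁ ⟨hD₁, hE₁, hl₁⟩ hj₁ hA
    have e1 := hA.a .left (by decide)
    have e2 := hA.a .mul (by decide)
    have e3 := hA.v .v (by decide)
    have e4 := hA.v .n (by decide)
    simp at e1 e2 e3 e4
    simp only [wp, Exp.eval, Store.set_v, reduceCtorEq, if_false, e1, e2, e3, hv, hj₁,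
      hW j hj]
    set L := (W.take j).sublists with hL
    have hLlen : L.length = 2 ^ j := by
      rw [hL, List.length_sublists, List.length_take, min_eq_left hj.le]
    refine wp_forTo L.length (fun _ => 9) (fun q h' =>
      Dict n (h'.a .trie) (h'.a .dict) (h'.v .free) c ∧
      Entries (L ++ (L.take q).map (· ++ [W[j]])) h' ∧
      h'.v .len = (L ++ (L.take q).map (· ++ [W[j]])).length)
      (by decide) (fun k h h' hJ hv ha => ?_) ⟨by simpa using hD₁, ?_, by simpa using hl₁⟩
      (fun k h' _ hA => ?_) ?_ ?_
    · dsimp only [Entries] at hJ ⊢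
      rwa [ha, hv .free (by decide), hv .len (by decide)]
    · simpa [Entries] using hE₁
    · simp [hA.v .m (by decide), hl₁]
    · rintro q hq h₂ ⟨hD₂, hE₂, hl₂⟩ hq₂ hA₂
      refine wp_mono (wp_extendEntry (q := q) (l := L[q]) (w := W[j]) hn h₂ ?_ hD₂ hE₂ hl₂ hq₂ ?_
        ?_ (hWn _ (List.getElem_mem hj))) ?_
      · simp [hA₂.v .n (by decide), e4, hvn]
      · rw [List.getElem?_append_left hq, List.getElem?_eq_getElem hq]
      · simp [hA₂.v .w (by decide)]
      · intro h₃ hh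
        rw [← List.take_append_getElem hq, List.map_append, ← List.append_assoc]
        exact hh
    · rintro h₂ ⟨hD₂, hE₂, hl₂⟩ hA₂ ht₂
      rw [List.take_length, hL, ← List.sublists_concat, List.take_append_getElem hj] at hE₂ hl₂
      refine ⟨⟨hD₂, hE₂, hl₂⟩, ht₂.trans ?_⟩
      simp [hLlen]
      omega
  · rintro h₁ ⟨hD₁, hE₁, hl₁⟩ hA₁ ht₁
    rw [List.take_length] at hE₁ hl₁
    refine ⟨hD₁, hE₁, hl₁, ht₁.trans ?_⟩
    -- Round `j` extends `2 ^ j` entries at 9 + 2 units each. With `k ≤ 2 ^ k` the geometric sum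
    -- yields the factor 17.
    have hgeom : ∀ k, ∑ j ∈ Finset.range k, (11 * 2 ^ j + 4 + 2) + 11 = 11 * 2 ^ k + 6 * k := by
      intro k
      induction k with
      | zero => simp
      | succ k ih => rw [Finset.sum_range_succ, pow_succ]; omega
    have := hgeom W.length
    have := (Nat.lt_two_pow_self (n := W.length)).le
    simp only [Store.set_time, Store.put_time]
    omega

end Biclique

namespace Biclique

variable {inp : ℕ → ℕ} {N : ℕ}

/-! ### Left neighbours -/

namespace AdjLists

variable {n : ℕ} (A : AdjLists n) (R : List ℕ)

/-- The neighbours of `y` among the first `c` vertices of `R` that precede `y`. -/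
def leftAt (c y : ℕ) : List ℕ := (R.take (min c (R.idxOf y))).filter (· ∈ A.nb y)

/-- The neighbours of `y` that precede `y` in `R`. -/
def leftOf (y : ℕ) : List ℕ := (R.take (R.idxOf y)).filter (· ∈ A.nb y)

/-- The number of common neighbours of the members of `l` among the first `c` vertices. -/
def common (c : ℕ) (l : List ℕ) : ℕ := (R.take c).countP fun u => ∀ y ∈ l, y ∈ A.nb u

/-- The number of the first `c` vertices that have all members of `l` as left neighbours. -/
def seen (c : ℕ) (l : List ℕ) : ℕ := (R.take c).countP fun u => l.Sublist (A.leftOf R u)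

variable {A R}

theorem idxOf_lt_of_mem_take {c u : ℕ} (h : u ∈ R.take c) : R.idxOf u < c := by
  have := List.mem_take_iff_idxOf_lt (n := c) (List.mem_of_mem_take h)
  exact this.1 h

theorem mem_take_of_idxOf_lt {c u : ℕ} (hu : u ∈ R) (h : R.idxOf u < c) : u ∈ R.take c :=
  (List.mem_take_iff_idxOf_lt hu).2 h

theorem leftAt_of_mem {c y : ℕ} (hy : y ∈ R.take c) : A.leftAt R c y = A.leftOf R y := by
  rw [leftAt, leftOf, min_eq_right (idxOf_lt_of_mem_take hy).le]

theorem idxOf_getElem' (hR : R.Nodup) {c : ℕ} (hc : c < R.length) : R.idxOf R[c] = c :=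
  hR.idxOf_getElem c hc

theorem leftAt_getElem (hR : R.Nodup) {c : ℕ} (hc : c < R.length) :
    A.leftAt R c R[c] = A.leftOf R R[c] := by
  rw [leftAt, leftOf, idxOf_getElem' hR hc, min_self]

theorem leftAt_length_le (c y : ℕ) : (A.leftAt R c y).length ≤ c :=
  (List.length_filter_le _ _).trans (by simp)

/-- The list of `y` grows only until `y` itself is processed; irreflexivity settles the moment when
`y` is the new vertex. -/
theorem leftAt_succ {c : ℕ} (hc : c < R.length) {y : ℕ} (hy : y ∈ R) :
    A.leftAt R (c + 1) y = A.leftAt R c y ++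
      if y ∈ A.nb R[c] ∧ y ∉ R.take c then [R[c]] else [] := by
  simp only [leftAt, List.mem_take_iff_idxOf_lt hy]
  rcases lt_trichotomy (R.idxOf y) c with h | h | h
  · rw [min_eq_right (by omega), min_eq_right (by omega), if_neg (by simp [h]), List.append_nil]
  · obtain rfl : R[c] = y := by
      subst h
      exact List.getElem_idxOf hc
    rw [min_eq_right (by omega), min_eq_right (by omega), if_neg (by simp [A.irrefl]),
      List.append_nil]
  · rw [min_eq_left (by omega), min_eq_left (by omega), ← List.take_append_getElem hc,
      List.filter_append]
    have : R[c] ∈ A.nb y ↔ y ∈ A.nb R[c] := ⟨A.symm, A.symm⟩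
    by_cases hm : y ∈ A.nb R[c] <;> simp [this, hm, h.not_gt]

theorem seen_succ {c : ℕ} (hc : c < R.length) (l : List ℕ) :
    A.seen R (c + 1) l = A.seen R c l + if l.Sublist (A.leftOf R R[c]) then 1 else 0 := by
  rw [seen, seen, ← List.take_append_getElem hc, List.countP_append]
  simp [List.countP_singleton]

theorem common_le (c : ℕ) (l : List ℕ) : A.common R c l ≤ c :=
  (List.countP_le_length).trans (by simp)

theorem mem_leftOf {u y : ℕ} : u ∈ A.leftOf R y ↔ u ∈ R.take (R.idxOf y) ∧ u ∈ A.nb y := by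
  simp [leftOf]

/-- A common neighbour of the members of `l` either precedes the last member or has all of them
as left neighbours. -/
theorem common_eq (hR : R.Nodup) {c : ℕ} (hc : c < R.length) {l l' : List ℕ} {w : ℕ}
    (hl : l.Sublist (A.leftOf R R[c])) (hw : l = l' ++ [w]) :
    A.common R c l = (A.leftOf R w).countP (fun u => ∀ y ∈ l, y ∈ A.nb u) + A.seen R c l := by
  have hwl : w ∈ l := by simp [hw]
  have hlc : l.Sublist (R.take c) := by
    have := hl.trans List.filter_sublist
    rwa [idxOf_getElem' hR hc] at this
  have hwc : w ∈ R.take c := hlc.subset hwl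
  have hwR : w ∈ R := List.mem_of_mem_take hwc
  set k := R.idxOf w with hk
  have hkc : k < c := idxOf_lt_of_mem_take hwc
  have hkR : k < R.length := by omega
  have hRk : R[k] = w := List.getElem_idxOf hkR
  -- The list `l` is ordered along `R` and ends with `w`, so none of its members lies behind `w`.
  have hlk : l.Sublist (R.take (k + 1)) := by
    have hsplit : R.take c = R.take (k + 1) ++ (R.drop (k + 1)).take (c - (k + 1)) := by
      rw [← List.take_add]
      congr 1
      omega
    rw [hsplit, List.sublist_append_iff] at hlc
    obtain ⟨l₁, l₂, he, h₁, h₂⟩ := hlc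
    rcases List.eq_nil_or_concat l₂ with rfl | ⟨l₃, x, rfl⟩
    · rw [he, List.append_nil]; exact h₁
    · rw [hw, List.concat_eq_append, ← List.append_assoc] at he
      obtain ⟨-, he⟩ := List.append_inj' he rfl
      simp only [List.cons.injEq, and_true] at he
      subst he
      have h3 : w ∈ R.drop (k + 1) := List.mem_of_mem_take (h₂.subset (by simp))
      have h4 : w ∈ R.take (k + 1) := mem_take_of_idxOf_lt hwR (by omega)
      exact absurd h3 (List.disjoint_take_drop hR le_rfl h4)
  have hsub : ∀ u, l.Sublist (A.leftOf R u) → ∀ y ∈ l, y ∈ A.nb u := fun u hu y hy =>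
    (mem_leftOf.1 (hu.subset hy)).2
  have hlow : ∀ u ∈ R.take k, ¬ l.Sublist (A.leftOf R u) := fun u hu hlu => by
    have h1 := idxOf_lt_of_mem_take hu
    have h2 := idxOf_lt_of_mem_take (mem_leftOf.1 (hlu.subset hwl)).1
    omega
  have hsplit : R.take c = R.take k ++ ([w] ++ (R.drop (k + 1)).take (c - (k + 1))) := by
    rw [← List.append_assoc, ← hRk, List.take_append_getElem, ← List.take_add]
    congr 1
    omega
  have hw1 : ¬ ∀ y ∈ l, y ∈ A.nb w := fun h => A.irrefl w (h w hwl)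
  have hw2 : ¬ l.Sublist (A.leftOf R w) := fun h => hw1 (hsub w h)
  rw [common, seen, hsplit]
  simp only [List.countP_append, List.countP_singleton, decide_eq_true_eq, hw1, hw2, if_false]
  have h1 : (R.take k).countP (fun u => l.Sublist (A.leftOf R u)) = 0 := by
    rw [List.countP_eq_zero]
    intro u hu
    simpa using hlow u hu
  have h2 : (A.leftOf R w).countP (fun u => ∀ y ∈ l, y ∈ A.nb u) =
      (R.take k).countP (fun u => ∀ y ∈ l, y ∈ A.nb u) := by
    rw [leftOf, List.countP_filter, ← hk]
    refine List.countP_congr fun u _ => ?_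
    simp only [Bool.and_eq_true, decide_eq_true_eq, and_iff_left_iff_imp]
    exact fun h => A.symm (h w hwl)
  -- Behind `w` every vertex has all of `l` before it, so being a common neighbour is the same as
  -- having `l` among the left neighbours.
  have h3 : ((R.drop (k + 1)).take (c - (k + 1))).countP (fun u => ∀ y ∈ l, y ∈ A.nb u) =
      ((R.drop (k + 1)).take (c - (k + 1))).countP (fun u => l.Sublist (A.leftOf R u)) := by
    refine List.countP_congr fun u hu => ?_
    simp only [decide_eq_true_eq]
    refine ⟨fun h => ?_, hsub u⟩
    have hu' : u ∈ R.drop (k + 1) := List.mem_of_mem_take hu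
    have huR : u ∈ R := List.mem_of_mem_drop hu'
    have hku : k + 1 ≤ R.idxOf u := by
      by_contra hlt
      exact List.disjoint_take_drop hR le_rfl
        (mem_take_of_idxOf_lt huR (by omega : R.idxOf u < k + 1)) hu'
    have h4 : l.Sublist (R.take (R.idxOf u)) := hlk.trans (List.take_sublist_take_left hku)
    have h5 := h4.filter (· ∈ A.nb u)
    rwa [List.filter_eq_self.2 (by simpa using h)] at h5
  rw [h1, h2, h3]
  omega

end AdjLists

end Biclique

namespace Biclique

variable {inp : ℕ → ℕ} {N : ℕ}

/-! ### Counting -/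

/-- Test whether all members of the set `z` are neighbours of `u`. -/
def checkAll : Cmd :=
  .loop (.lt (.lit 0) (.get .dep (.var .z))) (
    .ite (.eq (.get .mat (.add (.get .mul (.var .u)) (.get .last (.var .z)))) (.lit 0))
      (.set .good (.lit 0)) .skip ;;
    .set .z (.get .par (.var .z)))

/-- Count the left neighbours of the last member of the set `q` that are common neighbours of all
its members. -/
def commonLeft : Cmd :=
  .set .w (.get .last (.var .q)) ;; .set .cnt (.lit 0) ;;
  .forTo .a (.get .llen (.var .w)) (
    .set .u (.get .left (.add (.get .mul (.var .w)) (.var .a))) ;;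
    .set .good (.lit 1) ;; .set .z (.var .q) ;;
    checkAll ;;
    .set .cnt (.add (.var .cnt) (.var .good)))

/-- Parent pointers strip the last member until the empty set is reached: `l₂` has been tested, and
the length of the untested part `l₁` is the variant. -/
theorem wp_checkAll {L : List (List ℕ)} {l S : List ℕ} (h : Store) (hE : Entries L h)
    (hz : L[h.v .z]? = some l) (hgood : h.v .good = 1)
    (hm : ∀ y ∈ l, h.a .mat (h.a .mul (h.v .u) + y) = if y ∈ S then 1 else 0) :
    wp inp N checkAll h fun h' => h'.v .good = (if ∀ y ∈ l, y ∈ S then 1 else 0) ∧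
      h'.time ≤ h.time + (4 * l.length + 1) := by
  refine ⟨fun m h' => ∃ l₁ l₂, m = l₁.length ∧ l = l₁ ++ l₂ ∧ L[h'.v .z]? = some l₁ ∧
    h'.v .good = (if ∀ y ∈ l₂, y ∈ S then 1 else 0) ∧ h'.a = h.a ∧ h'.v .u = h.v .u ∧
    h'.time ≤ h.time + 4 * l₂.length, ⟨_, l, [], rfl, by simp, hz, by simp [hgood], rfl, rfl,
    by simp⟩, ?_⟩
  rintro m h' ⟨l₁, l₂, rfl, hl, hz', hg', ha, hu, ht⟩
  obtain ⟨-, hdep, hpar⟩ := hE _ _ hz'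
  simp only [Cond.eval, Exp.eval, ha, hdep]
  refine ⟨fun hpos => ?_, fun hpos => ?_⟩
  · obtain ⟨l₃, h3, h3'⟩ := hpar (List.ne_nil_of_length_pos hpos)
    set y := h.a .last (h'.v .z) with hy
    have hyl : y ∈ l := by rw [hl, h3']; simp
    have hmy := hm y hyl
    simp only [wp, Cond.eval, Exp.eval, Store.tick_v, Store.tick_a, ha, hu, ← hy, hmy]
    have hlen : l₃.length < l₁.length := by rw [h3']; simp
    have hl' : l = l₃ ++ (y :: l₂) := by rw [hl, h3']; simp
    refine ⟨fun h0 => ⟨_, hlen, l₃, y :: l₂, rfl, hl', by simp [ha, h3], ?_, by simpa using ha,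
      by simpa using hu, by simp; omega⟩, fun h0 => ⟨_, hlen, l₃, y :: l₂, rfl, hl',
      by simp [h3], ?_, by simpa using ha, by simpa using hu, by simp; omega⟩⟩
    · have : y ∉ S := by simpa using h0
      simp [this]
    · have : y ∈ S := by simpa using h0
      simp [hg', this]
  · have : l₁ = [] := List.eq_nil_of_length_eq_zero (by omega)
    subst this
    simp only [List.nil_append] at hl
    subst hl
    exact ⟨hg', by simp; omega⟩

/-- This supplies the first summand of `AdjLists.common_eq`, with the left neighbours of `w` as `W`.
-/
theorem wp_commonLeft {n q : ℕ} {A : AdjLists n} {L : List (List ℕ)} {l l' W : List ℕ} {w : ℕ}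
    (h : Store) (hE : Entries L h) (hq : h.v .q = q) (hl : L[q]? = some l) (hw : l = l' ++ [w])
    (hlen : h.a .llen w = W.length)
    (hW : ∀ k (hk : k < W.length), h.a .left (h.a .mul w + k) = W[k])
    (hm : ∀ u ∈ W, ∀ y ∈ l, h.a .mat (h.a .mul u + y) = if y ∈ A.nb u then 1 else 0) :
    wp inp N commonLeft h fun h' => h'.v .cnt = W.countP (fun u => ∀ y ∈ l, y ∈ A.nb u) ∧
      h'.time ≤ h.time + (W.length * (4 * l.length + 7) + 4) := by
  have hlast : h.a .last q = w := by
    obtain ⟨l'', -, h2⟩ := (hE q l hl).2.2 (by simp [hw])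
    rw [hw] at h2
    simpa using (List.append_inj' h2 rfl).2.symm
  simp only [commonLeft, wp]
  refine wp_forTo W.length (fun _ => 4 * l.length + 5)
    (fun k h' => h'.v .cnt = (W.take k).countP (fun u => ∀ y ∈ l, y ∈ A.nb u)) (by decide)
    (fun k h h' hJ hv ha => by simpa [hv] using hJ) (by simp)
    (fun k h' _ hA => ?_) ?_ ?_
  · have e1 := hA.a .llen (by decide)
    have e2 := hA.v .w (by decide)
    simp [e1, e2, hq, hlast, hlen]
  · intro k hk h₁ hJ₁ hk₁ hA₁
    have e2 := hA₁.v .w (by decide)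
    have e3 := hA₁.v .q (by decide)
    have ea : h₁.a = h.a := funext fun a => hA₁.a a (List.not_mem_nil)
    simp [hq, hlast] at e2 e3
    simp only [wp, Exp.eval, Store.set_v, reduceCtorEq, if_false, ea, e2, e3, hk₁,
      hW k hk]
    refine wp_mono (wp_agree (wp_checkAll (S := A.nb W[k]) _ ?_ (l := l) (L := L) ?_ ?_ ?_)) ?_
    · dsimp only [Entries] at hE ⊢
      simpa [ea] using hE
    · simpa using hl
    · simp
    · simpa [ea] using hm _ (List.getElem_mem hk)
    · rintro h₂ ⟨⟨hg, ht⟩, hA₂⟩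
      have e5 := hA₂.v .cnt (by decide)
      simp at e5 ht
      rw [← List.take_append_getElem hk, List.countP_append]
      simp [hg, e5, hJ₁, List.countP_singleton]
      omega
  · intro h₁ hJ₁ hA₁ ht₁
    rw [List.take_length] at hJ₁
    refine ⟨hJ₁, ht₁.trans ?_⟩
    simp
    ring_nf
    omega

/-- Add the number of pairs formed by the set `q` and `v`, which is read off the array `b`, to the
result, and count the occurrence of the set. -/
def addPairs (b : Arr) : Cmd :=
  commonLeft ;;
  .set .x (.add (.var .cnt) (.get .dict (.get .code (.var .q)))) ;;
  .set .res (.add (.var .res) (.get b (.var .x))) ;;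
  .put .dict (.get .code (.var .q)) (.add (.get .dict (.get .code (.var .q))) (.lit 1))

/-- Process all described sets that have `s` or `t` members. -/
def countSubsets : Cmd :=
  .forTo .q (.var .len) (
    .ite (.eq (.get .dep (.var .q)) (.var .t)) (addPairs .bin)
      (.ite (.eq (.get .dep (.var .q)) (.var .s)) (addPairs .bin2) .skip))

/-- Store the adjacencies of `v` and append `v` to the lists of its neighbours to the right. -/
def addVertex : Cmd :=
  .forNbr .v (
    .put .mat (.add (.get .mul (.var .v)) (.var .y)) (.lit 1) ;;
    .ite (.eq (.get .done (.var .y)) (.lit 0))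
      (.put .left (.add (.get .mul (.var .y)) (.get .llen (.var .y))) (.var .v) ;;
        .put .llen (.var .y) (.add (.get .llen (.var .y)) (.lit 1))) .skip) ;;
  .put .done (.var .v) (.lit 1)

/-- Process all vertices. -/
def countAll : Cmd :=
  .set .res (.lit 0) ;; .set .free (.var .n) ;;
  .forTo .i (.var .n) (
    .set .v (.get .ord (.sub (.sub (.var .n) (.lit 1)) (.var .i))) ;;
    buildSubsets ;; countSubsets ;; addVertex)

namespace AdjLists

variable {n : ℕ} (A : AdjLists n) (R : List ℕ)

/-- The number of pairs of a set of `s` or `t` vertices and the `c`-th vertex that the set `l`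
contributes. -/
def pairs (s t c : ℕ) (l : List ℕ) : ℕ :=
  if l.length = t then (A.common R c l).choose (s - 1)
  else if l.length = s then (A.common R c l).choose (t - 1) else 0

/-- The contents of the dictionary. -/
def counts (s t c : ℕ) (l : List ℕ) : ℕ :=
  if l.length = t ∨ l.length = s then A.seen R c l.reverse else 0

/-- The arrays describe the situation after `c` vertices. -/
structure Lists (c : ℕ) (llen left mat done : ℕ → ℕ) : Prop where
  llen : ∀ y < n, llen y = (A.leftAt R c y).length
  left : ∀ y < n, ∀ k (hk : k < (A.leftAt R c y).length), left (y * n + k) = (A.leftAt R c y)[k]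
  mat : ∀ u < n, ∀ y < n, mat (u * n + y) = if u ∈ R.take c ∧ y ∈ A.nb u then 1 else 0
  done : ∀ y < n, done y = if y ∈ R.take c then 1 else 0

end AdjLists

/-! ### Correctness and cost of processing the enumerated sets. -/

section

variable {n : ℕ} {A : AdjLists n} {R : List ℕ}

theorem wp_addPairs {s t c d f : ℕ} {L : List (List ℕ)} {l : List ℕ} {b : Arr} (hR : R.Nodup)
    (hRn : ∀ v ∈ R, v < n) (hc : c < R.length) (hcn : c < n)
    (hd : ∀ v ∈ R, (A.leftOf R v).length ≤ d) (h : Store)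
    {g : List ℕ → ℕ} (hD : Dict n (h.a .trie) (h.a .dict) f g)
    (hg : g l.reverse = A.seen R c l)
    (hlists : A.Lists R c (h.a .llen) (h.a .left) (h.a .mat) (h.a .done))
    (hmul : ∀ v < n, h.a .mul v = v * n) (hE : Entries L h) {q : ℕ} (hq : h.v .q = q)
    (hl : L[q]? = some l) (hl0 : l ≠ []) (hls : l.length ≤ s)
    (hsub : l.Sublist (A.leftOf R R[c])) (hbin : ∀ x < n, h.a b x = x.choose t) :
    wp inp N (addPairs b) h fun h' =>
      h'.v .res = h.v .res + (A.common R c l).choose t ∧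
      Dict n (h'.a .trie) (h'.a .dict) f (fun k => g k + if k = l.reverse then 1 else 0) ∧
      h'.time ≤ h.time + (d * (4 * s + 7) + 7) := by
  obtain ⟨l', w, hw⟩ : ∃ l' w, l = l' ++ [w] := by
    rcases List.eq_nil_or_concat l with h | ⟨l', w, h⟩
    · exact absurd h hl0
    · exact ⟨l', w, by simpa using h⟩
  have hltake : ∀ y ∈ l, y ∈ R.take c := by
    intro y hy
    have := (AdjLists.mem_leftOf.1 (hsub.subset hy)).1
    rwa [AdjLists.idxOf_getElem' hR hc] at this
  have hln : ∀ y ∈ l, y < n := fun y hy => hRn y (List.mem_of_mem_take (hltake y hy))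
  have hwl : w ∈ l := by simp [hw]
  have hleft := AdjLists.leftAt_of_mem (A := A) (hltake w hwl)
  have h1 := hlists.llen w (hln w hwl)
  have h2 := hlists.left w (hln w hwl)
  rw [hleft] at h1
  simp only [addPairs, wp]
  refine wp_mono (wp_agree (wp_commonLeft (A := A) (W := A.leftOf R w) h hE hq hl hw h1
    (fun k hk => ?_) ?_)) ?_
  · rw [hmul w (hln w hwl), h2 k (by rwa [hleft])]
    simp [hleft]
  · intro u hu y hy
    have huR := (AdjLists.mem_leftOf.1 hu).1
    have hun := hRn u (List.mem_of_mem_take huR)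
    -- A left neighbour of `w` precedes `w`, so its matrix row has already been filled.
    have huc : u ∈ R.take c :=
      List.take_subset_take_left _ (AdjLists.idxOf_lt_of_mem_take (hltake w hwl)).le huR
    rw [hmul u hun, hlists.mat u hun y (hln y hy)]
    simp [huc]
  · rintro h₁ ⟨⟨hcnt, ht⟩, hA⟩
    have ea : h₁.a = h.a := funext fun a => hA.a a (by cases a <;> decide)
    have e1 := hA.v .q (by decide)
    have e2 := hA.v .res (by decide)
    have hpath := (hE q l hl).1
    have hval : h.a .dict (h.a .code q) = A.seen R c l := by
      rw [← hg]
      exact hD.val _ _ (by simpa using hln) hpath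
    have hcom := AdjLists.common_eq hR hc hsub hw
    -- The binomial tables have correct entries only below `n`.
    have hlt : A.common R c l < n := (AdjLists.common_le c l).trans_lt hcn
    rw [hq] at e1
    have hsum : h₁.v .cnt + h.a .dict (h.a .code q) = A.common R c l := by
      rw [hcnt, hval, hcom]
    simp only [Exp.eval, Store.set_v, Store.set_a, reduceCtorEq, if_false, if_true, ea, e1, e2,
      hsum, hbin _ hlt]
    have hdinc := hD.incr (c' := fun k => g k + if k = l.reverse then 1 else 0) hpath
      (by simpa using hln) (by simp) (fun k hk => by simp [hk])
    refine ⟨by simp, by simpa [ea] using hdinc, ?_⟩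
    simp only [Store.put_time, Store.set_time]
    have hwd := hd w (List.mem_of_mem_take (hltake w hwl))
    have := Nat.mul_le_mul hwd (show 4 * l.length + 7 ≤ 4 * s + 7 by omega)
    omega

/-- The time it takes to process a set. -/
def setCost (s t d : ℕ) (l : List ℕ) : ℕ :=
  (if l.length = t ∨ l.length = s then d * (4 * s + 7) + 7 else 0) + 2

theorem sum_range_getD {α : Type*} (L : List α) (b : α) (F : α → ℕ) :
    ∑ q ∈ Finset.range L.length, F (L.getD q b) = (L.map F).sum := by
  induction L using List.reverseRecOn with
  | nil => simp
  | append_singleton L l ih =>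
    rw [List.length_append, List.length_singleton, Finset.sum_range_succ, List.map_append,
      List.sum_append, ← ih]
    congr 1
    · refine Finset.sum_congr rfl fun q hq => ?_
      rw [List.getD_append _ _ _ _ (by simpa using hq)]
    · simp

/-- Distinct sublists are each registered once, so after the loop the dictionary has gained exactly
the increment of `AdjLists.seen_succ`. -/
theorem wp_countSubsets {s t c d : ℕ} (hR : R.Nodup) (hRn : ∀ v ∈ R, v < n) (hc : c < R.length)
    (hcn : c < n) (hd : ∀ v ∈ R, (A.leftOf R v).length ≤ d) (ht : 1 ≤ t) (hts : t ≤ s)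
    (h : Store) (hs' : h.v .s = s) (ht' : h.v .t = t)
    (hD : Dict n (h.a .trie) (h.a .dict) (h.v .free) (A.counts R s t c))
    (hlists : A.Lists R c (h.a .llen) (h.a .left) (h.a .mat) (h.a .done))
    (hmul : ∀ v < n, h.a .mul v = v * n) (hE : Entries (A.leftOf R R[c]).sublists h)
    (hlen : h.v .len = (A.leftOf R R[c]).sublists.length)
    (hbin : ∀ x < n, h.a .bin x = x.choose (s - 1))
    (hbin2 : ∀ x < n, h.a .bin2 x = x.choose (t - 1)) :
    wp inp N countSubsets h fun h' =>
      h'.v .res = h.v .res + ((A.leftOf R R[c]).sublists.map (A.pairs R s t c)).sum ∧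
      Dict n (h'.a .trie) (h'.a .dict) (h'.v .free) (A.counts R s t (c + 1)) ∧
      h'.time ≤ h.time + (((A.leftOf R R[c]).sublists.map
        fun l => setCost s t d l + 2).sum + 2) := by
  set L := (A.leftOf R R[c]).sublists with hL
  have hLn : L.Nodup := List.nodup_sublists.2 ((hR.sublist (List.take_sublist _ _)).filter _)
  refine wp_forTo L.length (fun q => setCost s t d (L.getD q [])) (fun q h' =>
    h'.v .res = h.v .res + ((L.take q).map (A.pairs R s t c)).sum ∧
    Dict n (h'.a .trie) (h'.a .dict) (h'.v .free) (fun k => A.counts R s t c k +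
      if (k.length = t ∨ k.length = s) ∧ k.reverse ∈ L.take q then 1 else 0)) (by decide)
    (fun k h h' hJ hv ha => ?_) ⟨by simp, by simpa using hD⟩ (fun k h' _ hA => ?_) ?_ ?_
  · dsimp only at hJ ⊢
    rwa [ha, hv .free (by decide), hv .res (by decide)]
  · simp [hA.v .len (by decide), hlen]
  · rintro q hq h₁ ⟨hres, hD₁⟩ hq₁ hA
    have e1 := hA.v .s (by decide)
    have e2 := hA.v .t (by decide)
    have a1 := hA.a .llen (by decide)
    have a2 := hA.a .left (by decide)
    have a3 := hA.a .mat (by decide)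
    have a4 := hA.a .done (by decide)
    have a5 := hA.a .mul (by decide)
    have a6 := hA.a .bin (by decide)
    have a7 := hA.a .bin2 (by decide)
    have a8 := hA.a .dep (by decide)
    have a9 := hA.a .code (by decide)
    have a10 := hA.a .trie (by decide)
    have a11 := hA.a .par (by decide)
    have a12 := hA.a .last (by decide)
    have hlq : L[q]? = some L[q] := List.getElem?_eq_getElem hq
    have hE₁ : Entries L h₁ := by
      dsimp only [Entries] at hE ⊢
      rwa [a8, a9, a10, a11, a12]
    have hdep := (hE q _ hlq).2.1
    have hget : L.getD q [] = L[q] := List.getD_eq_getElem _ _ hq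
    have hsub : L[q].Sublist (A.leftOf R R[c]) := List.mem_sublists.1 (List.getElem_mem hq)
    have hnot : L[q] ∉ L.take q := getElem_notMem_take hLn hq
    have htk : ∀ k, k ∈ L.take (q + 1) ↔ k ∈ L.take q ∨ k = L[q] := fun k => by
      rw [← List.take_append_getElem hq, List.mem_append, List.mem_singleton]
    -- Both sizes are treated alike, with `r = s - 1` or `r = t - 1`. For `s = t` only the first
    -- branch runs, so no set is counted twice.
    have main : ∀ (b : Arr) (r : ℕ), b = .bin ∨ b = .bin2 → (∀ x < n, h.a b x = x.choose r) →
        L[q].length = t ∨ L[q].length = s →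
        A.pairs R s t c L[q] = (A.common R c L[q]).choose r → ∀ h₂ : Store, h₂.v = h₁.v →
        h₂.a = h₁.a → h₂.time ≤ h₁.time + 2 →
        wp inp N (addPairs b) h₂ fun h' =>
          (h'.v .res = h.v .res + ((L.take (q + 1)).map (A.pairs R s t c)).sum ∧
          Dict n (h'.a .trie) (h'.a .dict) (h'.v .free) (fun k => A.counts R s t c k +
            if (k.length = t ∨ k.length = s) ∧ k.reverse ∈ L.take (q + 1) then 1 else 0)) ∧
          h'.time ≤ h₁.time + setCost s t d (L.getD q []) := by
      intro b r hb hbr hlen hpairs h₂ hv₂ ha₂ ht₂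
      have hbA := hA.a b (by rcases hb with rfl | rfl <;> decide)
      refine wp_mono (wp_agree (wp_addPairs (A := A) (R := R) (s := s) (t := r) (c := c) (d := d)
        (f := h₁.v .free) (L := L) (l := L[q]) (q := q) (b := b) hR hRn hc hcn hd h₂
        (by rw [ha₂]; exact hD₁) ?_ ?_ (by rwa [ha₂, a5]) ?_ (by rw [hv₂, hq₁]) hlq ?_ ?_ hsub ?_))
        ?_
      · simp [AdjLists.counts, hlen, hnot]
      · rwa [ha₂, a1, a2, a3, a4]
      · dsimp only [Entries] at hE₁ ⊢
        rwa [ha₂]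
      · intro h0
        rw [h0] at hlen
        simp at hlen
        omega
      · omega
      · rwa [ha₂, hbA]
      · rintro h₃ ⟨⟨r1, r2, r3⟩, hA₃⟩
        have f1 := hA₃.v .free (by rcases hb with rfl | rfl <;> decide)
        refine ⟨⟨?_, ?_⟩, ?_⟩
        · rw [r1, hv₂, hres, ← List.take_append_getElem hq, List.map_append, List.sum_append,
            ← hpairs]
          simp [add_assoc]
        · rw [f1, hv₂]
          convert r2 using 2 with k
          rw [add_assoc]
          congr 1
          simp only [htk]
          have hiff : k.reverse = L[q] ↔ k = L[q].reverse := List.reverse_eq_iff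
          by_cases hk : k = L[q].reverse
          · subst hk
            simp [hlen, hnot]
          · have hk' : k.reverse ≠ L[q] := fun h => hk (hiff.1 h)
            simp [hk, hk']
        · rw [setCost, hget, if_pos hlen]
          omega
    change wp inp N (.ite _ _ (.ite _ _ _)) _ _
    simp only [wp, Cond.eval, Exp.eval, Store.tick_v, Store.tick_a, a8, hq₁, hdep, e1, e2, hs', ht']
    refine ⟨fun hlt => main .bin _ (.inl rfl) hbin (.inl hlt) (by rw [AdjLists.pairs, if_pos hlt])
        _ rfl rfl (by simp),
      fun hlt => ⟨fun hls => main .bin2 _ (.inr rfl) hbin2 (.inr hls)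
        (by rw [AdjLists.pairs, if_neg hlt, if_pos hls]) _ rfl rfl (by simp),
        fun hls => ⟨⟨?_, ?_⟩, ?_⟩⟩⟩
    · rw [← List.take_append_getElem hq, List.map_append, List.sum_append, hres]
      simp [AdjLists.pairs, hlt, hls]
    · convert hD₁ using 2 with k
      simp only [htk]
      congr 1
      by_cases hk : k.reverse = L[q]
      · have : k.length = L[q].length := by rw [← hk, List.length_reverse]
        simp [this, hlt, hls]
      · simp [hk]
    · rw [setCost]
      simp
  · rintro h₁ ⟨hres, hD₁⟩ hA ht₁
    rw [List.take_length] at hres hD₁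
    refine ⟨hres, ?_, ?_⟩
    · convert hD₁ using 2 with k
      rw [AdjLists.counts, AdjLists.counts, AdjLists.seen_succ hc]
      simp only [hL, List.mem_sublists]
      split_ifs <;> simp_all
    · rwa [sum_range_getD L [] (fun l => setCost s t d l + 2)] at ht₁

end

end Biclique

/-! ### Registering a processed vertex, and the complete counting pass. -/

namespace Biclique

variable {inp : ℕ → ℕ} {N : ℕ} {n : ℕ} {A : AdjLists n} {R : List ℕ}

theorem cell_inj {y y' k k' : ℕ} (hk : k < n) (hk' : k' < n) (h : y * n + k = y' * n + k') :
    y = y' ∧ k = k' := by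
  rcases lt_trichotomy y y' with hlt | rfl | hlt
  · have := Nat.mul_le_mul_right n (Nat.succ_le_of_lt hlt)
    rw [Nat.succ_mul] at this
    omega
  · exact ⟨rfl, by omega⟩
  · have := Nat.mul_le_mul_right n (Nat.succ_le_of_lt hlt)
    rw [Nat.succ_mul] at this
    omega

theorem wp_addVertex {c : ℕ} (hR : R.Nodup) (hRn : ∀ v, v ∈ R ↔ v < n) (hc : c < R.length)
    (hcn : c < n) (h : Store) (hI : A.Stored (h.a .input)) (hv : h.v .v = R[c])
    (hlists : A.Lists R c (h.a .llen) (h.a .left) (h.a .mat) (h.a .done))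
    (hmul : ∀ v < n, h.a .mul v = v * n) :
    wp inp N addVertex h fun h' =>
      A.Lists R (c + 1) (h'.a .llen) (h'.a .left) (h'.a .mat) (h'.a .done) ∧
      h'.time ≤ h.time + (7 * (A.nb R[c]).length + 4) := by
  set v := R[c] with hvdef
  have hvn : v < n := (hRn v).1 (List.getElem_mem hc)
  have hvc : v ∉ R.take c := getElem_notMem_take hR hc
  -- What the list of `y` has received after the first `i` neighbours of `v`.
  set ap : ℕ → ℕ → List ℕ := fun i y => if y ∈ (A.nb v).take i ∧ y ∉ R.take c then [v] else []
    with hap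
  have hapl : ∀ i y, (ap i y).length ≤ 1 := by
    intro i y
    simp only [hap]
    split_ifs <;> simp
  simp only [addVertex, wp]
  refine wp_forNbr (A.nb v) 4 (fun i h' =>
    (∀ y < n, h'.a .llen y = (A.leftAt R c y ++ ap i y).length) ∧
    (∀ y < n, ∀ k (hk : k < (A.leftAt R c y ++ ap i y).length),
      h'.a .left (y * n + k) = (A.leftAt R c y ++ ap i y)[k]) ∧
    (∀ u < n, ∀ y < n, h'.a .mat (u * n + y) =
      if (u ∈ R.take c ∧ y ∈ A.nb u) ∨ (u = v ∧ y ∈ (A.nb v).take i) then 1 else 0))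
    (by decide) (by decide) (by decide) (by decide)
    (fun k h h' hJ hv ha => by dsimp only at hJ ⊢; rwa [ha]) ⟨?_, ?_, ?_⟩
    (by rw [hv]; exact hI.next v hvn) (by rw [hv]; exact hI.get v hvn) ?_ ?_
  · simpa [hap] using hlists.llen
  · simpa [hap] using hlists.left
  · simpa using hlists.mat
  · rintro i hi h₁ ⟨h1, h2, h3⟩ hy hA
    set y := (A.nb v)[i] with hydef
    have hyv : y ∈ A.nb v := List.getElem_mem hi
    have hyn := A.lt hyv
    have hyi : y ∉ (A.nb v).take i := getElem_notMem_take (A.nodup v) hi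
    have htk : ∀ u, u ∈ (A.nb v).take (i + 1) ↔ u ∈ (A.nb v).take i ∨ u = y := fun u => by
      rw [← List.take_append_getElem hi, List.mem_append, List.mem_singleton]
    have e1 := hA.v .v (by decide)
    have e2 := hA.a .mul (by decide)
    have e3 := hA.a .done (by decide)
    have hmat : ∀ u < n, ∀ x < n, Function.update (h₁.a .mat) (v * n + y) 1 (u * n + x) =
        if (u ∈ R.take c ∧ x ∈ A.nb u) ∨ (u = v ∧ x ∈ (A.nb v).take (i + 1)) then 1 else 0 := by
      intro u hu x hx
      by_cases hux : u = v ∧ x = y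
      · obtain ⟨rfl, rfl⟩ := hux
        simp [htk]
      · rw [Function.update_of_ne, h3 u hu x hx]
        · simp only [htk]
          refine if_congr ?_ rfl rfl
          tauto
        · intro heq
          exact hux (cell_inj hx hyn heq)
    have hap' : ∀ x, x ≠ y → ap (i + 1) x = ap i x := fun x hx => by simp [hap, htk, hx]
    have hapy : ap i y = [] := by simp [hap, hyi]
    have hlly : h₁.a .llen y = (A.leftAt R c y).length := by
      rw [h1 y hyn, hapy, List.append_nil]
    have hlly' := AdjLists.leftAt_length_le (A := A) (R := R) c y
    simp only [wp, Cond.eval, Exp.eval, hy, e1, hv, e2, hmul v hvn, hmul y hyn, Store.tick_v,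
      Store.tick_a, Store.put_a, Store.put_v, reduceCtorEq, if_false, if_true, e3,
      hlists.done y hyn]
    refine ⟨fun hnot => ?_, fun hin => ?_⟩
    · have hnot' : y ∉ R.take c := by simpa using hnot
      have hapy' : ap (i + 1) y = [v] := by simp [hap, htk, hnot']
      refine ⟨⟨fun x hx => ?_, fun x hx k hk => ?_, hmat⟩, by simp⟩
      · by_cases hxy : x = y
        · subst hxy
          simp [hapy', hlly]
        · simp only [Function.update_of_ne hxy, hap' x hxy, h1 x hx]
      · by_cases hxy : x = y
        · subst hxy
          simp only [hapy', List.length_append, List.length_singleton] at hk ⊢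
          rcases Nat.lt_or_eq_of_le (Nat.le_of_lt_succ hk) with hk' | rfl
          · have := h2 y hyn k (by simp [hapy, hk'])
            rw [hlly, Function.update_of_ne (by omega), this]
            simp [hk', hapy]
          · simp [hlly]
        · have hk' : k < (A.leftAt R c x ++ ap i x).length := by rwa [hap' x hxy] at hk
          -- A left list has at most `c + 1 ≤ n` entries at this stage, so it stays inside its row.
          have hkn : k < n := by
            have := AdjLists.leftAt_length_le (A := A) (R := R) c x
            have := hapl i x
            simp at hk'
            omega
          rw [Function.update_of_ne]
          · simp only [hap' x hxy, h2 x hx k hk']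
          · intro heq
            exact hxy (cell_inj hkn (by omega) heq).1
    · have hin' : y ∈ R.take c := by simpa using hin
      have hapy' : ap (i + 1) y = [] := by simp [hap, hin']
      have hap'' : ap (i + 1) = ap i := by
        funext x
        by_cases hxy : x = y
        · rw [hxy, hapy, hapy']
        · exact hap' x hxy
      simp only [hap'']
      exact ⟨⟨h1, h2, hmat⟩, by simp⟩
  · rintro h₁ ⟨h1, h2, h3⟩ hA ht
    have e1 := hA.v .v (by decide)
    have e3 := hA.a .done (by decide)
    have htk : ∀ u, u ∈ R.take (c + 1) ↔ u ∈ R.take c ∨ u = v := fun u => by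
      rw [← List.take_append_getElem hc, List.mem_append, List.mem_singleton]
    have hleft : ∀ y < n, A.leftAt R (c + 1) y = A.leftAt R c y ++ ap (A.nb v).length y := by
      intro y hy
      rw [AdjLists.leftAt_succ hc ((hRn y).2 hy)]
      simp only [hap, List.take_length, hvdef]
    simp only [e1, hv, Exp.eval]
    refine ⟨⟨fun y hy => ?_, fun y hy k hk => ?_, fun u hu y hy => ?_, fun y hy => ?_⟩, ?_⟩
    · simp [hleft y hy, h1 y hy]
    · simp only [hleft y hy] at hk ⊢
      simp [h2 y hy k hk]
    · simp only [Store.put_a, reduceCtorEq, if_false]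
      rw [h3 u hu y hy, List.take_length]
      refine if_congr ?_ rfl rfl
      rw [htk]
      constructor
      · rintro (h | ⟨rfl, h⟩)
        exacts [⟨.inl h.1, h.2⟩, ⟨.inr rfl, h⟩]
      · rintro ⟨h | rfl, h'⟩
        exacts [.inl ⟨h, h'⟩, .inr ⟨rfl, h'⟩]
    · simp only [Store.put_a, if_true, e3, Function.update_apply, hlists.done y hy]
      by_cases hyv : y = v
      · simp [hyv, htk]
      · simp [hyv, htk]
    · simp only [Store.put_time]
      ring_nf at ht ⊢
      omega

/-- The time it takes to process the `c`-th vertex. -/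
def vertexCost (A : AdjLists n) (R : List ℕ) (s t d c : ℕ) : ℕ :=
  17 * 2 ^ (A.leftOf R (R.getD c 0)).length +
    ((A.leftOf R (R.getD c 0)).sublists.map fun l => setCost s t d l + 2).sum +
    7 * (A.nb (R.getD c 0)).length + 7

/-- Zeroed arrays already represent the empty trie, empty left lists and an empty matrix. Vertices
are taken from the end of the elimination order, hence the index `n - 1 - c`. -/
theorem wp_countAll {s t d : ℕ} (hn : 0 < n) (hR : R.Nodup) (hRn : ∀ v, v ∈ R ↔ v < n)
    (hRl : R.length = n) (hd : ∀ v ∈ R, (A.leftOf R v).length ≤ d) (ht : 1 ≤ t) (hts : t ≤ s)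
    (h : Store) (hn' : h.v .n = n) (hs' : h.v .s = s) (ht' : h.v .t = t)
    (hI : A.Stored (h.a .input)) (hord : ∀ c (hc : c < R.length), h.a .ord (n - 1 - c) = R[c])
    (hmul : ∀ v < n, h.a .mul v = v * n)
    (hbin : ∀ x < n, h.a .bin x = x.choose (s - 1))
    (hbin2 : ∀ x < n, h.a .bin2 x = x.choose (t - 1))
    (hzero : ∀ a, a = .trie ∨ a = .dict ∨ a = .llen ∨ a = .left ∨ a = .mat ∨ a = .done →
      h.a a = fun _ => 0) :
    wp inp N countAll h fun h' =>
      h'.v .res = ∑ c ∈ Finset.range n,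
        ((A.leftOf R (R.getD c 0)).sublists.map (A.pairs R s t c)).sum ∧
      h'.time ≤ h.time + (∑ c ∈ Finset.range n, (vertexCost A R s t d c + 2) + 4) := by
  simp only [countAll, wp]
  refine wp_forTo n (vertexCost A R s t d) (fun c h' =>
    h'.v .res = ∑ c ∈ Finset.range c,
        ((A.leftOf R (R.getD c 0)).sublists.map (A.pairs R s t c)).sum ∧
    Dict n (h'.a .trie) (h'.a .dict) (h'.v .free) (A.counts R s t c) ∧
    A.Lists R c (h'.a .llen) (h'.a .left) (h'.a .mat) (h'.a .done)) (by decide)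
    (fun k h h' hJ hv ha => ?_) ⟨by simp, ?_, ?_⟩ (fun k h' _ hA => ?_) ?_ ?_
  · dsimp only at hJ ⊢
    rwa [ha, hv .free (by decide), hv .res (by decide)]
  · simp only [Store.set_a, Store.set_v, if_true, Exp.eval, reduceCtorEq, if_false, hn',
      hzero .trie (by simp), hzero .dict (by simp)]
    exact Dict.init hn fun l => by simp [AdjLists.counts, AdjLists.seen]
  · simp only [Store.set_a, hzero .llen (by simp), hzero .left (by simp), hzero .mat (by simp),
      hzero .done (by simp)]
    exact ⟨fun y _ => by simp [AdjLists.leftAt], fun y _ k hk => by simp [AdjLists.leftAt] at hk,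
      fun u _ y _ => by simp, fun y _ => by simp⟩
  · simp [hA.v .n (by decide), hn']
  · rintro c hc h₁ ⟨hres, hD, hL⟩ hc₁ hA
    have hcR : c < R.length := by omega
    have hget : R.getD c 0 = R[c] := List.getD_eq_getElem _ _ hcR
    have e1 := hA.v .n (by decide)
    have e2 := hA.v .s (by decide)
    have e3 := hA.v .t (by decide)
    have a1 := hA.a .ord (by decide)
    have a2 := hA.a .mul (by decide)
    have a3 := hA.a .bin (by decide)
    have a4 := hA.a .bin2 (by decide)
    have a5 := hA.a .input (by decide)
    simp at e1 e2 e3 a1 a2 a3 a4 a5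
    simp only [wp, Exp.eval, hc₁, e1, hn', a1, hord c hcR]
    set W := A.leftOf R R[c] with hW
    have hvn : R[c] < n := (hRn _).1 (List.getElem_mem hcR)
    have hleft := AdjLists.leftAt_getElem (A := A) hR hcR
    have hl1 := hL.llen _ hvn
    have hl2 := hL.left _ hvn
    rw [hleft] at hl1
    refine wp_mono (wp_agree (wp_buildSubsets (n := n) (v := R[c]) (c := A.counts R s t c) (W := W)
      hn (h₁.set .v R[c]) (by simp [e1, hn']) (by simpa using hD) (by simp) hl1 (fun k hk => ?_)
      fun w hw => ?_)) ?_
    · simp only [Store.set_a, a2, hmul _ hvn]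
      rw [hl2 k (by rwa [hleft])]
      simp [hleft, hW]
    · exact (hRn w).1 (List.mem_of_mem_take (AdjLists.mem_leftOf.1 hw).1)
    rintro h₂ ⟨⟨hD₂, hE₂, hlen₂, ht₂⟩, hA₂⟩
    have b1 := hA₂.v .s (by decide)
    have b2 := hA₂.v .t (by decide)
    have b3 := hA₂.v .v (by decide)
    have b4 := hA₂.v .res (by decide)
    have c1 := hA₂.a .llen (by decide)
    have c2 := hA₂.a .left (by decide)
    have c3 := hA₂.a .mat (by decide)
    have c4 := hA₂.a .done (by decide)
    have c5 := hA₂.a .mul (by decide)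
    have c6 := hA₂.a .bin (by decide)
    have c7 := hA₂.a .bin2 (by decide)
    have c8 := hA₂.a .input (by decide)
    simp only [Store.set_v, Store.set_a, reduceCtorEq, if_false, if_true, Store.set_time]
      at b1 b2 b3 b4 c1 c2 c3 c4 c5 c6 c7 c8 ht₂
    have hL₂ : A.Lists R c (h₂.a .llen) (h₂.a .left) (h₂.a .mat) (h₂.a .done) := by
      rwa [c1, c2, c3, c4]
    have hmul₂ : ∀ v < n, h₂.a .mul v = v * n := by rwa [c5, a2]
    refine wp_mono (wp_agree (wp_countSubsets hR (fun v => (hRn v).1) hcR hc hd ht hts h₂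
      (by rw [b1, e2, hs']) (by rw [b2, e3, ht']) hD₂ hL₂ hmul₂ hE₂ hlen₂ (by rwa [c6, a3])
      (by rwa [c7, a4]))) ?_
    rintro h₃ ⟨⟨hres₃, hD₃, ht₃⟩, hA₃⟩
    have d1 := hA₃.v .v (by decide)
    have d2 := hA₃.a .llen (by decide)
    have d3 := hA₃.a .left (by decide)
    have d4 := hA₃.a .mat (by decide)
    have d5 := hA₃.a .done (by decide)
    have d6 := hA₃.a .mul (by decide)
    have d7 := hA₃.a .input (by decide)
    refine wp_mono (wp_agree (wp_addVertex hR hRn hcR hc h₃ (by rwa [d7, c8, a5])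
      (by rw [d1, b3]) (by rwa [d2, d3, d4, d5]) (by rwa [d6]))) ?_
    rintro h₄ ⟨⟨hL₄, ht₄⟩, hA₄⟩
    have f1 := hA₄.v .res (by decide)
    have f2 := hA₄.v .free (by decide)
    have f3 := hA₄.a .trie (by decide)
    have f4 := hA₄.a .dict (by decide)
    refine ⟨⟨?_, by rwa [f2, f3, f4], hL₄⟩, ?_⟩
    · rw [f1, hres₃, b4, hres, Finset.sum_range_succ, hget]
    · rw [hW] at ht₂
      rw [vertexCost, hget]
      omega
  · rintro h₁ ⟨hres, -, -⟩ - ht₁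
    refine ⟨hres, ht₁.trans ?_⟩
    simp only [Store.set_time]
    omega

end Biclique

namespace Biclique

/-! ### Copies of complete bipartite graphs -/

section Copies

variable {V : Type*} {G : SimpleGraph V}

/-- All edges between the two sets are present. -/
def Complete (G : SimpleGraph V) (X Y : Finset V) : Prop := ∀ x ∈ X, ∀ y ∈ Y, G.Adj x y

theorem Complete.symm {X Y : Finset V} (h : Complete G X Y) : Complete G Y X :=
  fun y hy x hx => (h x hx y hy).symm

theorem Complete.disjoint {X Y : Finset V} (h : Complete G X Y) : Disjoint X Y :=
  Finset.disjoint_left.2 fun x hx hy => G.irrefl (h x hx x hy)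

variable [DecidableEq V] (G)

/-- The subgraph formed by two sets of vertices and all edges between them. -/
def bicliqueSub (X Y : Finset V) : G.Subgraph where
  verts := {v | v ∈ X ∪ Y}
  Adj u v := G.Adj u v ∧ (u ∈ X ∧ v ∈ Y ∨ u ∈ Y ∧ v ∈ X)
  adj_sub h := h.1
  edge_vert := by
    rintro u v ⟨-, h | h⟩
    · exact Finset.mem_union_left _ h.1
    · exact Finset.mem_union_right _ h.1
  symm := ⟨fun u v h => ⟨h.1.symm, h.2.symm.imp And.symm And.symm⟩⟩

theorem mem_verts_bicliqueSub {X Y : Finset V} {v : V} :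
    v ∈ (bicliqueSub G X Y).verts ↔ v ∈ X ∪ Y := Iff.rfl

theorem bicliqueSub_comm (X Y : Finset V) : bicliqueSub G X Y = bicliqueSub G Y X := by
  ext u v
  · simp [bicliqueSub, or_comm]
  · simp [bicliqueSub, or_comm]

variable {G}

/-- The sides are the images of the two parts under the isomorphism; conversely, enumerations of two
completely joined sets, which are automatically disjoint, assemble into one. -/
theorem nonempty_iso_iff {s t : ℕ} (G' : G.Subgraph) :
    Nonempty (completeBipartiteGraph (Fin s) (Fin t) ≃g G'.coe) ↔
      ∃ X Y : Finset V, X.card = s ∧ Y.card = t ∧ Complete G X Y ∧ G' = bicliqueSub G X Y := by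
  constructor
  · rintro ⟨e⟩
    have hinj : Function.Injective fun x => (e x : V) := Subtype.val_injective.comp e.injective
    set X : Finset V := Finset.univ.image fun i : Fin s => (e (.inl i) : V) with hX
    set Y : Finset V := Finset.univ.image fun i : Fin t => (e (.inr i) : V) with hY
    have hadj : ∀ a b, G'.Adj (e a) (e b) ↔ (completeBipartiteGraph (Fin s) (Fin t)).Adj a b :=
      fun a b => e.map_rel_iff (a := a) (b := b)
    have hcomp : Complete G X Y := by
      intro x hx y hy
      obtain ⟨i, -, rfl⟩ := Finset.mem_image.1 hx
      obtain ⟨j, -, rfl⟩ := Finset.mem_image.1 hy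
      exact G'.adj_sub ((hadj _ _).2 (by simp))
    have hsurj : ∀ v ∈ G'.verts, ∃ a, (e a : V) = v := fun v hv =>
      ⟨e.symm ⟨v, hv⟩, by simp⟩
    have hmemX : ∀ a, (e a : V) ∈ X ↔ a.isLeft := by
      intro a
      rcases a with i | j
      · simp [hX]
      · simp only [hX, Finset.mem_image, Finset.mem_univ, true_and, Sum.isLeft_inr]
        simp only [Bool.false_eq_true, iff_false, not_exists]
        intro i hi
        exact Sum.inl_ne_inr (hinj hi)
    have hmemY : ∀ a, (e a : V) ∈ Y ↔ a.isRight := by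
      intro a
      rcases a with i | j
      · simp only [hY, Finset.mem_image, Finset.mem_univ, true_and, Sum.isRight_inl]
        simp only [Bool.false_eq_true, iff_false, not_exists]
        intro j hj
        exact Sum.inr_ne_inl (hinj hj)
      · simp [hY]
    have hverts : ∀ v, v ∈ X ∪ Y → v ∈ G'.verts := by
      intro v hv
      rcases Finset.mem_union.1 hv with hv | hv
      · obtain ⟨i, -, rfl⟩ := Finset.mem_image.1 hv
        exact (e _).2
      · obtain ⟨i, -, rfl⟩ := Finset.mem_image.1 hv
        exact (e _).2
    refine ⟨X, Y, ?_, ?_, hcomp, ?_⟩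
    · exact (Finset.card_image_of_injective _ (hinj.comp Sum.inl_injective)).trans (by simp)
    · exact (Finset.card_image_of_injective _ (hinj.comp Sum.inr_injective)).trans (by simp)
    · ext u v
      · refine ⟨fun hu => ?_, hverts u⟩
        obtain ⟨a, rfl⟩ := hsurj u hu
        change _ ∈ X ∪ Y
        rw [Finset.mem_union, hmemX, hmemY]
        cases a <;> simp
      · constructor
        · intro h
          obtain ⟨a, rfl⟩ := hsurj u (G'.edge_vert h)
          obtain ⟨b, rfl⟩ := hsurj v (G'.edge_vert h.symm)
          refine ⟨G'.adj_sub h, ?_⟩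
          rw [hmemX, hmemX, hmemY, hmemY]
          simpa using (hadj a b).1 h
        · rintro ⟨-, h⟩
          obtain ⟨a, rfl⟩ := hsurj u (hverts u (by
            rcases h with h | h
            exacts [Finset.mem_union_left _ h.1, Finset.mem_union_right _ h.1]))
          obtain ⟨b, rfl⟩ := hsurj v (hverts v (by
            rcases h with h | h
            exacts [Finset.mem_union_right _ h.2, Finset.mem_union_left _ h.2]))
          rw [hmemX, hmemX, hmemY, hmemY] at h
          exact (hadj a b).2 (by simpa using h)
  · rintro ⟨X, Y, rfl, rfl, hcomp, rfl⟩
    let eX := X.equivFin.symm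
    let eY := Y.equivFin.symm
    let f : Fin X.card ⊕ Fin Y.card → (bicliqueSub G X Y).verts :=
      Sum.elim (fun i => ⟨eX i, Finset.mem_union_left _ (eX i).2⟩)
        (fun i => ⟨eY i, Finset.mem_union_right _ (eY i).2⟩)
    have hdis := Finset.disjoint_left.1 hcomp.disjoint
    have hf : Function.Bijective f := by
      constructor
      · rintro (i | i) (j | j) hij
        · have : (eX i : V) = eX j := congrArg (Subtype.val (p := (· ∈ (bicliqueSub G X Y).verts))) hij
          rw [eX.injective (Subtype.ext this)]
        · have : (eX i : V) = eY j := congrArg (Subtype.val (p := (· ∈ (bicliqueSub G X Y).verts))) hij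
          exact absurd (this ▸ (eY j).2) (hdis (eX i).2)
        · have : (eY i : V) = eX j := congrArg (Subtype.val (p := (· ∈ (bicliqueSub G X Y).verts))) hij
          exact absurd (this ▸ (eY i).2) (hdis (eX j).2)
        · have : (eY i : V) = eY j := congrArg (Subtype.val (p := (· ∈ (bicliqueSub G X Y).verts))) hij
          rw [eY.injective (Subtype.ext this)]
      · rintro ⟨v, hv⟩
        rcases Finset.mem_union.1 hv with h | h
        · exact ⟨.inl (eX.symm ⟨v, h⟩), by simp [f]⟩
        · exact ⟨.inr (eY.symm ⟨v, h⟩), by simp [f]⟩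
    refine ⟨⟨Equiv.ofBijective f hf, ?_⟩⟩
    have hX : ∀ i, (eX i : V) ∈ X ∧ (eX i : V) ∉ Y := fun i => ⟨(eX i).2, hdis (eX i).2⟩
    have hY : ∀ i, (eY i : V) ∈ Y ∧ (eY i : V) ∉ X :=
      fun i => ⟨(eY i).2, fun h => hdis h (eY i).2⟩
    rintro (i | i) (j | j)
    · change (bicliqueSub G X Y).Adj (eX i : V) (eX j) ↔ _
      simp [bicliqueSub, hX]
    · change (bicliqueSub G X Y).Adj (eX i : V) (eY j) ↔ _
      simp [bicliqueSub, hcomp _ (hX i).1 _ (hY j).1]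
    · change (bicliqueSub G X Y).Adj (eY i : V) (eX j) ↔ _
      simp [bicliqueSub, (hcomp _ (hX j).1 _ (hY i).1).symm]
    · change (bicliqueSub G X Y).Adj (eY i : V) (eY j) ↔ _
      simp [bicliqueSub, hY]

/-- The two sides of a complete bipartite graph are determined up to their order. -/
theorem bicliqueSub_inj {X Y X' Y' : Finset V} (h : Complete G X Y) (h' : Complete G X' Y')
    (hX : X.Nonempty) (hY : Y.Nonempty) (heq : bicliqueSub G X Y = bicliqueSub G X' Y') :
    X = X' ∧ Y = Y' ∨ X = Y' ∧ Y = X' := by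
  -- The neighbourhood of a shared vertex of `X` and `X'` is `Y` in one description and `Y'` in the
  -- other.
  have side : ∀ {X Y X' Y' : Finset V}, Complete G X Y → Complete G X' Y' →
      bicliqueSub G X Y = bicliqueSub G X' Y' → ∀ x ∈ X, x ∈ X' → Y ⊆ Y' := by
    intro X Y X' Y' h h' heq x hx hx' y hy
    have : (bicliqueSub G X Y).Adj x y := ⟨h x hx y hy, .inl ⟨hx, hy⟩⟩
    rw [heq] at this
    rcases this.2 with h1 | h1
    · exact h1.2
    · exact absurd h1.1 (Finset.disjoint_left.1 h'.disjoint hx')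
  have both : ∀ {X Y X' Y' : Finset V}, Complete G X Y → Complete G X' Y' →
      bicliqueSub G X Y = bicliqueSub G X' Y' → Y.Nonempty → ∀ x ∈ X, x ∈ X' →
      X = X' ∧ Y = Y' := by
    intro X Y X' Y' h h' heq hY x hx hx'
    have hYY : Y = Y' := (side h h' heq x hx hx').antisymm (side h' h heq.symm x hx' hx)
    obtain ⟨y, hy⟩ := hY
    rw [bicliqueSub_comm G X Y, bicliqueSub_comm G X' Y'] at heq
    exact ⟨(side h.symm h'.symm heq y hy (hYY ▸ hy)).antisymm
      (side h'.symm h.symm heq.symm y (hYY ▸ hy) hy), hYY⟩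
  obtain ⟨x, hx⟩ := hX
  have hxv : x ∈ (bicliqueSub G X Y).verts := Finset.mem_union_left _ hx
  rw [heq] at hxv
  rcases Finset.mem_union.1 hxv with hx' | hx'
  · exact .inl (both h h' heq hY x hx hx')
  · exact .inr (both h h'.symm (heq.trans (bicliqueSub_comm G X' Y')) hY x hx hx')

end Copies

end Biclique

/-! ### The counted sum equals the number of copies. -/

namespace Biclique

-- Sublists of a duplicate-free list correspond to subsets of its members; the induction matches
-- `List.sublists_concat` with the recursion for the power set of `insert w`.
open Finset in
theorem sum_map_sublists (W : List ℕ) (hW : W.Nodup) (g : Finset ℕ → ℕ) :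
    (W.sublists.map fun l => g l.toFinset).sum = ∑ Y ∈ W.toFinset.powerset, g Y := by
  induction W using List.reverseRecOn generalizing g with
  | nil => simp
  | append_singleton W w ih =>
    rw [List.nodup_append] at hW
    have hw : w ∉ W.toFinset := fun h => hW.2.2 w (by simpa using h) w (by simp) rfl
    have h1 : (W ++ [w]).toFinset = insert w W.toFinset := by ext; simp
    have h2 : ∀ l : List ℕ, (l ++ [w]).toFinset = insert w l.toFinset := by
      intro l; ext; simp
    rw [h1, sum_powerset_insert hw, List.sublists_concat, List.map_append, List.sum_append,
      ih hW.1 g, List.map_map, ← ih hW.1 fun Y => g (insert w Y)]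
    simp only [Function.comp_def, h2]

/-- The set of the elements of `Fin n` whose values belong to a set of numbers. -/
def toFin (n : ℕ) (Y : Finset ℕ) : Finset (Fin n) := Finset.univ.filter fun v => (v : ℕ) ∈ Y

section toFin

variable {n : ℕ}

@[simp] theorem mem_toFin {Y : Finset ℕ} {v : Fin n} : v ∈ toFin n Y ↔ (v : ℕ) ∈ Y := by
  simp [toFin]

theorem map_toFin {Y : Finset ℕ} (hY : ∀ y ∈ Y, y < n) :
    (toFin n Y).map Fin.valEmbedding = Y := by
  ext y
  simp only [Finset.mem_map, mem_toFin, Fin.valEmbedding_apply]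
  exact ⟨fun ⟨v, hv, h⟩ => h ▸ hv, fun h => ⟨⟨y, hY y h⟩, h, rfl⟩⟩

theorem card_toFin {Y : Finset ℕ} (hY : ∀ y ∈ Y, y < n) : (toFin n Y).card = Y.card := by
  rw [← Finset.card_map Fin.valEmbedding, map_toFin hY]

theorem toFin_inj {Y Y' : Finset ℕ} (hY : ∀ y ∈ Y, y < n) (hY' : ∀ y ∈ Y', y < n)
    (h : toFin n Y = toFin n Y') : Y = Y' := by
  rw [← map_toFin hY, h, map_toFin hY']

theorem toFin_map (X : Finset (Fin n)) : toFin n (X.map Fin.valEmbedding) = X := by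
  ext v
  simp [Fin.val_inj]

end toFin

section Count

variable {n : ℕ} (A : AdjLists n) (R : List ℕ)

/-- The common neighbours of the members of `Y` among the first `c` vertices. -/
def commonSet (c : ℕ) (Y : Finset ℕ) : Finset ℕ :=
  (R.take c).toFinset.filter fun u => ∀ y ∈ Y, y ∈ A.nb u

/-- The triples of the position `c` of the last vertex, the side without this vertex, and the rest
of the other side. -/
def triples (s t : ℕ) : Finset (Σ _ : ℕ, Σ _ : Finset ℕ, Finset ℕ) :=
  (Finset.range n).sigma fun c =>
    ((A.leftOf R (R.getD c 0)).toFinset.powerset.filter fun Y => Y.card = t ∨ Y.card = s).sigma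
      fun Y => (commonSet A R c Y).powersetCard (s + t - Y.card - 1)

variable {A R}

theorem mem_triples {s t c : ℕ} {Y Z : Finset ℕ} : ⟨c, Y, Z⟩ ∈ triples A R s t ↔
    c < n ∧ (Y ⊆ (A.leftOf R (R.getD c 0)).toFinset ∧ (Y.card = t ∨ Y.card = s)) ∧
      Z ⊆ commonSet A R c Y ∧ Z.card = s + t - Y.card - 1 := by
  simp [triples, Finset.mem_powersetCard]

/-- The size `s + t - Y.card - 1` unifies the two cases: it is `s - 1` if `Y` has `t` members and `t
- 1` if it has `s`. -/
theorem sum_pairs_eq (s t : ℕ) (hR : R.Nodup) :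
    ∑ c ∈ Finset.range n, ((A.leftOf R (R.getD c 0)).sublists.map (A.pairs R s t c)).sum =
      (triples A R s t).card := by
  rw [triples, Finset.card_sigma]
  refine Finset.sum_congr rfl fun c _ => ?_
  set W := A.leftOf R (R.getD c 0) with hWdef
  have hW : W.Nodup := (hR.sublist (List.take_sublist _ _)).filter _
  rw [Finset.card_sigma, Finset.sum_filter, ← sum_map_sublists W hW fun Y =>
    if Y.card = t ∨ Y.card = s then
      ((commonSet A R c Y).powersetCard (s + t - Y.card - 1)).card else 0]
  congr 1
  refine List.map_congr_left fun l hl => ?_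
  have hl' : l.Nodup := hW.sublist (List.mem_sublists.1 hl)
  have hcard : (commonSet A R c l.toFinset).card = A.common R c l := by
    rw [AdjLists.common, List.countP_eq_length_filter, ← List.toFinset_card_of_nodup
      ((hR.sublist (List.take_sublist _ _)).filter _), List.toFinset_filter, commonSet]
    congr 1
    ext u
    simp
  rw [Finset.card_powersetCard, List.toFinset_card_of_nodup hl', hcard, AdjLists.pairs]
  by_cases h1 : l.length = t
  · simp [h1]
  · by_cases h2 : l.length = s
    · rw [if_neg h1, if_pos h2, if_pos (Or.inr h2), h2]
      congr 1
      omega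
    · simp [h1, h2]

theorem triples_facts {G : SimpleGraph (Fin n)} (hG : ∀ u v : Fin n, (v : ℕ) ∈ A.nb u ↔ G.Adj u v)
    (hR : R.Nodup) (hRn : ∀ v, v ∈ R ↔ v < n) (hRl : R.length = n) {s t : ℕ} (ht : 1 ≤ t)
    (hs : 1 ≤ s) {c : ℕ} {Y Z : Finset ℕ} (h : ⟨c, Y, Z⟩ ∈ triples A R s t) :
    c < n ∧ (∀ u ∈ Y, u ∈ R.take c) ∧ (∀ u ∈ Z, u ∈ R.take c) ∧ R.getD c 0 ∉ R.take c ∧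
      R.idxOf (R.getD c 0) = c ∧ R.getD c 0 < n ∧
      Complete G (toFin n (insert (R.getD c 0) Z)) (toFin n Y) ∧
      (Y.card = t ∧ (insert (R.getD c 0) Z).card = s ∨
        Y.card = s ∧ (insert (R.getD c 0) Z).card = t) := by
  obtain ⟨hc, ⟨hY, hYc⟩, hZ, hZc⟩ := mem_triples.1 h
  have hcR : c < R.length := by omega
  have hget : R.getD c 0 = R[c] := List.getD_eq_getElem _ _ hcR
  rw [hget] at hY ⊢
  have hYt : ∀ u ∈ Y, u ∈ R.take c := fun u hu => by
    have := (AdjLists.mem_leftOf.1 (List.mem_toFinset.1 (hY hu))).1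
    rwa [AdjLists.idxOf_getElem' hR hcR] at this
  have hZt : ∀ u ∈ Z, u ∈ R.take c := fun u hu => by
    have := (Finset.mem_filter.1 (hZ hu)).1
    simpa using this
  have hvt := getElem_notMem_take hR hcR
  refine ⟨hc, hYt, hZt, hvt, AdjLists.idxOf_getElem' hR hcR,
    (hRn _).1 (List.getElem_mem hcR), ?_, ?_⟩
  · intro x hx y hy
    rw [mem_toFin, Finset.mem_insert] at hx
    rw [mem_toFin] at hy
    rw [← hG]
    rcases hx with hx | hx
    · rw [hx]
      exact A.symm (A.symm (AdjLists.mem_leftOf.1 (List.mem_toFinset.1 (hY hy))).2)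
    · exact (Finset.mem_filter.1 (hZ hx)).2 y hy
  · rw [Finset.card_insert_of_notMem fun hv => hvt (hZt _ hv)]
    omega

/-- A triple is sent to the subgraph with sides {v} ∪ Z and Y, where v is the vertex at position c.
For the inverse, v is the last vertex of the copy in `R`, Y the side without it, and Z the rest of
its side. -/
theorem card_triples {G : SimpleGraph (Fin n)}
    (hG : ∀ u v : Fin n, (v : ℕ) ∈ A.nb u ↔ G.Adj u v) (hR : R.Nodup) (hRn : ∀ v, v ∈ R ↔ v < n)
    (hRl : R.length = n) {s t : ℕ} (ht : 1 ≤ t) (hs : 1 ≤ s) :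
    (triples A R s t).card = G.copyCount (completeBipartiteGraph (Fin s) (Fin t)) := by
  classical
  rw [SimpleGraph.copyCount]
  have hlt : ∀ {c u}, u ∈ R.take c → u < n := fun h => (hRn _).1 (List.mem_of_mem_take h)
  have hXlt : ∀ {c : ℕ} {Z : Finset ℕ}, R.getD c 0 < n → (∀ u ∈ Z, u ∈ R.take c) →
      ∀ x ∈ insert (R.getD c 0) Z, x < n := by
    intro c Z hv hZ x hx
    rcases Finset.mem_insert.1 hx with rfl | hx
    exacts [hv, hlt (hZ x hx)]
  refine Finset.card_bij
    (fun x _ => bicliqueSub G (toFin n (insert (R.getD x.1 0) x.2.2)) (toFin n x.2.1)) ?_ ?_ ?_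
  · rintro ⟨c, Y, Z⟩ h
    obtain ⟨hc, hY, hZ, hv, hi, hvn, hcomp, hcard⟩ := triples_facts hG hR hRn hRl ht hs h
    rw [Finset.mem_filter, nonempty_iso_iff]
    refine ⟨@Finset.mem_univ _ (_) _, ?_⟩
    dsimp only
    have hcX := card_toFin (Y := insert (R.getD c 0) Z) (hXlt hvn hZ)
    have hcY := card_toFin (n := n) (Y := Y) fun y hy => hlt (hY y hy)
    rcases hcard with ⟨h1, h2⟩ | ⟨h1, h2⟩
    · exact ⟨_, _, hcX.trans h2, hcY.trans h1, hcomp, rfl⟩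
    · exact ⟨_, _, hcY.trans h1, hcX.trans h2, hcomp.symm, bicliqueSub_comm ..⟩
  · rintro ⟨c, Y, Z⟩ h ⟨c', Y', Z'⟩ h' heq
    dsimp only at heq
    obtain ⟨hc, hY, hZ, hv, hi, hvn, hcomp, hcard⟩ := triples_facts hG hR hRn hRl ht hs h
    obtain ⟨hc', hY', hZ', hv', hi', hvn', hcomp', hcard'⟩ := triples_facts hG hR hRn hRl ht hs h'
    -- All vertices of the first subgraph have position at most `c`, and the vertex at position `c'`
    -- is one of them.
    have key : ∀ {c c' : ℕ} {Y Z Y' Z' : Finset ℕ}, (∀ u ∈ Y, u ∈ R.take c) →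
        (∀ u ∈ Z, u ∈ R.take c) → R.idxOf (R.getD c 0) = c → R.idxOf (R.getD c' 0) = c' →
        R.getD c' 0 < n →
        bicliqueSub G (toFin n (insert (R.getD c 0) Z)) (toFin n Y) =
          bicliqueSub G (toFin n (insert (R.getD c' 0) Z')) (toFin n Y') → c' ≤ c := by
      intro c c' Y Z Y' Z' hY hZ hi hi' hvn' heq
      have hmem : (⟨R.getD c' 0, hvn'⟩ : Fin n) ∈
          (bicliqueSub G (toFin n (insert (R.getD c' 0) Z')) (toFin n Y')).verts :=
        (mem_verts_bicliqueSub G).2 (Finset.mem_union_left _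
          (mem_toFin.2 (Finset.mem_insert_self (R.getD c' 0) Z')))
      rw [← heq, mem_verts_bicliqueSub] at hmem
      rcases Finset.mem_union.1 hmem with hm | hm
      · rw [mem_toFin, Finset.mem_insert] at hm
        rcases hm with hm | hm
        · have hm' : R.getD c' 0 = R.getD c 0 := hm
          rw [← hi', hm', hi]
        · have := AdjLists.idxOf_lt_of_mem_take (hZ _ hm)
          rw [hi'] at this
          exact this.le
      · rw [mem_toFin] at hm
        have := AdjLists.idxOf_lt_of_mem_take (hY _ hm)
        rw [hi'] at this
        exact this.le
    obtain rfl : c = c' := le_antisymm (key hY' hZ' hi' hi hvn heq.symm) (key hY hZ hi hi' hvn' heq)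
    have hYne : (toFin n Y).Nonempty := by
      rw [← Finset.card_pos, card_toFin (n := n) (Y := Y) fun y hy => hlt (hY y hy)]
      omega
    have hXne : (toFin n (insert (R.getD c 0) Z)).Nonempty := ⟨⟨_, hvn⟩, by simp⟩
    have hcases := bicliqueSub_inj hcomp hcomp' hXne hYne heq
    -- The last vertex never lies in the opposite side, which excludes swapped sides.
    have hfst : (⟨R.getD c 0, hvn⟩ : Fin n) ∉ toFin n Y' := fun hm => hv (hY' _ (mem_toFin.1 hm))
    rcases hcases with ⟨h1, h2⟩ | ⟨h1, -⟩
    · have hYY := toFin_inj (Y := Y) (Y' := Y') (fun y hy => hlt (hY y hy))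
        (fun y hy => hlt (hY' y hy)) h2
      have hXX := toFin_inj (Y := insert (R.getD c 0) Z)
        (Y' := insert (R.getD c 0) Z') (hXlt hvn hZ) (hXlt hvn' hZ') h1
      have hZZ : Z = Z' := by
        rw [← Finset.erase_insert fun hm => hv (hZ _ hm), hXX,
          Finset.erase_insert fun hm => hv (hZ' _ hm)]
      rw [hYY, hZZ]
    · rw [← h1] at hfst
      exact absurd (by simp) hfst
  · intro G' hG'
    rw [Finset.mem_filter, nonempty_iso_iff] at hG'
    obtain ⟨-, X₀, Y₀, hX₀, hY₀, hcomp₀, rfl⟩ := hG'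
    -- Here `X` is the side containing the last vertex; it may be the side of size `s` or of size
    -- `t`.
    have main : ∀ X Y : Finset (Fin n), Complete G X Y → (Y.card = t ∧ X.card = s ∨
        Y.card = s ∧ X.card = t) → (∃ v ∈ X, ∀ u ∈ X ∪ Y, R.idxOf (u : ℕ) ≤ R.idxOf (v : ℕ)) →
        ∃ x, ∃ _ : x ∈ triples A R s t,
          bicliqueSub G (toFin n (insert (R.getD x.1 0) x.2.2)) (toFin n x.2.1) =
            bicliqueSub G X Y := by
      rintro X Y hcomp hcard ⟨v, hvX, hmax⟩
      have hvR : (v : ℕ) ∈ R := (hRn v).2 v.2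
      have hcR : R.idxOf (v : ℕ) < R.length := List.idxOf_lt_length_of_mem hvR
      have hget : R.getD (R.idxOf (v : ℕ)) 0 = v := by
        rw [List.getD_eq_getElem _ _ hcR, List.getElem_idxOf]
      have hlast : ∀ u ∈ X ∪ Y, u ≠ v → (u : ℕ) ∈ R.take (R.idxOf (v : ℕ)) := by
        intro u hu huv
        refine AdjLists.mem_take_of_idxOf_lt ((hRn u).2 u.2) (lt_of_le_of_ne (hmax u hu) ?_)
        intro heq
        exact huv (Fin.ext ((List.idxOf_inj ((hRn u).2 u.2)).1 heq))
      have hvY : v ∉ Y := Finset.disjoint_left.1 hcomp.disjoint hvX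
      have hX : insert (v : ℕ) ((X.erase v).map Fin.valEmbedding) = X.map Fin.valEmbedding := by
        conv_rhs => rw [← Finset.insert_erase hvX, Finset.map_insert]
        rfl
      refine ⟨⟨R.idxOf (v : ℕ), Y.map Fin.valEmbedding, (X.erase v).map Fin.valEmbedding⟩, ?_, ?_⟩
      · rw [mem_triples, hget, Finset.card_map, Finset.card_map, Finset.card_erase_of_mem hvX]
        refine ⟨by omega, ⟨fun y hy => ?_, by omega⟩, fun x hx => ?_, by omega⟩
        · obtain ⟨u, hu, rfl⟩ := Finset.mem_map.1 hy
          rw [List.mem_toFinset, AdjLists.mem_leftOf]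
          refine ⟨hlast u (Finset.mem_union_right _ hu) fun h => hvY (h ▸ hu), ?_⟩
          exact (hG v u).2 (hcomp v hvX u hu)
        · obtain ⟨u, hu, rfl⟩ := Finset.mem_map.1 hx
          rw [commonSet, Finset.mem_filter, List.mem_toFinset]
          obtain ⟨huv, huX⟩ := Finset.mem_erase.1 hu
          refine ⟨hlast u (Finset.mem_union_left _ huX) huv, fun y hy => ?_⟩
          obtain ⟨w, hw, rfl⟩ := Finset.mem_map.1 hy
          exact (hG u w).2 (hcomp u huX w hw)
      · dsimp only
        rw [hget, hX, toFin_map, toFin_map]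
    obtain ⟨v, hv, hmax⟩ := Finset.exists_max_image (X₀ ∪ Y₀) (fun u => R.idxOf (u : ℕ)) (by
      rw [← Finset.card_pos]
      have := Finset.card_le_card (Finset.subset_union_left (s₁ := X₀) (s₂ := Y₀))
      omega)
    rcases Finset.mem_union.1 hv with hv | hv
    · exact main X₀ Y₀ hcomp₀ (.inl ⟨hY₀, hX₀⟩) ⟨v, hv, hmax⟩
    · rw [bicliqueSub_comm]
      exact main Y₀ X₀ hcomp₀.symm (.inr ⟨hX₀, hY₀⟩)
        ⟨v, hv, fun u hu => hmax u (by rwa [Finset.union_comm])⟩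

end Count

end Biclique

namespace Biclique

/-! ### The input -/

section Input

variable {n : ℕ}

/-- The adjacency lists of a graph as lists of numbers. -/
def AdjLists.ofAdj {G : SimpleGraph (Fin n)} {adj : Fin n → List (Fin n)}
    (h : G.IsAdjList adj) : AdjLists n where
  nb v := if hv : v < n then (adj ⟨v, hv⟩).map Fin.val else []
  nodup v := by
    split_ifs with hv
    · exact (h _).1.map Fin.val_injective
    · exact List.nodup_nil
  symm := by
    intro u v huv
    split_ifs at huv with hv
    · obtain ⟨w, hw, rfl⟩ := List.mem_map.1 huv
      rw [dif_pos w.2]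
      exact List.mem_map.2 ⟨⟨v, hv⟩, ((h _).2 _).2 (((h _).2 _).1 hw).symm, rfl⟩
    · simp at huv
  irrefl v hv := by
    split_ifs at hv with hv'
    · obtain ⟨w, hw, hwv⟩ := List.mem_map.1 hv
      obtain rfl : w = ⟨v, hv'⟩ := Fin.ext hwv
      exact G.irrefl (((h _).2 _).1 hw)
    · simp at hv
  lt := by
    intro u v huv
    split_ifs at huv with hv
    · obtain ⟨w, -, rfl⟩ := List.mem_map.1 huv
      exact w.2
    · simp at huv

variable {G : SimpleGraph (Fin n)} {adj : Fin n → List (Fin n)} (hadj : G.IsAdjList adj)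

theorem ofAdj_nb (v : Fin n) :
    (AdjLists.ofAdj hadj).nb v = (adj v).map Fin.val := dif_pos v.2

theorem mem_ofAdj (u v : Fin n) : (v : ℕ) ∈ (AdjLists.ofAdj hadj).nb u ↔ G.Adj u v := by
  rw [ofAdj_nb, List.mem_map_of_injective Fin.val_injective]
  exact (hadj u).2 v

theorem adjStart_eq {k : ℕ} (hk : k ≤ n) : adjStart adj k =
    n + 1 + ∑ u ∈ Finset.range k, ((AdjLists.ofAdj hadj).nb u).length := by
  have h1 : (∑ v : Fin n, if (v : ℕ) < k then (adj v).length else 0) =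
      ∑ v : Fin n, if (v : ℕ) < k then ((AdjLists.ofAdj hadj).nb v).length else 0 :=
    Finset.sum_congr rfl fun v _ => by rw [ofAdj_nb, List.length_map]
  rw [adjStart, h1, Fin.sum_univ_eq_sum_range
    (fun v => if v < k then ((AdjLists.ofAdj hadj).nb v).length else 0) n, ← Finset.sum_filter]
  congr 2
  ext u
  simp
  omega

theorem length_flatMap_range (f : ℕ → List ℕ) (m : ℕ) :
    ((List.range m).flatMap f).length = ∑ u ∈ Finset.range m, (f u).length := by
  induction m with
  | zero => simp
  | succ m ih => simp [List.range_succ, Finset.sum_range_succ, ih]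

theorem getElem?_flatMap_range (f : ℕ → List ℕ) (m v j : ℕ) (hv : v < m)
    (hj : j < (f v).length) :
    ((List.range m).flatMap f)[(∑ u ∈ Finset.range v, (f u).length) + j]? = some (f v)[j] := by
  induction m with
  | zero => omega
  | succ m ih =>
    rw [List.range_succ, List.flatMap_append, List.flatMap_singleton]
    rcases Nat.lt_succ_iff_lt_or_eq.1 hv with hv | rfl
    · rw [List.getElem?_append_left, ih hv]
      exact (List.getElem?_eq_some_iff.1 (ih hv)).1
    · rw [List.getElem?_append_right (by rw [length_flatMap_range]; omega), length_flatMap_range,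
        Nat.add_sub_cancel_left, List.getElem?_eq_getElem hj]

theorem encodeAdj_eq : encodeAdj adj = (List.range (n + 1)).map (adjStart adj) ++
    (List.range n).flatMap (AdjLists.ofAdj hadj).nb := by
  rw [encodeAdj]
  congr 1
  rw [← List.map_coe_finRange_eq_range, List.flatMap_map]
  simp only [ofAdj_nb, List.map_eq_flatMap]
  simp

theorem length_encodeAdj (hadj : G.IsAdjList adj) : (encodeAdj adj).length = adjStart adj n := by
  rw [encodeAdj_eq hadj, adjStart_eq hadj le_rfl, List.length_append, length_flatMap_range]
  simp

theorem encodeAdj_start {k : ℕ} (hk : k ≤ n) : (encodeAdj adj).getD k 0 = adjStart adj k := by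
  rw [encodeAdj, List.getD_append _ _ _ _ (by simp; omega), List.getD_eq_getElem _ _ (by simp; omega)]
  simp

theorem encodeAdj_get {v j : ℕ} (hv : v < n) (hj : j < ((AdjLists.ofAdj hadj).nb v).length) :
    adjStart adj v + j < adjStart adj n ∧
      (encodeAdj adj).getD (adjStart adj v + j) 0 = ((AdjLists.ofAdj hadj).nb v)[j] := by
  have h := getElem?_flatMap_range (AdjLists.ofAdj hadj).nb n v j hv hj
  have h' : (encodeAdj adj)[adjStart adj v + j]? = some ((AdjLists.ofAdj hadj).nb v)[j] := by
    rw [encodeAdj_eq hadj, List.getElem?_append_right, ← h, adjStart_eq hadj hv.le]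
    · congr 1
      simp
      omega
    · rw [adjStart_eq hadj hv.le]
      simp
      omega
  constructor
  · rw [← length_encodeAdj hadj]
    exact (List.getElem?_eq_some_iff.1 h').1
  · rw [List.getD_eq_getElem?_getD, h', Option.getD_some]

theorem stored_of_eq {I : ℕ → ℕ}
    (hI : ∀ i < adjStart adj n, I i = (encodeAdj adj).getD i 0) :
    (AdjLists.ofAdj hadj).Stored I := by
  have hlow : ∀ v ≤ n, I v = adjStart adj v := by
    intro v hv
    rw [hI v, encodeAdj_start hv]
    rw [adjStart]
    omega
  have hnext : ∀ v < n, I (v + 1) = I v + ((AdjLists.ofAdj hadj).nb v).length := by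
    intro v hv
    rw [hlow v hv.le, hlow (v + 1) hv, adjStart_eq hadj hv.le, adjStart_eq hadj hv,
      Finset.sum_range_succ]
    omega
  refine ⟨hnext, fun v hv k hk => ?_⟩
  obtain ⟨h1, h2⟩ := encodeAdj_get hadj hv hk
  rw [hlow v hv.le, hI _ h1, h2]

/-- Stated over an abstract type so that `r` does not compete with the usual order of `Fin n`. -/
theorem exists_last {V : Type*} (r : LinearOrder V) (U : Finset V) (hU : U.Nonempty) :
    ∃ v ∈ U, ∀ u ∈ U, u ≠ v → r.lt u v :=
  ⟨U.max' hU, U.max'_mem hU, fun u hu hne => lt_of_le_of_ne (U.le_max' u hu) hne⟩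

/-- The last member of `U` in a degeneracy order has all its neighbours in `U` before it, hence at
most `d`. -/
theorem degenerate_ofAdj {d : ℕ} (hG : G.IsDegenerate d) :
    (AdjLists.ofAdj hadj).Degenerate d := by
  obtain ⟨r, hr⟩ := hG
  intro U hU hUn
  obtain ⟨x, hx⟩ := hU
  have hlt : ∀ u ∈ U, u < n := fun u hu => Finset.mem_range.1 (hUn hu)
  obtain ⟨v, hv, hmax⟩ := exists_last r (toFin n U) ⟨⟨x, hlt x hx⟩, by simpa using hx⟩
  refine ⟨v, mem_toFin.1 hv, le_trans ?_ (hr v)⟩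
  rw [← card_toFin (n := n) (fun y hy => hlt y (Finset.mem_filter.1 hy).1),
    ← Set.ncard_coe_finset]
  refine Set.ncard_le_ncard (fun u hu => ?_) (Set.toFinite _)
  have hu' := Finset.mem_filter.1 (mem_toFin.1 (Finset.mem_coe.1 hu))
  have hadj' := (mem_ofAdj hadj v u).1 hu'.2
  exact ⟨hadj', hmax u (mem_toFin.2 hu'.1) hadj'.ne'⟩

/-- Each degree splits into neighbours before and after the vertex. Exchanging summations turns the
second total into the first, which is at most `d * n`. -/
theorem sum_degrees_le {d : ℕ} (hG : G.IsDegenerate d) :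
    ∑ v ∈ Finset.range n, ((AdjLists.ofAdj hadj).nb v).length ≤ 2 * (d * n) := by
  classical
  obtain ⟨r, hr⟩ := hG
  rw [← Fin.sum_univ_eq_sum_range fun v => ((AdjLists.ofAdj hadj).nb v).length]
  have hlen : ∀ v : Fin n, ((AdjLists.ofAdj hadj).nb v).length =
      ∑ u : Fin n, ((if G.Adj v u ∧ r.lt u v then 1 else 0) +
        if G.Adj u v ∧ r.lt v u then 1 else 0) := by
    intro v
    have h1 : (adj v).toFinset = Finset.univ.filter fun u => G.Adj v u := by
      ext u
      simp [(hadj v).2 u]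
    rw [ofAdj_nb, List.length_map, ← List.toFinset_card_of_nodup (hadj v).1, h1,
      Finset.card_filter]
    refine Finset.sum_congr rfl fun u _ => ?_
    by_cases h : G.Adj v u
    · rcases @lt_trichotomy _ r u v with h' | h' | h'
      · have := @lt_asymm _ r.toPreorder _ _ h'
        simp [h, h.symm, h', this]
      · exact absurd h' h.ne'
      · have := @lt_asymm _ r.toPreorder _ _ h'
        simp [h, h.symm, h', this]
    · have h' : ¬ G.Adj u v := fun h' => h h'.symm
      simp [h, h']
  have hd : ∀ v : Fin n, (∑ u : Fin n, if G.Adj v u ∧ r.lt u v then 1 else 0) ≤ d := by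
    intro v
    rw [← Finset.card_filter]
    refine le_trans (le_of_eq ?_) (hr v)
    rw [← Set.ncard_coe_finset]
    congr 1
    ext u
    simp
  simp only [hlen, Finset.sum_add_distrib]
  rw [Finset.sum_comm (f := fun v u => if G.Adj u v ∧ r.lt v u then 1 else 0)]
  have := Finset.sum_le_sum fun (v : Fin n) (_ : v ∈ Finset.univ) => hd v
  simp only [Finset.sum_const, Finset.card_univ, Fintype.card_fin, smul_eq_mul] at this
  rw [mul_comm d n]
  omega

/-- Left neighbours in the reversed order are neighbours that were removed later. -/
theorem leftOf_reverse_length_le {A : AdjLists n} {d : ℕ} {Q : List ℕ} {o : ℕ → ℕ}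
    (hQ : A.Queue d Q n o) (hQn : Q.length = n) :
    ∀ v ∈ Q.reverse, (A.leftOf Q.reverse v).length ≤ d := by
  intro v hv
  obtain ⟨c, hc, rfl⟩ := List.getElem_of_mem hv
  have hR : Q.reverse.Nodup := List.nodup_reverse.2 hQ.nodup
  have hcn : c < n := by simpa [hQn] using hc
  set i := n - 1 - c with hi
  have hiQ : i < Q.length := by omega
  have hval : Q.reverse[c] = Q[i] := by
    rw [List.getElem_reverse]
    congr 1
    omega
  have hgood := hQ.good i hiQ (by omega)
  rw [← hval] at hgood
  refine le_trans ?_ hgood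
  have hnd : (A.leftOf Q.reverse Q.reverse[c]).Nodup :=
    (hR.sublist (List.take_sublist _ _)).filter _
  rw [← List.toFinset_card_of_nodup hnd]
  refine Finset.card_le_card fun w hw => ?_
  obtain ⟨hw1, hw2⟩ := AdjLists.mem_leftOf.1 (List.mem_toFinset.1 hw)
  rw [AdjLists.idxOf_getElem' hR hc, List.take_reverse, List.mem_reverse] at hw1
  rw [Finset.mem_filter, List.mem_toFinset]
  refine ⟨hw2, fun hw3 => ?_⟩
  have : Q.length - c = i + 1 := by omega
  rw [this] at hw1
  exact List.disjoint_take_drop hQ.nodup le_rfl hw3 hw1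

end Input

/-! ### The running time -/

/-- For each of the two sizes r ≤ s at most d^r ≤ d^s sets are expensive, where d ≥ 1 is needed; the
rest cost a constant. -/
theorem sum_setCost_le {W : List ℕ} (hW : W.Nodup) {s t d : ℕ} (hd : W.length ≤ d) (ht : t ≤ s)
    (hd1 : 1 ≤ d) :
    (W.sublists.map fun l => setCost s t d l + 2).sum ≤
      4 * 2 ^ d + 2 * (d ^ s * (d * (4 * s + 7) + 7)) := by
  set E := d * (4 * s + 7) + 7
  have h1 : (W.sublists.map fun l => setCost s t d l + 2).sum =
      ∑ Y ∈ W.toFinset.powerset, ((if Y.card = t ∨ Y.card = s then E else 0) + 4) := by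
    rw [← sum_map_sublists W hW]
    congr 1
    refine List.map_congr_left fun l hl => ?_
    rw [List.toFinset_card_of_nodup (hW.sublist (List.mem_sublists.1 hl)), setCost]
  have hc : W.toFinset.card = W.length := List.toFinset_card_of_nodup hW
  have hch : ∀ r ≤ s, ∑ Y ∈ W.toFinset.powerset, (if Y.card = r then E else 0) ≤ d ^ s * E := by
    intro r hr
    rw [← Finset.sum_filter, Finset.sum_const, ← Finset.powersetCard_eq_filter,
      Finset.card_powersetCard, hc, smul_eq_mul]
    refine Nat.mul_le_mul_right _ ((Nat.choose_le_pow _ _).trans ?_)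
    exact (Nat.pow_le_pow_left hd r).trans (Nat.pow_le_pow_right hd1 hr)
  calc (W.sublists.map fun l => setCost s t d l + 2).sum
      = ∑ Y ∈ W.toFinset.powerset, ((if Y.card = t ∨ Y.card = s then E else 0) + 4) := h1
    _ ≤ ∑ Y ∈ W.toFinset.powerset, ((if Y.card = t then E else 0) +
          (if Y.card = s then E else 0) + 4) := by
        refine Finset.sum_le_sum fun Y _ => ?_
        split_ifs <;> omega
    _ ≤ d ^ s * E + d ^ s * E + 2 ^ d * 4 := by
        rw [Finset.sum_add_distrib, Finset.sum_add_distrib, Finset.sum_const, smul_eq_mul,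
          Finset.card_powerset, hc]
        have := Nat.pow_le_pow_right (n := 2) (by norm_num) hd
        have h2 := hch t ht
        have h3 := hch s le_rfl
        have h4 := Nat.mul_le_mul_right 4 this
        omega
    _ = 4 * 2 ^ d + 2 * (d ^ s * E) := by ring

theorem total_le {n d s t M T : ℕ} (hn : 1 ≤ n) (hd : 1 ≤ d) (ht : t ≤ s) (hs : 1 ≤ s)
    (hM : M ≤ 2 * (d * n))
    (hT : T ≤ 4 * (n + 1 + M) + 5 * n + (d + 1) * (5 * n + 5) + (7 * M + 6 * n) +
      5 * ((n + 1) * s) + 5 * ((n + 1) * t) +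
      (n * (21 * 2 ^ d + 2 * (d ^ s * (d * (4 * s + 7) + 7)) + 9) + 7 * M) + 20) :
    T ≤ 400 * (d * 2 ^ d * n + n * (4 * d) ^ s * d * s ^ 3) := by
  have hX1 : d * n ≤ d * 2 ^ d * n := by
    rw [mul_right_comm]
    exact Nat.le_mul_of_pos_right _ (by positivity)
  have hX2 : n ≤ d * n := Nat.le_mul_of_pos_left _ hd
  have hX3 : n * 2 ^ d ≤ d * 2 ^ d * n := by
    rw [mul_assoc, mul_comm n]
    exact Nat.le_mul_of_pos_left _ hd
  have hY0 : d ^ s ≤ (4 * d) ^ s := Nat.pow_le_pow_left (by omega) s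
  have hs3 : s ≤ s ^ 3 := Nat.le_self_pow (by norm_num) s
  have hY1 : n * (d ^ s * (d * s)) ≤ n * (4 * d) ^ s * d * s ^ 3 := by
    calc n * (d ^ s * (d * s)) = n * d ^ s * d * s := by ring
      _ ≤ n * (4 * d) ^ s * d * s ^ 3 := by gcongr
  have hY2 : n * s ≤ n * (d ^ s * (d * s)) := by
    refine Nat.mul_le_mul_left n ?_
    rw [← mul_assoc]
    exact Nat.le_mul_of_pos_left _ (by positivity)
  have hE : n * (2 * (d ^ s * (d * (4 * s + 7) + 7))) ≤ 36 * (n * (d ^ s * (d * s))) := by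
    have : d * (4 * s + 7) + 7 ≤ 18 * (d * s) := by nlinarith
    calc n * (2 * (d ^ s * (d * (4 * s + 7) + 7)))
        ≤ n * (2 * (d ^ s * (18 * (d * s)))) := by gcongr
      _ = 36 * (n * (d ^ s * (d * s))) := by ring
  have hst : (n + 1) * t ≤ (n + 1) * s := Nat.mul_le_mul_left _ ht
  have hns : (n + 1) * s ≤ 2 * (n * s) := by nlinarith
  have hdn : (d + 1) * (5 * n + 5) ≤ 20 * (d * n) := by nlinarith
  have hsum : n * (21 * 2 ^ d + 2 * (d ^ s * (d * (4 * s + 7) + 7)) + 9) =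
      21 * (n * 2 ^ d) + n * (2 * (d ^ s * (d * (4 * s + 7) + 7))) + 9 * n := by ring
  rw [hsum] at hT
  -- With the nonlinear products replaced by atoms, the collected inequalities imply the bound by
  -- linear arithmetic.
  generalize n * (2 * (d ^ s * (d * (4 * s + 7) + 7))) = e1 at *
  generalize n * (d ^ s * (d * s)) = e2 at *
  generalize n * (4 * d) ^ s * d * s ^ 3 = e3 at *
  generalize d * 2 ^ d * n = e4 at *
  generalize n * 2 ^ d = e5 at *
  generalize (d + 1) * (5 * n + 5) = e6 at *
  generalize (n + 1) * t = e7 at *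
  generalize (n + 1) * s = e8 at *
  generalize n * s = e9 at *
  generalize d * n = e10 at *
  omega

end Biclique

namespace Biclique

/-! ### The whole algorithm -/

/-- Count the bicliques. A graph without edges, recognised by the size of the input, contains
none. -/
def main : Cmd :=
  .ite (.eq (.var .top) (.add (.var .n) (.lit 1))) (.set .n (.lit 0))
    (copyInput ;; initTables ;; eliminate ;; binomials .bin .s ;; binomials .bin2 .t ;;
      countAll ;; .set .n (.var .res))

variable {n : ℕ} {G : SimpleGraph (Fin n)} {adj : Fin n → List (Fin n)}

theorem copyCount_bot {s t : ℕ} (ht : 1 ≤ t) (hs : 1 ≤ s) (hG : ∀ u v, ¬ G.Adj u v) :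
    G.copyCount (completeBipartiteGraph (Fin s) (Fin t)) = 0 := by
  rw [SimpleGraph.copyCount_eq_zero]
  rintro ⟨f⟩
  refine hG _ _ (f.toHom.map_adj (v := Sum.inl ⟨0, hs⟩) (w := Sum.inr ⟨0, ht⟩) ?_)
  simp

theorem sum_vertexCost_le {A : AdjLists n} {R : List ℕ} {s t d : ℕ} (hR : R.Nodup)
    (hRn : ∀ v, v ∈ R ↔ v < n) (hRl : R.length = n) (hd : ∀ v ∈ R, (A.leftOf R v).length ≤ d)
    (hts : t ≤ s) (hd1 : 1 ≤ d) :
    ∑ c ∈ Finset.range n, (vertexCost A R s t d c + 2) ≤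
      n * (21 * 2 ^ d + 2 * (d ^ s * (d * (4 * s + 7) + 7)) + 9) +
        7 * ∑ v ∈ Finset.range n, (A.nb v).length := by
  have hdeg : ∑ c ∈ Finset.range n, (A.nb (R.getD c 0)).length =
      ∑ v ∈ Finset.range n, (A.nb v).length := by
    have hset : R.toFinset = Finset.range n := by
      ext v
      simp [hRn]
    rw [← hset, List.sum_toFinset (fun v => (A.nb v).length) hR, hset,
      ← sum_range_getD R 0 fun v => (A.nb v).length, hRl]
  rw [← hdeg, Finset.mul_sum]
  set E := 21 * 2 ^ d + 2 * (d ^ s * (d * (4 * s + 7) + 7)) + 9 with hE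
  have : n * E = ∑ c ∈ Finset.range n, E := by simp
  rw [this, ← Finset.sum_add_distrib]
  refine Finset.sum_le_sum fun c hc => ?_
  have hcR : c < R.length := by simpa [hRl] using hc
  have hmem : R.getD c 0 ∈ R := by
    rw [List.getD_eq_getElem _ _ hcR]
    exact List.getElem_mem _
  have h1 := hd _ hmem
  have h2 := sum_setCost_le (s := s) (t := t)
    (show (A.leftOf R (R.getD c 0)).Nodup from (hR.sublist (List.take_sublist _ _)).filter _) h1
    hts hd1
  have h3 := Nat.pow_le_pow_right (n := 2) (by norm_num) h1
  rw [vertexCost]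
  omega

theorem wp_main (hadj : G.IsAdjList adj) {d s t : ℕ} (hG : G.IsDegenerate d) (ht : 1 ≤ t)
    (hts : t ≤ s) {inp : ℕ → ℕ} (hinp : ∀ i < adjStart adj n, inp i = (encodeAdj adj).getD i 0)
    (h : Store) (hn : h.v .n = n) (hs' : h.v .s = s) (ht' : h.v .t = t)
    (htop : h.v .top = adjStart adj n) (hzero : ∀ a, h.a a = fun _ => 0) (htime : h.time = 0) :
    wp inp (adjStart adj n) main h fun h' =>
      h'.v .n = G.copyCount (completeBipartiteGraph (Fin s) (Fin t)) ∧
      h'.time ≤ 400 * (d * 2 ^ d * n + n * (4 * d) ^ s * d * s ^ 3) + 2 := by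
  set A := AdjLists.ofAdj hadj with hA
  have hN : adjStart adj n = n + 1 + ∑ v ∈ Finset.range n, (A.nb v).length :=
    adjStart_eq hadj le_rfl
  have hM := sum_degrees_le hadj hG
  rw [← hA] at hM
  set M := ∑ v ∈ Finset.range n, (A.nb v).length with hMdef
  refine ⟨fun hb => ?_, fun hb => ?_⟩
  -- For `d = 0` the two terms containing `n` vanish, so an edgeless graph has to be settled in
  -- constant time.
  · simp only [Cond.eval, Exp.eval, htop, hn] at hb
    have hM0 : M = 0 := by omega
    refine ⟨?_, by simp [htime]⟩
    rw [copyCount_bot ht (ht.trans hts)]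
    · simp
    · intro u v huv
      have h1 := (mem_ofAdj hadj u v).2 huv
      have h2 := Finset.sum_eq_zero_iff.1 hM0 u (Finset.mem_range.2 u.2)
      rw [List.length_eq_zero_iff.1 h2] at h1
      simp at h1
  simp only [Cond.eval, Exp.eval, htop, hn] at hb
  -- An edge exists, so the degree sum, which is at most `2 * (d * n)`, is positive.
  have hM0 : 0 < d * n := by omega
  have hd1 : 1 ≤ d := Nat.pos_of_ne_zero fun h0 => by simp [h0] at hM0
  have hn1 : 1 ≤ n := Nat.pos_of_ne_zero fun h0 => by simp [h0] at hM0
  simp only [wp]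
  refine wp_mono (wp_agree (wp_copyInput h.tick (by simpa using htop)))
    fun h₁ ⟨⟨hI₁, ht₁⟩, A₁⟩ => ?_
  refine wp_mono (wp_agree (wp_initTables h₁)) fun h₂ ⟨⟨hT₂, ht₂⟩, A₂⟩ => ?_
  have hst := stored_of_eq hadj fun i hi => (hI₁ i hi).trans (hinp i hi)
  have hn₁ : h₁.v .n = n := by rw [A₁.v .n (by decide)]; exact hn
  have hn₂ : h₂.v .n = n := by rw [A₂.v .n (by decide), hn₁]
  have hI₂ : A.Stored (h₂.a .input) := by rw [A₂.a .input (by decide)]; exact hst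
  rw [hn₁] at hT₂ ht₂
  refine wp_mono (wp_agree (wp_eliminate (degenerate_ofAdj hadj hG) h₂ hI₂ hn₂ fun v hv => ?_))
    fun h₃ ⟨⟨⟨Q, hQ, hQn⟩, ht₃⟩, A₃⟩ => ?_
  · rw [(hT₂ v hv).1, hst.next v hv, Nat.add_sub_cancel_left]
  have hn₃ : h₃.v .n = n := by rw [A₃.v .n (by decide), hn₂]
  have hs₃ : h₃.v .s = s := by
    rw [A₃.v .s (by decide), A₂.v .s (by decide), A₁.v .s (by decide)]; exact hs'
  have ht₃' : h₃.v .t = t := by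
    rw [A₃.v .t (by decide), A₂.v .t (by decide), A₁.v .t (by decide)]; exact ht'
  refine wp_mono (wp_agree (wp_binomials .bin .s (.inl rfl) h₃ (by omega)))
    fun h₄ ⟨⟨hB₄, ht₄⟩, A₄⟩ => ?_
  have hn₄ : h₄.v .n = n := by rw [A₄.v .n (by decide), hn₃]
  have ht₄' : h₄.v .t = t := by rw [A₄.v .t (by decide), ht₃']
  refine wp_mono (wp_agree (wp_binomials .bin2 .t (.inr rfl) h₄ (by omega)))
    fun h₅ ⟨⟨hB₅, ht₅⟩, A₅⟩ => ?_
  rw [hn₃, hs₃] at hB₄ ht₄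
  rw [hn₄, ht₄'] at hB₅ ht₅
  have hR : Q.reverse.Nodup := List.nodup_reverse.2 hQ.nodup
  have hRl : Q.reverse.length = n := by simpa using hQn
  have hRn : ∀ v, v ∈ Q.reverse ↔ v < n := by
    have hsub : Q.toFinset ⊆ Finset.range n := fun u hu =>
      Finset.mem_range.2 (hQ.lt u (List.mem_toFinset.1 hu))
    have heq : Q.toFinset = Finset.range n := Finset.eq_of_subset_of_card_le hsub (by
      rw [List.toFinset_card_of_nodup hQ.nodup, hQn, Finset.card_range])
    intro v
    rw [List.mem_reverse, ← List.mem_toFinset, heq, Finset.mem_range]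
  have hleft := leftOf_reverse_length_le hQ hQn
  refine wp_mono (wp_countAll (A := A) (by omega) hR hRn hRl hleft ht hts h₅
    (by rw [A₅.v .n (by decide), hn₄])
    (by rw [A₅.v .s (by decide), A₄.v .s (by decide), hs₃])
    (by rw [A₅.v .t (by decide), ht₄'])
    (by rw [A₅.a .input (by decide), A₄.a .input (by decide), A₃.a .input (by decide)]; exact hI₂)
    (fun c hc => ?_)
    (fun v hv => by
      rw [A₅.a .mul (by decide), A₄.a .mul (by decide), A₃.a .mul (by decide), (hT₂ v hv).2])
    (fun x hx => by rw [A₅.a .bin (by decide), hB₄ x hx]) hB₅ (fun a ha => ?_))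
    fun h₆ ⟨hres, ht₆⟩ => ⟨?_, ?_⟩
  · have hcn : c < n := by omega
    rw [A₅.a .ord (by decide), A₄.a .ord (by decide), hQ.get (n - 1 - c) (by omega),
      List.getElem_reverse]
    congr 1
    omega
  · have hne : a ∉ copyInput.arrs ∧ a ∉ initTables.arrs ∧ a ∉ eliminate.arrs ∧
        a ∉ (binomials .bin .s).arrs ∧ a ∉ (binomials .bin2 .t).arrs := by
      rcases ha with rfl | rfl | rfl | rfl | rfl | rfl <;> decide
    rw [A₅.a a hne.2.2.2.2, A₄.a a hne.2.2.2.1, A₃.a a hne.2.2.1, A₂.a a hne.2.1, A₁.a a hne.1]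
    exact hzero a
  · simp only [Store.set_v, if_true, Exp.eval]
    rw [hres, sum_pairs_eq s t hR, card_triples (mem_ofAdj hadj) hR hRn hRl ht (ht.trans hts)]
  · refine (total_le hn1 hd1 hts (ht.trans hts) hM ?_).trans (Nat.le_add_right _ _)
    have hv := sum_vertexCost_le (A := A) (s := s) hR hRn hRl hleft hts hd1
    have hc : ∑ v ∈ Finset.range n, A.cost v = 7 * M + 6 * n := by
      simp only [AdjLists.cost, Finset.sum_add_distrib, ← Finset.mul_sum, Finset.sum_const,
        Finset.card_range, smul_eq_mul]
      rw [mul_comm n]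
    simp only [Store.set_time, Store.tick_time, htime] at ht₁ ⊢
    rw [hc] at ht₃
    rw [hN] at ht₁
    omega

end Biclique

open Biclique RAM in
theorem mainTheorem9 :
    ∃ (P : RAM.Prog) (c : ℕ), ∀ (n d s t : ℕ) (G : SimpleGraph (Fin n))
      (adj : Fin n → List (Fin n)),
      1 ≤ t → t ≤ s → G.IsDegenerate d → G.IsAdjList adj →
      ∃ (T : ℕ) (τ : RAM.State), RAM.Runs P (inputState adj s t) T τ ∧
        τ.reg 0 = G.copyCount (completeBipartiteGraph (Fin s) (Fin t)) ∧
        T ≤ c * (s * (2 * s).factorial + d * 2 ^ d * n + n * (4 * d) ^ s * d * s ^ 3) := by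
  obtain ⟨P, K, hP⟩ := cmd_compiles Biclique.main
  -- Four instructions bring t and s into the registers of their variables, fetch the end of the
  -- input from cell n of the address table into register 1, and copy it to `top`. Register 0 is the
  -- variable `n`, which also receives the result.
  refine ⟨.seq (.instr (.move 4 2)) (.seq (.instr (.move 2 1)) (.seq (.instr (.load 1 0))
    (.seq (.instr (.move 6 1)) P))), 4 + 402 * K, fun n d s t G adj ht hts hG hadj => ?_⟩
  set N := adjStart adj n with hN
  -- All cells behind the input are zero, so every array starts out zero.
  have hmem : ∀ i, N ≤ i → (encodeAdj adj).getD i 0 = 0 := fun i hi =>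
    List.getD_eq_default _ _ (by rw [length_encodeAdj hadj]; exact hi)
  have hload : (encodeAdj adj).getD n 0 = N := encodeAdj_start le_rfl
  obtain ⟨T, τ, h', hrun, hrep, ⟨hcount, hle⟩, htime, -⟩ := hP (fun i => (encodeAdj adj).getD i 0) N
    ((((((inputState adj s t).setReg 4 t).setReg 2 s).setReg 1 N).setReg 6 N))
    ⟨fun b => match b with | .n => n | .s => s | .t => t | .top => N | _ => 0, fun _ _ => 0, 0⟩ _
    ⟨fun b => by cases b <;> simp [State.setReg, inputState, Var.idx],
      by simp [State.setReg], fun j _ => rfl, fun a i => hmem _ (by omega)⟩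
    (wp_main hadj hG ht hts (fun _ _ => rfl) _ rfl rfl rfl rfl (fun _ => rfl) rfl)
  refine ⟨1 + (1 + (1 + (1 + T))), τ, .seq (.instr _ _) (.seq (.instr _ _) (.seq (.instr _ _)
    (.seq (.instr _ _) ?_))), by simpa [Var.idx, hcount] using hrep.reg .n, ?_⟩
  · convert hrun using 1
    simp [Instr.exec, State.setReg, inputState, ← hload]
  -- The factorial term is only used to dominate the constant 1.
  · have hF : 1 ≤ s * (2 * s).factorial := Nat.mul_pos (by omega) (Nat.factorial_pos _)
    set X := d * 2 ^ d * n + n * (4 * d) ^ s * d * s ^ 3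
    have h1 : T ≤ K * (400 * X + 2) := by
      simp only [mul_zero, add_zero] at htime
      exact htime.trans (Nat.mul_le_mul_left K hle)
    have h2 : K * (400 * X + 2) ≤ 402 * K * (1 + X) := by nlinarith
    calc 1 + (1 + (1 + (1 + T))) ≤ (4 + 402 * K) * (1 + X) := by nlinarith
      _ ≤ (4 + 402 * K) * (s * (2 * s).factorial + d * 2 ^ d * n +
          n * (4 * d) ^ s * d * s ^ 3) := Nat.mul_le_mul_left _ (by omega)
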